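/- Let $n\ge 1$ and let $\mathbb Z=X\sqcup\Xi$ be a partition of $\mathbb Z$ into two non-empty subsets, each stable under translation by $n$. A permutation $w$ of $\mathbb Z$ is $n$-periodic if $w(i+n)=w(i)+n$ for all $i$; its total shift is $\frac1n\sum_{x=1}^n(w(x)-x)$. For $u_1,\dots,u_k$ distinct modulo $n$, $(u_1,\dots,u_k)_{[h]}$ denotes the $n$-periodic permutation (a cycle) mapping $u_i$ to $u_{i+1}$ for $1\le i<k$ and $u_k$ to $u_1+hn$, and fixing all integers not congruent to some $u_i$; write $(u_1,\dots,u_k)$ for $h=0$. The reflections are the permutations $(a,b)$ with $a\not\equiv b \pmod n$, and $l$ denotes the length with respect to the set of all reflections on the group they generate (the $n$-periodic permutations of total shift $0$, a Coxeter group of type $\tilde A_{n-1}$). Latin letters denote elements of $X$, Greek letters elements of $\Xi$. A cycle is positive and self non-crossing if it is of the form $(a_1,\dots,a_k,\alpha_1,\dots,\alpha_l)$ with $k+l\geq 1$, or $(a_1,\dots,a_k)_{[1]}$, or $(\alpha_1,\dots,\alpha_l)_{[-1]}$, with $a_1<\dots<a_k<a_1+n$ and $\alpha_1>\dots>\alpha_l>\alpha_1-n$.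 Put $a_{k+1}=a_1+n$ and $\alpha_{l+1}=\alpha_1-n$. Two such cycles are non-crossing if, in some order, one of the following holds: 1. one is of the form $(a_1,\dots,a_k)$ or $(a_1,\dots,a_k)_{[1]}$ and the other of the form $(\alpha_1,\dots,\alpha_l)$ or $(\alpha_1,\dots,\alpha_l)_{[-1]}$; 2. they are $(a_1,\dots,a_k,\alpha_1,\dots,\alpha_l)$ and $(b_1,\dots,b_q,\beta_1,\dots,\beta_r)$ with $k,l,q,r>0$, $a_k<b_i<a_1+n$ and $\alpha_1<\beta_i<\alpha_l+n$ for all $i$; 3. one is $(a_1,\dots,a_k,\alpha_1,\dots,\alpha_l)$ with $k,l\ge0$ and the other is $(b_1,\dots,b_m)$ with $a_j<b_i<a_{j+1}$ for some $j$ and all $i$ (no condition if $k=0$), or $(\beta_1,\dots,\beta_m)$ with $\alpha_{j+1}<\beta_i<\alpha_j$ for some $j$ and all $i$ (no condition if $l=0$); 4. they are $(a_1,\dots,a_k)_{[1]}$ and $(b_1,\dots,b_m)$ with $a_j<b_i<a_{j+1}$ for some $j$ and all $i$, or $(\alpha_1,\dots,\alpha_l)_{[-1]}$ and $(\beta_1,\dots,\beta_m)$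 with $\alpha_{j+1}<\beta_i<\alpha_j$ for some $j$ and all $i$. The $\tilde A_{n-1}$ dual germ $P$ is the set of $n$-periodic permutations of total shift $0$ that are products of disjoint, pairwise non-crossing, positive self non-crossing cycles; the product of $u,v\in P$ is defined in $P$, and equal to the product of permutations $uv$, when $uv\in P$ and $l(uv)=l(u)+l(v)$. An element $v\in P$ left (resp. right) divides $w\in P$ if $w=vu$ (resp. $w=uv$) for some $u\in P$ such that this product is defined in $P$. For $w\in P$ let $p_w$ be the partition of $\mathbb Z$ whose parts are the finite orbits of $w$ and, if $w$ has infinite orbits, their union. In the strip $\mathbb R\times[0,1]$ represent $x\in X$ by $(x,0)$ and $\xi\in\Xi$ by $(\xi,1)$. Two subsets $A,B$ of $\mathbb Z$ are non-crossing if for all $a,a'\in A$ and $b,b'\in B$ there are disjoint paths in the strip, one from $a$ to $a'$ and one from $b$ to $b'$; a partition is non-crossing if any two distinct parts are. Let $\mathcal N$ be the set of non-crossing partitions of $\mathbb Z$ that are invariant under translation by $n$ and all of whose infinite parts meet both $X$ and $\Xi$, ordered by refinement (finer partitions being smaller). **Proposition.** Left and right divisibility in $P$ coincide and define a partial order on $P$,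 and $w\mapsto p_w$ is a well-defined bijection $P\to\mathcal N$ which is an isomorphism of posets: for $v,w\in P$, $v$ divides $w$ in $P$ if and only if $p_v$ is finer than (or equal to) $p_w$. -/

import Mathlib

namespace AffineDual

open Equiv

/-! ### Periodic permutations of the integers and their cycles -/

/-- `n`-periodic permutations of `ℤ`. -/
def IsPeriodic (n : ℕ) (w : Perm ℤ) : Prop :=
  ∀ i : ℤ, w (i + n) = w i + n

/-- The total shift `(1/n) ∑_{x=1}^{n} (w(x) - x)`. -/
noncomputable def totalShift (n : ℕ) (w : Perm ℤ) : ℚ :=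
  (1 / (n : ℚ)) * ∑ x ∈ Finset.Icc (1 : ℤ) n, ((w x : ℚ) - (x : ℚ))

/-- The word `a₁, …, a_k, a₁ + h n` obtained by closing up `a₁, …, a_k` with shift `h`. -/
def closeUp (n : ℕ) (h : ℤ) : List ℤ → List ℤ
  | [] => []
  | a :: L => (a :: L) ++ [a + h * n]

/-- `u` is the periodic cycle `(a₁, …, a_k)_{[h]}`, where `L = [a₁, …, a_k]` is non-empty and has
entries distinct modulo `n`: it maps `a_i` to `a_{i+1}` for `i < k` and `a_k` to `a₁ + h n`, acts
correspondingly on the translates by multiples of `n`, and fixes all other integers.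
For `h = 0` this is the finite cycle `(a₁, …, a_k)`. -/
def IsCycleWord (n : ℕ) (L : List ℤ) (h : ℤ) (u : Perm ℤ) : Prop :=
  L ≠ [] ∧ L.Pairwise (fun x y => ¬ (n : ℤ) ∣ x - y) ∧
  (∀ y z : ℤ, [y, z] <:+: closeUp n h L → ∀ m : ℤ, u (y + m * n) = z + m * n) ∧
  (∀ z : ℤ, (∀ x ∈ L, ¬ (n : ℤ) ∣ z - x) → u z = z)

/-- The reflections of the Coxeter group of type `Ã_{n-1}`: the permutations `(a, b)` with `a`
and `b` distinct modulo `n`. -/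
def IsReflection (n : ℕ) (r : Perm ℤ) : Prop :=
  ∃ a b : ℤ, ¬ (n : ℤ) ∣ a - b ∧ IsCycleWord n [a, b] 0 r

/-- Length with respect to the set of all reflections. (It is only used for periodic permutations
with total shift `0`, all of which are products of reflections.) -/
noncomputable def reflLength (n : ℕ) (w : Perm ℤ) : ℕ :=
  sInf {k : ℕ | ∃ L : List (Perm ℤ), (∀ r ∈ L, IsReflection n r) ∧ L.prod = w ∧ L.length = k}

/-! ### Positive self non-crossing permutations -/

/-- `a₁ < a₂ < ⋯ < a_k < a₁ + n`, all `a_i` in `X`. -/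
def IsIncreasingWord (n : ℕ) (X : Set ℤ) (A : List ℤ) : Prop :=
  (∀ a ∈ A, a ∈ X) ∧ (closeUp n 1 A).Pairwise (· < ·)

/-- `α₁ > α₂ > ⋯ > α_l > α₁ - n`, all `α_j` in `Ξ`. -/
def IsDecreasingWord (n : ℕ) (Ξ : Set ℤ) (B : List ℤ) : Prop :=
  (∀ β ∈ B, β ∈ Ξ) ∧ (closeUp n (-1) B).Pairwise (· > ·)

/-- `u` is the positive self non-crossing finite cycle `(a₁, …, a_k, α₁, …, α_l)`. -/
def IsFinCycle (n : ℕ) (X Ξ : Set ℤ) (A B : List ℤ) (u : Perm ℤ) : Prop :=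
  IsIncreasingWord n X A ∧ IsDecreasingWord n Ξ B ∧ IsCycleWord n (A ++ B) 0 u

/-- `u` is the positive self non-crossing infinite cycle `(a₁, …, a_k)_{[1]}`. -/
def IsInfCycleX (n : ℕ) (X : Set ℤ) (A : List ℤ) (u : Perm ℤ) : Prop :=
  IsIncreasingWord n X A ∧ IsCycleWord n A 1 u

/-- `u` is the positive self non-crossing infinite cycle `(α₁, …, α_l)_{[-1]}`. -/
def IsInfCycleXi (n : ℕ) (Ξ : Set ℤ) (B : List ℤ) (u : Perm ℤ) : Prop :=
  IsDecreasingWord n Ξ B ∧ IsCycleWord n B (-1) u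

/-- Positive self non-crossing cycles. -/
def IsPositiveCycle (n : ℕ) (X Ξ : Set ℤ) (u : Perm ℤ) : Prop :=
  (∃ A B, IsFinCycle n X Ξ A B u) ∨ (∃ A, IsInfCycleX n X A u) ∨ (∃ B, IsInfCycleXi n Ξ B u)

/-- There is some `j` with `a_j < b_i < a_{j+1}` for all `i`, where `A = [a₁, …, a_k]` and
`a_{k+1} = a₁ + n`; there is no condition if `k = 0`. -/
def InGapX (n : ℕ) (A A' : List ℤ) : Prop :=
  A = [] ∨ ∃ y z : ℤ, [y, z] <:+: closeUp n 1 A ∧ ∀ b ∈ A', y < b ∧ b < z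

/-- There is some `j` with `α_{j+1} < β_i < α_j` for all `i`, where `B = [α₁, …, α_l]` and
`α_{l+1} = α₁ - n`; there is no condition if `l = 0`. -/
def InGapXi (n : ℕ) (B B' : List ℤ) : Prop :=
  B = [] ∨ ∃ y z : ℤ, [y, z] <:+: closeUp n (-1) B ∧ ∀ β ∈ B', z < β ∧ β < y

/-- The four ways in which the ordered pair of positive self non-crossing cycles `u`, `v` can be
non-crossing. -/
def NonCrossingOrdered (n : ℕ) (X Ξ : Set ℤ) (u v : Perm ℤ) : Prop :=
  -- `u` only moves elements of `X` and `v` only moves elements of `Ξ`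
  (((∃ A, IsFinCycle n X Ξ A [] u) ∨ (∃ A, IsInfCycleX n X A u)) ∧
    ((∃ B, IsFinCycle n X Ξ [] B v) ∨ (∃ B, IsInfCycleXi n Ξ B v))) ∨
  -- `u = (a₁, …, a_k, α₁, …, α_l)`, `v = (b₁, …, b_q, β₁, …, β_r)` with `k, l, q, r > 0`,
  -- `a_k < b_i < a₁ + n` and `α₁ < β_i < α_l + n`
  (∃ A B A' B' : List ℤ, A ≠ [] ∧ B ≠ [] ∧ A' ≠ [] ∧ B' ≠ [] ∧
    IsFinCycle n X Ξ A B u ∧ IsFinCycle n X Ξ A' B' v ∧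
    (∀ a ∈ A, ∀ b ∈ A', a < b ∧ b < a + n) ∧ (∀ α ∈ B, ∀ β ∈ B', α < β ∧ β < α + n)) ∨
  -- `u` is finite, `v` is finite and contained in `X` or in `Ξ`
  (∃ A B : List ℤ, IsFinCycle n X Ξ A B u ∧
    ((∃ A', IsFinCycle n X Ξ A' [] v ∧ InGapX n A A') ∨
      (∃ B', IsFinCycle n X Ξ [] B' v ∧ InGapXi n B B'))) ∨
  -- `u` is infinite, `v` is finite
  ((∃ A A' : List ℤ, IsInfCycleX n X A u ∧ IsFinCycle n X Ξ A' [] v ∧ InGapX n A A') ∨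
    (∃ B B' : List ℤ, IsInfCycleXi n Ξ B u ∧ IsFinCycle n X Ξ [] B' v ∧ InGapXi n B B'))

/-- Non-crossing pairs of positive self non-crossing cycles. -/
def NonCrossingCycles (n : ℕ) (X Ξ : Set ℤ) (u v : Perm ℤ) : Prop :=
  NonCrossingOrdered n X Ξ u v ∨ NonCrossingOrdered n X Ξ v u

/-- Positive self non-crossing permutations: products of disjoint, pairwise non-crossing,
positive self non-crossing cycles. -/
def IsPositiveNonCrossing (n : ℕ) (X Ξ : Set ℤ) (w : Perm ℤ) : Prop :=
  ∃ L : List (Perm ℤ), (∀ u ∈ L, IsPositiveCycle n X Ξ u) ∧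
    L.Pairwise (fun u v => Perm.Disjoint u v ∧ NonCrossingCycles n X Ξ u v) ∧ L.prod = w

/-! ### The dual germ of type `Ã_{n-1}` and its divisibility relations -/

/-- The underlying set of the germ `P`: the positive self non-crossing `n`-periodic permutations
lying in the Coxeter group of type `Ã_{n-1}`, that is, having total shift `0`. -/
def DualGerm (n : ℕ) (X Ξ : Set ℤ) : Type :=
  {w : Perm ℤ // IsPeriodic n w ∧ totalShift n w = 0 ∧ IsPositiveNonCrossing n X Ξ w}

/-- The partial product of the germ: the product of `u` and `v` is defined and equal to `w`. -/
def IsGermProduct {n : ℕ} {X Ξ : Set ℤ} (u v w : DualGerm n X Ξ) : Prop :=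
  u.1 * v.1 = w.1 ∧ reflLength n w.1 = reflLength n u.1 + reflLength n v.1

/-- Left divisibility in the germ. -/
def LeftDivides {n : ℕ} {X Ξ : Set ℤ} (v w : DualGerm n X Ξ) : Prop :=
  ∃ u : DualGerm n X Ξ, IsGermProduct v u w

/-- Right divisibility in the germ. -/
def RightDivides {n : ℕ} {X Ξ : Set ℤ} (v w : DualGerm n X Ξ) : Prop :=
  ∃ u : DualGerm n X Ξ, IsGermProduct u v w

/-! ### Non-crossing partitions of the integers

A partition of `ℤ` is given by a `Setoid ℤ`, whose classes are the parts; `p ≤ q` means that `p`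
is finer than `q`. -/

/-- The closed strip between the parallel lines `y = 0` and `y = 1`. -/
def strip : Set (ℝ × ℝ) := {p | 0 ≤ p.2 ∧ p.2 ≤ 1}

open Classical in
/-- The point of the boundary of the strip that represents an integer: the elements of `X` are
placed in increasing order on the line `y = 0`, those of its complement `Ξ` on the line `y = 1`. -/
noncomputable def stripPoint (X : Set ℤ) (z : ℤ) : ℝ × ℝ :=
  ((z : ℝ), if z ∈ X then 0 else 1)

/-- Non-crossing subsets `A`, `B` of `ℤ = X ∪ Ξ`: any two points of `A` and any two points of `B`
can be joined by paths in the strip that do not meet. -/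
def NonCrossingSets (X A B : Set ℤ) : Prop :=
  ∀ a ∈ A, ∀ a' ∈ A, ∀ b ∈ B, ∀ b' ∈ B,
    ∃ (γ : Path (stripPoint X a) (stripPoint X a')) (δ : Path (stripPoint X b) (stripPoint X b')),
      Set.range γ ⊆ strip ∧ Set.range δ ⊆ strip ∧ Disjoint (Set.range γ) (Set.range δ)

/-- Non-crossing partitions: any two (distinct) parts are non-crossing. -/
def IsNonCrossingPartition (X : Set ℤ) (p : Setoid ℤ) : Prop :=
  ∀ A ∈ p.classes, ∀ B ∈ p.classes, A ≠ B → NonCrossingSets X A B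

/-- Partitions invariant by translation by `n`. -/
def IsPeriodicPartition (n : ℕ) (p : Setoid ℤ) : Prop :=
  ∀ x y : ℤ, p (x + n) (y + n) ↔ p x y

/-- The non-crossing `n`-periodic partitions of `ℤ` all of whose infinite parts meet both `X`
and `Ξ`, ordered by refinement. -/
abbrev PeriodicNCPartition (n : ℕ) (X Ξ : Set ℤ) : Type :=
  {p : Setoid ℤ // IsPeriodicPartition n p ∧ IsNonCrossingPartition X p ∧
    ∀ A ∈ p.classes, A.Infinite → (A ∩ X).Nonempty ∧ (A ∩ Ξ).Nonempty}

/-- The orbit of `x` under (the group generated by) `w`. -/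
def orbitOf (w : Perm ℤ) (x : ℤ) : Set ℤ := {y | w.SameCycle x y}

/-- The partition `p_w`: its parts are the finite orbits of `w` and the union of the infinite
orbits of `w`, if there are any. -/
def orbitPartition (w : Perm ℤ) : Setoid ℤ where
  r x y := w.SameCycle x y ∨ ((orbitOf w x).Infinite ∧ (orbitOf w y).Infinite)
  iseqv :=
    { refl := fun x => Or.inl (Perm.SameCycle.refl w x)
      symm := fun h => h.imp (fun h => h.symm) (fun h => ⟨h.2, h.1⟩)
      trans := by
        have key : ∀ x y : ℤ, w.SameCycle x y → orbitOf w x = orbitOf w y := fun x y h =>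
          Set.ext fun z => ⟨fun hz => h.symm.trans hz, fun hz => h.trans hz⟩
        rintro x y z (h | h) (h' | h')
        · exact Or.inl (h.trans h')
        · exact Or.inr ⟨by rw [key x y h]; exact h'.1, h'.2⟩
        · exact Or.inr ⟨h.1, by rw [← key y z h']; exact h.2⟩
        · exact Or.inr ⟨h.1, h'.2⟩ }

end AffineDual

namespace AffineDual

open Equiv

/-! ### Crossing paths -/

/-! Running along the boundary of the strip, upwards through `X` and then downwards through `Ξ`,
gives a linear order `pos` on `ℤ`. Two parts of a partition cross exactly when they contain
interleaved points for this order (`isNonCrossingPartition_iff`): paths with interleaved end points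
meet (`exists_eq_of_interleaved`), and otherwise disjoint paths can be written down. After that
everything is combinatorics of the order. A partition in `𝒩` (`IsNCP`) has at most one infinite
part, since such a part is periodic and reaches both ends of the strip (`IsNCP.rel_of_infinite`).

A partition `p` in `𝒩` determines the permutation `w` sending each integer to its cyclic successor
in its part (`IsSucc`). Successors are unique, so `p` determines `w`; and `p_w = p` by
`IsNCP.orbitPartition_eq`, where uniqueness of the infinite part is needed. The elements of `P` are
exactly these permutations. A product of non-crossing cycles is the successor permutation of its
orbit partition, and total shift `0` forces infinite cycles on `X` and on `Ξ` to occur together, so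
that an infinite part meets both sides (`exists_isNCP_of_isPositiveNonCrossing`). Conversely,
restricting `w` to suitable unions of parts exhibits the cycles (`IsNCP.isPositiveNonCrossing`).

Divisibility is controlled by a linear representation. Periodic permutations act on the
`n`-dimensional space of functions with `f (x + n) = 2 * f x`. The functions fixed by `w` are those
constant on the parts of `p_w`; the factor `2` makes them vanish on infinite orbits, so that
translations are detected as well. A reflection fixes a subspace of codimension at most one, hence
the codimension of the fixed space bounds the reflection length from below. Multiplying a successor
permutation by a reflection `(a, b)` with `a`, `b` in one part, not crossing their translates, cuts
`p` along the arcs `[a, b)` (`IsNCP.split_isSucc`) and raises the fixed dimension by exactly one;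
iterating shows that length equals codimension (`IsNCP.reflLength_add`).

If lengths add in `u * v = w`, the fixed space of `w` is the intersection of those of `u` and `v`,
and inclusion of fixed spaces gives back refinement of partitions because finite parts are separated
by functions (`le_of_mul_eq`). If `p ≤ q`, cutting both by the same reflections until `p` is trivial
leaves `v⁻¹ * w` unchanged and presents it as a successor permutation
(`IsNCP.exists_left_quotient`). Exchanging the two sides of the strip inverts permutations and
yields right quotients. So both divisibility relations are refinement. -/

lemma mul_pos_of_continuous_ne_zero {g : ℝ → ℝ} (hg : Continuous g) (h0 : ∀ x, g x ≠ 0) (a b : ℝ) :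
    0 < g a * g b := by
  by_contra h
  rcases mul_nonpos_iff.1 (not_lt.1 h) with ⟨h1, h2⟩ | ⟨h1, h2⟩
  · obtain ⟨x, hx⟩ := mem_range_of_exists_le_of_exists_ge hg ⟨b, h2⟩ ⟨a, h1⟩
    exact h0 x hx
  · obtain ⟨x, hx⟩ := mem_range_of_exists_le_of_exists_ge hg ⟨a, h1⟩ ⟨b, h2⟩
    exact h0 x hx

/-- The plane is simply connected, so a non-vanishing function lifts through the covering `exp`;
half of this logarithm gives the square root. -/
lemma exists_continuous_sq_eq {F : ℝ × ℝ → ℂ} (hF : Continuous F) (h0 : ∀ x, F x ≠ 0) :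
    ∃ H : ℝ × ℝ → ℂ, Continuous H ∧ ∀ x, H x ^ 2 = F x := by
  obtain ⟨G, ⟨-, hG⟩, -⟩ := Complex.isCoveringMapOn_exp.existsUnique_continuousMap_lifts
    ⟨F, hF⟩ (a₀ := (0, 0)) (e₀ := Complex.log (F (0, 0))) (Complex.exp_log (h0 _)) h0
  refine ⟨fun x => Complex.exp (G x / 2), by fun_prop, fun x => ?_⟩
  rw [← Complex.exp_nat_mul]
  have : (2 : ℕ) * (G x / 2) = G x := by push_cast; ring
  rw [this]
  exact congrFun hG x

/-- Two paths in the closed upper half plane joining interleaved points of the real line meet. -/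
lemma exists_eq_of_interleaved {γ δ : ℝ → ℂ} (hγ : Continuous γ) (hδ : Continuous δ)
    (hγ' : ∀ t, 0 ≤ (γ t).im) (hδ' : ∀ t, 0 ≤ (δ t).im) {r₁ r₂ r₃ r₄ : ℝ}
    (h₁₂ : r₁ < r₂) (h₂₃ : r₂ < r₃) (h₃₄ : r₃ < r₄)
    (h₁ : γ 0 = r₁) (h₃ : γ 1 = r₃) (h₂ : δ 0 = r₂) (h₄ : δ 1 = r₄) : ∃ s t, γ s = δ t := by
  by_contra! hne
  -- If the paths never meet, `γ s - δ t` has a continuous square root `H`. At a corner of the unit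
  -- square the difference is real, so `H` is real or purely imaginary according to its sign;
  -- following `H` around the four edges produces incompatible signs.
  obtain ⟨H, hH, hHF⟩ := exists_continuous_sq_eq (F := fun x => γ x.1 - δ x.2) (by fun_prop)
    (fun x => sub_ne_zero.2 (hne _ _))
  have him : ∀ x, 2 * (H x).re * (H x).im = (γ x.1).im - (δ x.2).im := fun x => by
    have := congrArg Complex.im (hHF x)
    rw [sq, Complex.mul_im, Complex.sub_im] at this
    linarith
  have hre : ∀ x, (H x).re * (H x).re - (H x).im * (H x).im = (γ x.1).re - (δ x.2).re := fun x => by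
    have := congrArg Complex.re (hHF x)
    rw [sq, Complex.mul_re, Complex.sub_re] at this
    linarith
  have hH0 : ∀ x, ¬ ((H x).re = 0 ∧ (H x).im = 0) := fun x hx => by
    have : H x = 0 := Complex.ext hx.1 hx.2
    have h2 := hHF x
    rw [this] at h2
    exact hne _ _ (sub_eq_zero.1 (by simpa using h2.symm))
  have key : ∀ x y : ℝ, 0 ≤ 2 * x * y → x + y = 0 → x = 0 ∧ y = 0 := fun x y h h' => by
    have : y = -x := by linarith
    subst this
    have : x = 0 := by nlinarith [sq_nonneg x]
    simp [this]
  have key' : ∀ x y : ℝ, 2 * x * y ≤ 0 → x - y = 0 → x = 0 ∧ y = 0 := fun x y h h' => by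
    have := key x (-y) (by linarith) (by linarith)
    simpa using this
  have neg : ∀ x, (γ x.1).im = 0 → (δ x.2).im = 0 → (γ x.1).re < (δ x.2).re → (H x).re = 0 := by
    intro x h1 h2 h3
    have h4 := him x
    have h5 := hre x
    by_contra h6
    have : (H x).im = 0 := by
      have : (H x).re * (H x).im = 0 := by linarith
      exact (mul_eq_zero.1 this).resolve_left h6
    rw [this] at h5
    nlinarith [mul_self_nonneg (H x).re]
  have pos : ∀ x, (γ x.1).im = 0 → (δ x.2).im = 0 → (δ x.2).re < (γ x.1).re → (H x).im = 0 := by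
    intro x h1 h2 h3
    have h4 := him x
    have h5 := hre x
    by_contra h6
    have : (H x).re = 0 := by
      have : (H x).re * (H x).im = 0 := by linarith
      exact (mul_eq_zero.1 this).resolve_right h6
    rw [this] at h5
    nlinarith [mul_self_nonneg (H x).im]
  have e00 := neg (0, 0) (by simp [h₁]) (by simp [h₂]) (by simpa [h₁, h₂] using h₁₂)
  have e10 := pos (1, 0) (by simp [h₃]) (by simp [h₂]) (by simpa [h₃, h₂] using h₂₃)
  have e11 := neg (1, 1) (by simp [h₃]) (by simp [h₄]) (by simpa [h₃, h₄] using h₃₄)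
  have e01 := neg (0, 1) (by simp [h₁]) (by simp [h₄])
    (by simpa [h₁, h₄] using h₁₂.trans (h₂₃.trans h₃₄))
  -- On each edge one path stays at a real point, so the imaginary part of `H ^ 2` has constant
  -- sign. Hence `re + im` (or `re - im`) cannot vanish there and keeps its sign from corner to
  -- corner.
  have s1 := mul_pos_of_continuous_ne_zero (g := fun s => (H (s, 0)).re + (H (s, 0)).im)
    (by fun_prop) (fun s hs => hH0 _ (key _ _ (by rw [him]; simpa [h₂] using hγ' s) hs)) 0 1
  have s2 := mul_pos_of_continuous_ne_zero (g := fun s => (H (1, s)).re - (H (1, s)).im)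
    (by fun_prop) (fun s hs => hH0 _ (key' _ _ (by rw [him]; simpa [h₃] using hδ' s) hs)) 0 1
  have s3 := mul_pos_of_continuous_ne_zero (g := fun s => (H (s, 1)).re + (H (s, 1)).im)
    (by fun_prop) (fun s hs => hH0 _ (key _ _ (by rw [him]; simpa [h₄] using hγ' s) hs)) 0 1
  have s4 := mul_pos_of_continuous_ne_zero (g := fun s => (H (0, s)).re - (H (0, s)).im)
    (by fun_prop) (fun s hs => hH0 _ (key' _ _ (by rw [him]; simpa [h₁] using hδ' s) hs)) 0 1
  simp only [e00, e10, e11, e01] at s1 s2 s3 s4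
  generalize (H (0, 0)).im = a at *
  generalize (H (1, 0)).re = b at *
  generalize (H (1, 1)).im = c at *
  generalize (H (0, 1)).im = d at *
  have h1 : 0 < a * b := by linarith
  have h2 : b * c < 0 := by linarith
  have h3 : 0 < c * d := by linarith
  have h4 : 0 < d * a := by linarith
  have := mul_pos (mul_pos h1 h3) h4
  nlinarith [mul_self_nonneg (a * d), mul_nonneg_of_nonpos_of_nonpos h2.le h2.le]

/-! ### The boundary order of the strip -/

open Classical in
/-- The position of an integer on the boundary of the strip, in the linear order in which the
elements of `X` come first, in increasing order, followed by the others in decreasing order. -/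
noncomputable def pos (X : Set ℤ) (x : ℤ) : ℤ ×ₗ ℤ :=
  if x ∈ X then toLex (0, x) else toLex (1, -x)

lemma pos_lt_pos {X : Set ℤ} {x y : ℤ} : pos X x < pos X y ↔
    (x ∈ X ∧ y ∈ X ∧ x < y) ∨ (x ∈ X ∧ y ∉ X) ∨ (x ∉ X ∧ y ∉ X ∧ y < x) := by
  unfold pos
  split_ifs with h1 h2 h2 <;> simp [Prod.Lex.toLex_lt_toLex, h1, h2]

lemma pos_injective (X : Set ℤ) : Function.Injective (pos X) := by
  intro x y h
  unfold pos at h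
  split_ifs at h with h1 h2 h2 <;> simp at h <;> exact h

/-- The map from the strip to the closed upper half plane. -/
noncomputable def toHalfPlane (p : ℝ × ℝ) : ℂ :=
  -Complex.exp (-(Real.pi * (p.1 + p.2 * Complex.I)))

lemma toHalfPlane_im {p : ℝ × ℝ} (hp : p ∈ strip) : 0 ≤ (toHalfPlane p).im := by
  have : (toHalfPlane p).im = Real.exp (-(Real.pi * p.1)) * Real.sin (Real.pi * p.2) := by
    simp [toHalfPlane, Complex.exp_im]
  rw [this]
  refine mul_nonneg (Real.exp_pos _).le (Real.sin_nonneg_of_nonneg_of_le_pi ?_ ?_)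
  · exact mul_nonneg Real.pi_pos.le hp.1
  · nlinarith [Real.pi_pos, hp.2]

/-- Two points with the same image differ vertically by a multiple of `2`, while the strip has
height `1`. -/
lemma toHalfPlane_injOn : Set.InjOn toHalfPlane strip := by
  rintro ⟨x, y⟩ hp ⟨x', y'⟩ hq h
  simp only [strip, Set.mem_ofPred_eq] at hp hq
  have h' := neg_injective h
  obtain ⟨m, hm⟩ := Complex.exp_eq_exp_iff_exists_int.1 h'
  have h1 := congrArg Complex.re hm
  have h2 := congrArg Complex.im hm
  simp at h1 h2
  have hpi := Real.pi_pos
  have h3 : y' = y + 2 * m := by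
    have : Real.pi * (y' - y - 2 * m) = 0 := by linarith
    rcases mul_eq_zero.1 this with h | h
    · exact absurd h hpi.ne'
    · linarith
  have hm1 : (m : ℝ) < 1 := by linarith
  have hm2 : (-1 : ℝ) < m := by linarith
  have hm3 : m < 1 := by exact_mod_cast hm1
  have hm4 : -1 < m := by exact_mod_cast hm2
  have hm5 : m = 0 := by omega
  subst hm5
  ext
  · simpa using h1
  · simpa using h3.symm

open Classical in
/-- The image in the boundary of the half plane of the point of the strip representing `x`. -/
noncomputable def boundaryPoint (X : Set ℤ) (x : ℤ) : ℝ :=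
  if x ∈ X then -Real.exp (-(Real.pi * x)) else Real.exp (-(Real.pi * x))

lemma toHalfPlane_stripPoint (X : Set ℤ) (x : ℤ) :
    toHalfPlane (stripPoint X x) = boundaryPoint X x := by
  unfold toHalfPlane stripPoint boundaryPoint
  split_ifs with h
  · simp
  · push_cast
    rw [one_mul, mul_add, neg_add, Complex.exp_add, Complex.exp_neg (Real.pi * Complex.I),
      Complex.exp_pi_mul_I]
    simp

lemma boundaryPoint_lt {X : Set ℤ} {x y : ℤ} (h : pos X x < pos X y) :
    boundaryPoint X x < boundaryPoint X y := by
  have hpi := Real.pi_pos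
  unfold boundaryPoint
  rcases pos_lt_pos.1 h with ⟨h1, h2, h3⟩ | ⟨h1, h2⟩ | ⟨h1, h2, h3⟩
  · have : (x : ℝ) < y := by exact_mod_cast h3
    simp [h1, h2]
    nlinarith
  · simp only [h1, h2, if_true, if_false]
    linarith [Real.exp_pos (-(Real.pi * x)), Real.exp_pos (-(Real.pi * y))]
  · have : (y : ℝ) < x := by exact_mod_cast h3
    simp [h1, h2]
    nlinarith

/-- Paths in the strip that join interleaved boundary points meet. -/
lemma not_disjoint_range_of_interleaved {X : Set ℤ} {p₁ p₂ p₃ p₄ : ℤ} (h₁₂ : pos X p₁ < pos X p₂)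
    (h₂₃ : pos X p₂ < pos X p₃) (h₃₄ : pos X p₃ < pos X p₄)
    (γ : Path (stripPoint X p₁) (stripPoint X p₃)) (δ : Path (stripPoint X p₂) (stripPoint X p₄))
    (hγ : Set.range γ ⊆ strip) (hδ : Set.range δ ⊆ strip) :
    ¬ Disjoint (Set.range γ) (Set.range δ) := by
  intro hd
  have hext : ∀ {a b : ℝ × ℝ} (γ : Path a b) (t : ℝ), γ.extend t ∈ Set.range γ := fun γ t => by
    rw [← Path.extend_range]; exact ⟨t, rfl⟩
  have hcont : Continuous toHalfPlane := by
    unfold toHalfPlane; fun_prop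
  obtain ⟨s, t, hst⟩ := exists_eq_of_interleaved (γ := fun t => toHalfPlane (γ.extend t))
    (δ := fun t => toHalfPlane (δ.extend t)) (hcont.comp γ.continuous_extend)
    (hcont.comp δ.continuous_extend) (fun t => toHalfPlane_im (hγ (hext γ t)))
    (fun t => toHalfPlane_im (hδ (hext δ t)))
    (boundaryPoint_lt h₁₂) (boundaryPoint_lt h₂₃) (boundaryPoint_lt h₃₄)
    (by simp [toHalfPlane_stripPoint]) (by simp [toHalfPlane_stripPoint])
    (by simp [toHalfPlane_stripPoint]) (by simp [toHalfPlane_stripPoint])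
  have := toHalfPlane_injOn (hγ (hext γ s)) (hδ (hext δ t)) hst
  exact Set.disjoint_left.1 hd (hext γ s) (this ▸ hext δ t)

/-! ### Non-crossing partitions in terms of the boundary order -/

/-- Combinatorial non-crossing condition on a partition. -/
def IsNonCrossing (X : Set ℤ) (p : Setoid ℤ) : Prop :=
  ∀ x x' y y', p x x' → p y y' → ¬ p x y → pos X x < pos X y → pos X y < pos X x' →
    pos X x < pos X y' ∧ pos X y' < pos X x'

/-- `a, a'` and `b, b'` can be joined in disjoint subsets of the strip. -/
def DisjointlyJoined (X : Set ℤ) (a a' b b' : ℤ) : Prop :=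
  ∃ F G : Set (ℝ × ℝ), F ⊆ strip ∧ G ⊆ strip ∧ Disjoint F G ∧
    JoinedIn F (stripPoint X a) (stripPoint X a') ∧ JoinedIn G (stripPoint X b) (stripPoint X b')

lemma DisjointlyJoined.swap {X : Set ℤ} {a a' b b' : ℤ} (h : DisjointlyJoined X a a' b b') :
    DisjointlyJoined X b b' a a' := by
  obtain ⟨F, G, hF, hG, hd, h1, h2⟩ := h
  exact ⟨G, F, hG, hF, hd.symm, h2, h1⟩

lemma DisjointlyJoined.symm_left {X : Set ℤ} {a a' b b' : ℤ} (h : DisjointlyJoined X a a' b b') :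
    DisjointlyJoined X a' a b b' := by
  obtain ⟨F, G, hF, hG, hd, h1, h2⟩ := h
  exact ⟨F, G, hF, hG, hd, h1.symm, h2⟩

lemma stripPoint_mem_strip (X : Set ℤ) (z : ℤ) : stripPoint X z ∈ strip := by
  unfold stripPoint strip
  split_ifs <;> simp

lemma mem_segment_strip {p q r : ℝ × ℝ} (h : r ∈ segment ℝ p q) (hp : p ∈ strip) (hq : q ∈ strip) :
    r ∈ strip := by
  have hc : Convex ℝ strip := by
    have : strip = Set.univ ×ˢ Set.Icc (0 : ℝ) 1 := by ext; simp [strip]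
    rw [this]
    exact convex_univ.prod (convex_Icc _ _)
  exact hc.segment_subset hp hq h

/-- Points on the same side can be joined along the boundary. -/
lemma disjointlyJoined_of_same_side {X : Set ℤ} {a a' b b' : ℤ} {h : ℝ}
    (ha : (stripPoint X a).2 = h) (ha' : (stripPoint X a').2 = h) (h01 : h = 0 ∨ h = 1)
    (hb : (stripPoint X b).2 = h → ¬ (min a a' ≤ b ∧ b ≤ max a a'))
    (hb' : (stripPoint X b').2 = h → ¬ (min a a' ≤ b' ∧ b' ≤ max a a')) :
    DisjointlyJoined X a a' b b' := by
  set F : Set (ℝ × ℝ) := {p | p.2 = h ∧ (min a a' : ℤ) ≤ p.1 ∧ p.1 ≤ (max a a' : ℤ)} with hF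
  -- The second path avoids the boundary segment `F` by first crossing vertically to the line at
  -- height `1 - h`, where it is free to move.
  have vert : ∀ b, ((stripPoint X b).2 = h → ¬ (min a a' ≤ b ∧ b ≤ max a a')) →
      JoinedIn (strip \ F) (stripPoint X b) ((b : ℝ), 1 - h) := by
    intro b hb
    refine JoinedIn.of_segment_subset fun r hr => ⟨mem_segment_strip hr (stripPoint_mem_strip X b)
      ?_, ?_⟩
    · rcases h01 with rfl | rfl <;> simp [strip]
    · rintro ⟨h1, h2, h3⟩
      rw [segment_eq_image'] at hr
      obtain ⟨θ, -, rfl⟩ := hr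
      have e1 : (stripPoint X b).1 = b := rfl
      simp only [Prod.fst_add, Prod.smul_fst, Prod.fst_sub, e1, sub_self, mul_zero,
        add_zero, Prod.snd_add, Prod.smul_snd, Prod.snd_sub, smul_eq_mul] at h1 h2 h3
      by_cases hh : (stripPoint X b).2 = h
      · exact hb hh ⟨by exact_mod_cast h2, by exact_mod_cast h3⟩
      · have : (stripPoint X b).2 = 1 - h := by
          unfold stripPoint at hh ⊢
          rcases h01 with rfl | rfl <;> split_ifs at hh ⊢ <;> simp_all
        rw [this] at h1
        rcases h01 with rfl | rfl <;> simp at h1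
  have hor : JoinedIn (strip \ F) ((b : ℝ), 1 - h) ((b' : ℝ), 1 - h) := by
    refine JoinedIn.of_segment_subset fun r hr => ⟨mem_segment_strip hr ?_ ?_, ?_⟩
    · rcases h01 with rfl | rfl <;> simp [strip]
    · rcases h01 with rfl | rfl <;> simp [strip]
    · rintro ⟨h1, -⟩
      rw [segment_eq_image'] at hr
      obtain ⟨θ, -, rfl⟩ := hr
      rcases h01 with rfl | rfl <;> simp at h1
  refine ⟨F, strip \ F, ?_, Set.sdiff_subset, Set.disjoint_sdiff_right, ?_,
    (vert b hb).trans (hor.trans (vert b' hb').symm)⟩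
  · rintro p ⟨h1, -⟩
    rcases h01 with rfl | rfl <;> simp [strip, h1]
  · refine JoinedIn.of_segment_subset fun r hr => ?_
    have hc : Convex ℝ F := by
      have : F = Set.Icc ((min a a' : ℤ) : ℝ) ((max a a' : ℤ) : ℝ) ×ˢ {h} := by
        ext p; simp [hF, and_comm]
      rw [this]
      exact (convex_Icc _ _).prod (convex_singleton _)
    refine hc.segment_subset ⟨ha, ?_, ?_⟩ ⟨ha', ?_, ?_⟩ hr <;> simp [stripPoint]

/-- Straight segments suffice: at equal heights, the horizontal distance of their points is a convex
combination of two distances of the same sign. -/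
lemma disjointlyJoined_of_lt {X : Set ℤ} {a a' b b' : ℤ} (ha : a ∈ X) (ha' : a' ∉ X) (hb : b ∈ X)
    (hb' : b' ∉ X) (h : a < b ∧ a' < b' ∨ b < a ∧ b' < a') : DisjointlyJoined X a a' b b' := by
  refine ⟨segment ℝ (stripPoint X a) (stripPoint X a'), segment ℝ (stripPoint X b) (stripPoint X b'),
    fun r hr => mem_segment_strip hr (stripPoint_mem_strip _ _) (stripPoint_mem_strip _ _),
    fun r hr => mem_segment_strip hr (stripPoint_mem_strip _ _) (stripPoint_mem_strip _ _),
    Set.disjoint_left.2 ?_, JoinedIn.of_segment_subset subset_rfl,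
    JoinedIn.of_segment_subset subset_rfl⟩
  intro r hr hr'
  rw [segment_eq_image'] at hr hr'
  obtain ⟨θ, ⟨h0, h1⟩, rfl⟩ := hr
  obtain ⟨η, -, hη⟩ := hr'
  simp only [stripPoint, ha, ha', hb, hb', if_true, if_false, Prod.mk_sub_mk, Prod.smul_mk,
    Prod.mk_add_mk, smul_eq_mul, sub_zero, mul_one, zero_add, Prod.mk.injEq] at hη
  obtain ⟨h2, rfl⟩ := hη
  rcases h with ⟨h3, h4⟩ | ⟨h3, h4⟩
  · have h3' : (a : ℝ) < b := by exact_mod_cast h3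
    have h4' : (a' : ℝ) < b' := by exact_mod_cast h4
    rcases h0.eq_or_lt with rfl | h0
    · linarith
    · nlinarith
  · have h3' : (b : ℝ) < a := by exact_mod_cast h3
    have h4' : (b' : ℝ) < a' := by exact_mod_cast h4
    rcases h0.eq_or_lt with rfl | h0
    · linarith
    · nlinarith

/-- `y` lies between `x` and `x'` in the boundary order. -/
def Between (X : Set ℤ) (x x' y : ℤ) : Prop :=
  (pos X x < pos X y ∧ pos X y < pos X x') ∨ (pos X x' < pos X y ∧ pos X y < pos X x)

/-- If `b` and `b'` are both between `a` and `a'`, they can be joined along the boundary and `a`,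
`a'` go around; if neither is, the roles are exchanged. -/
lemma disjointlyJoined_of_same {X : Set ℤ} {a a' b b' : ℤ} (haa : a ∈ X ↔ a' ∈ X) (h1 : a ≠ b)
    (h2 : a ≠ b') (h3 : a' ≠ b) (h4 : a' ≠ b')
    (h : Between X a a' b ↔ Between X a a' b') :
    DisjointlyJoined X a a' b b' := by
  unfold Between at h
  simp only [pos_lt_pos] at h
  by_cases ha : a ∈ X
  · have ha' := haa.1 ha
    by_cases hb : b ∈ X ∧ min a a' ≤ b ∧ b ≤ max a a'
    · have hb' : b' ∈ X ∧ min a a' ≤ b' ∧ b' ≤ max a a' := by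
        by_cases hb' : b' ∈ X <;> simp [ha, ha', hb.1, hb'] at h ⊢ <;> omega
      apply DisjointlyJoined.swap
      refine disjointlyJoined_of_same_side (h := 0) (by simp [stripPoint, hb.1])
        (by simp [stripPoint, hb'.1]) (Or.inl rfl) (fun _ => by omega) (fun _ => by omega)
    · refine disjointlyJoined_of_same_side (h := 0) (by simp [stripPoint, ha])
        (by simp [stripPoint, ha']) (Or.inl rfl) (fun hh => ?_) (fun hh => ?_)
      · have : b ∈ X := by by_contra hc; simp [stripPoint, hc] at hh
        exact fun hc => hb ⟨this, hc⟩
      · have hb' : b' ∈ X := by by_contra hc; simp [stripPoint, hc] at hh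
        by_cases hbX : b ∈ X <;> simp [ha, ha', hbX, hb'] at h hb <;> omega
  · have ha' : a' ∉ X := fun h => ha (haa.2 h)
    by_cases hb : b ∉ X ∧ min a a' ≤ b ∧ b ≤ max a a'
    · have hb' : b' ∉ X ∧ min a a' ≤ b' ∧ b' ≤ max a a' := by
        by_cases hb' : b' ∈ X <;> simp [ha, ha', hb.1, hb'] at h ⊢ <;> omega
      apply DisjointlyJoined.swap
      refine disjointlyJoined_of_same_side (h := 1) (by simp [stripPoint, hb.1])
        (by simp [stripPoint, hb'.1]) (Or.inr rfl) (fun _ => by omega) (fun _ => by omega)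
    · refine disjointlyJoined_of_same_side (h := 1) (by simp [stripPoint, ha])
        (by simp [stripPoint, ha']) (Or.inr rfl) (fun hh => ?_) (fun hh => ?_)
      · have : b ∉ X := fun hc => by simp [stripPoint, hc] at hh
        exact fun hc => hb ⟨this, hc⟩
      · have hb' : b' ∉ X := fun hc => by simp [stripPoint, hc] at hh
        by_cases hbX : b ∈ X <;> simp [ha, ha', hbX, hb'] at h hb <;> omega

lemma between_comm {X : Set ℤ} {x x' y : ℤ} : Between X x x' y ↔ Between X x' x y := or_comm

lemma disjointlyJoined_of_mixed {X : Set ℤ} {a a' b b' : ℤ} (ha : a ∈ X) (ha' : a' ∉ X)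
    (hb : b ∈ X) (hb' : b' ∉ X) (h1 : a ≠ b) (h4 : a' ≠ b')
    (h : Between X a a' b ↔ Between X a a' b') : DisjointlyJoined X a a' b b' := by
  have : a < b ↔ a' < b' := by simpa [Between, pos_lt_pos, ha, ha', hb, hb'] using h
  exact disjointlyJoined_of_lt ha ha' hb hb' (by omega)

lemma disjointlyJoined_of_between {X : Set ℤ} {a a' b b' : ℤ} (h1 : a ≠ b)
    (h2 : a ≠ b') (h3 : a' ≠ b) (h4 : a' ≠ b')
    (h : Between X a a' b ↔ Between X a a' b') (h' : Between X b b' a ↔ Between X b b' a') :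
    DisjointlyJoined X a a' b b' := by
  by_cases haa : a ∈ X ↔ a' ∈ X
  · exact disjointlyJoined_of_same haa h1 h2 h3 h4 h
  by_cases hbb : b ∈ X ↔ b' ∈ X
  · exact (disjointlyJoined_of_same hbb h1.symm h3.symm h2.symm h4.symm h').swap
  have hs : Between X a' a b ↔ Between X a' a b' := by rwa [between_comm, between_comm (y := b')]
  by_cases ha : a ∈ X <;> by_cases hb : b ∈ X
  · have ha' : a' ∉ X := by tauto
    have hb' : b' ∉ X := by tauto
    exact disjointlyJoined_of_mixed ha ha' hb hb' h1 h4 h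
  · have ha' : a' ∉ X := by tauto
    have hb' : b' ∈ X := by tauto
    exact (disjointlyJoined_of_mixed ha ha' hb' hb h2 h3 h.symm).swap.symm_left.swap
  · have ha' : a' ∈ X := by tauto
    have hb' : b' ∉ X := by tauto
    exact (disjointlyJoined_of_mixed ha' ha hb hb' h3 h2 hs).symm_left
  · have ha' : a' ∈ X := by tauto
    have hb' : b' ∈ X := by tauto
    exact (disjointlyJoined_of_mixed ha' ha hb' hb h4 h1 hs.symm).symm_left.swap.symm_left.swap

lemma IsNonCrossing.between {X : Set ℤ} {p : Setoid ℤ} (hp : IsNonCrossing X p) {a a' b b' : ℤ}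
    (ha : p a a') (hb : p b b') (hab : ¬ p a b) (h : Between X a a' b) : Between X a a' b' := by
  rcases h with ⟨h1, h2⟩ | ⟨h1, h2⟩
  · exact Or.inl (hp a a' b b' ha hb hab h1 h2)
  · exact Or.inr (hp a' a b b' (p.symm ha) hb (fun h => hab (p.trans ha h)) h1 h2)

lemma isNonCrossingPartition_iff {X : Set ℤ} {p : Setoid ℤ} :
    IsNonCrossingPartition X p ↔ IsNonCrossing X p := by
  constructor
  · intro h x x' y y' hx hy hxy h1 h2
    have hne : {z | p z x} ≠ {z | p z y} := fun he => hxy (by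
      have : x ∈ {z | p z x} := p.refl x
      rw [he] at this
      exact this)
    have := h _ ⟨x, rfl⟩ _ ⟨y, rfl⟩ hne
    have hxy' : ∀ u v, p u x → p v y → u ≠ v := by
      rintro u v hu hv rfl
      exact hxy (p.trans (p.symm hu) hv)
    by_contra hcon
    -- The point `y'` lies outside the arc from `x` to `x'`; on either side of it, the four points
    -- are interleaved.
    have hcases : pos X x' < pos X y' ∨ pos X y' < pos X x := by
      by_contra hc
      push Not at hc
      refine hcon ⟨lt_of_le_of_ne hc.2 fun he => hxy' x y' (p.refl x) (p.symm hy)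
        (pos_injective X he), lt_of_le_of_ne hc.1 fun he => hxy' x' y' (p.symm hx) (p.symm hy)
        (pos_injective X he.symm)⟩
    rcases hcases with h3 | h3
    · obtain ⟨γ, δ, hγ, hδ, hd⟩ := this x (p.refl x) x' (p.symm hx) y (p.refl y) y' (p.symm hy)
      exact not_disjoint_range_of_interleaved h1 h2 h3 γ δ hγ hδ hd
    · obtain ⟨γ, δ, hγ, hδ, hd⟩ := this x (p.refl x) x' (p.symm hx) y' (p.symm hy) y (p.refl y)
      exact not_disjoint_range_of_interleaved h3 h1 h2 δ γ hδ hγ hd.symm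
  · rintro h A ⟨x, rfl⟩ B ⟨y, rfl⟩ hne a ha a' ha' b hb b' hb'
    have ha : p a x := ha
    have ha' : p a' x := ha'
    have hb : p b y := hb
    have hb' : p b' y := hb'
    have hxy : ¬ p x y := fun hxy => hne (Set.ext fun z =>
      ⟨fun hz => p.trans hz hxy, fun hz => p.trans hz (p.symm hxy)⟩)
    have hd : ∀ u v, p u x → p v y → ¬ p u v := fun u v hu hv huv =>
      hxy (p.trans (p.symm hu) (p.trans huv hv))
    have hn : ∀ u v, p u x → p v y → u ≠ v := fun u v hu hv huv => hd u v hu hv (huv ▸ p.refl u)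
    have haa := p.trans ha (p.symm ha')
    have hbb := p.trans hb (p.symm hb')
    obtain ⟨F, G, hF, hG, hFG, hj, hj'⟩ := disjointlyJoined_of_between (X := X) (hn _ _ ha hb)
      (hn _ _ ha hb') (hn _ _ ha' hb) (hn _ _ ha' hb')
      ⟨h.between haa hbb (hd _ _ ha hb), h.between haa (p.symm hbb) (hd _ _ ha hb')⟩
      ⟨h.between hbb haa (fun hh => hd _ _ ha hb (p.symm hh)),
        h.between hbb (p.symm haa) (fun hh => hd _ _ ha' hb (p.symm hh))⟩
    obtain ⟨γ, hγ⟩ := hj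
    obtain ⟨δ, hδ⟩ := hj'
    have hγ' : Set.range γ ⊆ F := Set.range_subset_iff.2 hγ
    have hδ' : Set.range δ ⊆ G := Set.range_subset_iff.2 hδ
    exact ⟨γ, δ, hγ'.trans hF, hδ'.trans hG, hFG.mono hγ' hδ'⟩

lemma perm_apply_inv (w : Perm ℤ) (x : ℤ) : w (w⁻¹ x) = x := w.apply_symm_apply x

/-! ### Translation by `n` -/

lemma add_mul_mem_iff {n : ℕ} {X : Set ℤ} (hX : ∀ z : ℤ, z + n ∈ X ↔ z ∈ X) (z m : ℤ) :
    z + m * n ∈ X ↔ z ∈ X := by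
  induction m using Int.induction_on with
  | zero => simp
  | succ i ih => rw [← ih, ← hX (z + i * n)]; ring_nf
  | pred i ih => rw [← ih, ← hX (z + (-i - 1) * n)]; ring_nf

lemma IsPeriodicPartition.add_mul {n : ℕ} {p : Setoid ℤ} (hp : IsPeriodicPartition n p)
    (x y m : ℤ) : p (x + m * n) (y + m * n) ↔ p x y := by
  induction m using Int.induction_on with
  | zero => simp
  | succ i ih => rw [← ih, ← hp (x + i * n)]; ring_nf
  | pred i ih => rw [← ih, ← hp (x + (-i - 1) * n)]; ring_nf

lemma IsPeriodic.add_mul {n : ℕ} {w : Perm ℤ} (hw : IsPeriodic n w) (x m : ℤ) :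
    w (x + m * n) = w x + m * n := by
  induction m using Int.induction_on with
  | zero => simp
  | succ i ih =>
    have := hw (x + i * n)
    rw [ih] at this
    rw [show x + ((i : ℤ) + 1) * n = x + i * n + n by ring, this]; ring
  | pred i ih =>
    have := hw (x + (-i - 1) * n)
    rw [show x + (-(i : ℤ) - 1) * n + n = x + -i * n by ring, ih] at this
    linear_combination -this

lemma IsPeriodic.mul {n : ℕ} {u v : Perm ℤ} (hu : IsPeriodic n u) (hv : IsPeriodic n v) :
    IsPeriodic n (u * v) := fun i => by
  rw [Perm.mul_apply, Perm.mul_apply, hv, hu]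

lemma IsPeriodic.inv {n : ℕ} {u : Perm ℤ} (hu : IsPeriodic n u) : IsPeriodic n u⁻¹ := fun i => by
  rw [Perm.inv_eq_iff_eq, hu, perm_apply_inv]

lemma IsPeriodic.one {n : ℕ} : IsPeriodic n 1 := fun _ => rfl

lemma IsPeriodic.zpow {n : ℕ} {u : Perm ℤ} (hu : IsPeriodic n u) (k : ℤ) :
    IsPeriodic n (u ^ k) := by
  induction k using Int.induction_on with
  | zero => simpa using IsPeriodic.one
  | succ i ih => rw [zpow_add_one]; exact ih.mul hu
  | pred i ih => rw [zpow_sub_one]; exact ih.mul hu.inv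

lemma pos_add_mul_lt {n : ℕ} {X : Set ℤ} (hX : ∀ z : ℤ, z + n ∈ X ↔ z ∈ X) (x y m : ℤ) :
    pos X (x + m * n) < pos X (y + m * n) ↔ pos X x < pos X y := by
  simp only [pos_lt_pos, add_mul_mem_iff hX, add_lt_add_iff_right]

lemma pos_add_mul_le {n : ℕ} {X : Set ℤ} (hX : ∀ z : ℤ, z + n ∈ X ↔ z ∈ X) (x y m : ℤ) :
    pos X (x + m * n) ≤ pos X (y + m * n) ↔ pos X x ≤ pos X y := by
  rw [← not_lt, pos_add_mul_lt hX, not_lt]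

lemma pos_compl_lt {X : Set ℤ} {x y : ℤ} : pos Xᶜ x < pos Xᶜ y ↔ pos X y < pos X x := by
  simp only [pos_lt_pos, Set.mem_compl_iff]
  tauto

lemma pos_compl_le {X : Set ℤ} {x y : ℤ} : pos Xᶜ x ≤ pos Xᶜ y ↔ pos X y ≤ pos X x := by
  rw [← not_lt, pos_compl_lt, not_lt]

/-- Pigeonhole on residues modulo `n`. -/
lemma exists_add_mul_mem_of_infinite {n : ℕ} (hn : 0 < n) {S : Set ℤ} (hS : S.Infinite) :
    ∃ x ∈ S, ∃ k : ℤ, 0 < k ∧ x + k * n ∈ S := by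
  have hn' : (0 : ℤ) < n := by exact_mod_cast hn
  obtain ⟨x, hx, y, hy, hxy, he⟩ := hS.exists_ne_map_eq_of_mapsTo (f := fun x => x % (n : ℤ))
    (t := Set.Ico 0 (n : ℤ)) (fun x _ => ⟨Int.emod_nonneg _ hn'.ne', Int.emod_lt_of_pos _ hn'⟩)
    (Set.finite_Ico _ _)
  have key : ∀ x ∈ S, ∀ y ∈ S, x < y → x % (n : ℤ) = y % n →
      ∃ x ∈ S, ∃ k : ℤ, 0 < k ∧ x + k * n ∈ S := by
    intro x hx y hy hxy he
    obtain ⟨k, hk⟩ := Int.ModEq.dvd (show x ≡ y [ZMOD n] from he)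
    refine ⟨x, hx, k, ?_, ?_⟩
    · by_contra hc
      nlinarith
    · have : x + k * n = y := by linear_combination -hk
      rwa [this]
  rcases lt_or_gt_of_ne hxy with h | h
  · exact key x hx y hy h he
  · exact key y hy x hx h he.symm

/-! ### Periodic non-crossing partitions -/

/-- Periodic non-crossing partitions whose infinite parts meet both `X` and its complement. -/
structure IsNCP (n : ℕ) (X : Set ℤ) (p : Setoid ℤ) : Prop where
  per : IsPeriodicPartition n p
  nc : IsNonCrossing X p
  meets : ∀ x, {y | p x y}.Infinite → (∃ y, p x y ∧ y ∈ X) ∧ ∃ y, p x y ∧ y ∉ X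

/-- Exchanging the sides of the strip reverses the boundary order. This symmetry later provides
predecessors, inverses and right quotients. -/
lemma IsNonCrossing.compl {X : Set ℤ} {p : Setoid ℤ} (h : IsNonCrossing X p) :
    IsNonCrossing Xᶜ p := by
  intro x x' y y' hx hy hxy h1 h2
  rw [pos_compl_lt] at h1 h2 ⊢
  rw [pos_compl_lt]
  exact (h x' x y y' (p.symm hx) hy (fun h => hxy (p.trans hx h)) h2 h1).symm

lemma IsNCP.compl {n : ℕ} {X : Set ℤ} {p : Setoid ℤ} (h : IsNCP n X p) : IsNCP n Xᶜ p where
  per := h.per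
  nc := h.nc.compl
  meets x hx := by
    obtain ⟨h1, h2⟩ := h.meets x hx
    exact ⟨h2, by simpa using h1⟩

lemma setOf_rel_eq {p : Setoid ℤ} {x y : ℤ} (h : p x y) : {z | p x z} = {z | p y z} :=
  Set.ext fun _ => ⟨fun hz => p.trans (p.symm h) hz, fun hz => p.trans h hz⟩

/-- An infinite part contains two points differing by some `k * n`, so it meets its translate by `k
* n`, which is again a part; the two coincide. -/
lemma IsPeriodicPartition.exists_period {n : ℕ} (hn : 0 < n) {p : Setoid ℤ}
    (hp : IsPeriodicPartition n p) {x : ℤ} (hx : {y | p x y}.Infinite) :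
    ∃ k : ℤ, 0 < k ∧ ∀ z, p x z → ∀ j : ℤ, p x (z + j * (k * n)) := by
  obtain ⟨y, hy, k, hk, hyk⟩ := exists_add_mul_mem_of_infinite hn hx
  have hy : p x y := hy
  have hyk : p x (y + k * n) := hyk
  have key : ∀ z, p x (z + k * n) ↔ p x z := fun z => by
    constructor
    · intro h
      have h1 := (hp.add_mul y z k).1 (p.trans (p.symm hyk) h)
      exact p.trans hy h1
    · intro h
      exact p.trans hyk ((hp.add_mul y z k).2 (p.trans (p.symm hy) h))
  refine ⟨k, hk, fun z hz j => ?_⟩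
  induction j using Int.induction_on with
  | zero => simpa using hz
  | succ i ih => rw [← key] at ih; convert ih using 1; ring
  | pred i ih => rw [← key]; convert ih using 1; ring

/-- A chord of one infinite part across the strip separates its two ends, whereas another infinite
part is stable under some non-zero translation and so has points of `X` near both ends. -/
lemma IsNCP.rel_of_infinite {n : ℕ} (hn : 0 < n) {X : Set ℤ}
    (hX : ∀ z : ℤ, z + n ∈ X ↔ z ∈ X) {p : Setoid ℤ}
    (hp : IsNCP n X p) {x z : ℤ} (hx : {y | p x y}.Infinite) (hz : {y | p z y}.Infinite) :
    p x z := by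
  obtain ⟨⟨a, ha, haX⟩, ⟨α, hα, hαX⟩⟩ := hp.meets x hx
  obtain ⟨⟨b, hb, hbX⟩, -⟩ := hp.meets z hz
  obtain ⟨k, hk, hper⟩ := hp.per.exists_period hn hz
  by_contra hxz
  have hab : ¬ p a b := fun h => hxz (p.trans ha (p.trans h (p.symm hb)))
  have hk1 : 1 ≤ k * n := by
    have : (1 : ℤ) ≤ n := by exact_mod_cast hn
    nlinarith
  -- Translating `b` by `±(|a - b| + 1)` periods moves it beyond `a` in both directions.
  have hne : |a - b| + 1 ≤ (|a - b| + 1) * (k * n) := by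
    nlinarith [abs_nonneg (a - b)]
  have h1 := hper b hb (|a - b| + 1)
  have h2 := hper b hb (-(|a - b| + 1))
  have hm1 : b + (|a - b| + 1) * (k * n) ∈ X := by rw [← mul_assoc, add_mul_mem_iff hX]; exact hbX
  have hm2 : b + -(|a - b| + 1) * (k * n) ∈ X := by rw [← mul_assoc, add_mul_mem_iff hX]; exact hbX
  have h3 := hp.nc a α _ _ (p.trans (p.symm ha) hα) (p.trans (p.symm h1) h2)
    (fun h => hxz (p.trans ha (p.trans h (p.symm h1))))
    (pos_lt_pos.2 (Or.inl ⟨haX, hm1, by linarith [le_abs_self (a - b)]⟩))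
    (pos_lt_pos.2 (Or.inr (Or.inl ⟨hm1, hαX⟩)))
  rcases pos_lt_pos.1 h3.1 with h | h | h
  · linarith [h.2.2, neg_abs_le (a - b)]
  · exact h.2 hm2
  · exact h.1 haX

lemma IsPeriodicPartition.infinite_add_mul {n : ℕ} {p : Setoid ℤ} (hp : IsPeriodicPartition n p)
    {x : ℤ} (m : ℤ) : {y | p (x + m * n) y}.Infinite ↔ {y | p x y}.Infinite := by
  have : {y | p (x + m * n) y} = (fun y => y + m * n) '' {y | p x y} := by
    ext y
    constructor
    · intro hy
      refine ⟨y - m * n, ?_, by ring⟩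
      change p _ _
      rw [← hp.add_mul _ _ m]
      simpa using hy
    · rintro ⟨y, hy, rfl⟩
      exact (hp.add_mul _ _ _).2 hy
  rw [this, Set.infinite_image_iff (fun a _ b _ h => by simpa using h)]

lemma IsNCP.rel_add_mul_of_infinite {n : ℕ} (hn : 0 < n) {X : Set ℤ}
    (hX : ∀ z : ℤ, z + n ∈ X ↔ z ∈ X) {p : Setoid ℤ}
    (hp : IsNCP n X p) {x : ℤ} (hx : {y | p x y}.Infinite) (m : ℤ) : p x (x + m * n) :=
  hp.rel_of_infinite hn hX hx ((hp.per.infinite_add_mul m).2 hx)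

lemma IsPeriodicPartition.infinite_of_rel_add_mul {n : ℕ} (hn : 0 < n) {p : Setoid ℤ}
    (hp : IsPeriodicPartition n p) {x m : ℤ} (hm : m ≠ 0) (h : p x (x + m * n)) :
    {y | p x y}.Infinite := by
  have key : ∀ j : ℤ, p x (x + j * (m * n)) := fun j => by
    induction j using Int.induction_on with
    | zero => simp
    | succ i ih =>
      refine p.trans h ?_
      have := (hp.add_mul _ _ m).2 ih
      convert this using 1; ring
    | pred i ih =>
      refine p.trans (p.symm ((hp.add_mul (x + -m * n) _ m).1 (by simpa using h))) ?_
      have := (hp.add_mul _ _ (-m)).2 ih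
      convert this using 1; ring
  refine Set.infinite_of_injective_forall_mem (f := fun j : ℤ => x + j * (m * n)) ?_ key
  intro i j hij
  have hmn : m * (n : ℤ) ≠ 0 := mul_ne_zero hm (by exact_mod_cast hn.ne')
  simpa [hmn, hm, hn.ne'] using hij

lemma IsPeriodicPartition.eq_zero_of_rel_add_mul {n : ℕ} (hn : 0 < n) {p : Setoid ℤ}
    (hp : IsPeriodicPartition n p) {x m : ℤ} (hx : {y | p x y}.Finite) (h : p x (x + m * n)) :
    m = 0 := by
  by_contra hm
  exact hp.infinite_of_rel_add_mul hn hm h hx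

/-! ### Cyclic successors -/

/-- `y` is the cyclic successor of `x` in its `p`-class, in the boundary order. -/
def Succ (X : Set ℤ) (p : Setoid ℤ) (x y : ℤ) : Prop :=
  p x y ∧ ∀ z, p x z → (pos X x < pos X y ∧ (pos X z ≤ pos X x ∨ pos X y ≤ pos X z)) ∨
    (pos X y ≤ pos X z ∧ pos X z ≤ pos X x)

/-- `w` maps each integer to its cyclic successor. -/
def IsSucc (X : Set ℤ) (p : Setoid ℤ) (w : Perm ℤ) : Prop := ∀ x, Succ X p x (w x)

lemma Succ.unique {X : Set ℤ} {p : Setoid ℤ} {x y y' : ℤ} (h : Succ X p x y)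
    (h' : Succ X p x y') : y = y' := by
  apply pos_injective X
  have h1 := h.2 _ h'.1
  have h2 := h'.2 _ h.1
  have h3 := h.2 _ h.1
  have h4 := h'.2 _ h'.1
  generalize pos X x = a at *
  generalize pos X y = b at *
  generalize pos X y' = c at *
  grind

/-- Reversing the boundary order turns successors into predecessors. -/
lemma succ_compl {X : Set ℤ} {p : Setoid ℤ} {x y : ℤ} : Succ Xᶜ p x y ↔ Succ X p y x := by
  simp only [Succ, pos_compl_le, pos_compl_lt]
  constructor
  · rintro ⟨h, h'⟩
    refine ⟨p.symm h, fun z hz => ?_⟩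
    have := h' z (p.trans h hz)
    tauto
  · rintro ⟨h, h'⟩
    refine ⟨p.symm h, fun z hz => ?_⟩
    have := h' z (p.trans h hz)
    tauto

lemma Succ.add_mul {n : ℕ} {X : Set ℤ} (hX : ∀ z : ℤ, z + n ∈ X ↔ z ∈ X) {p : Setoid ℤ}
    (hp : IsPeriodicPartition n p) {x y : ℤ} (h : Succ X p x y) (m : ℤ) :
    Succ X p (x + m * n) (y + m * n) := by
  refine ⟨(hp.add_mul _ _ _).2 h.1, fun z hz => ?_⟩
  have hz' : z = (z - m * n) + m * n := by ring
  rw [hz'] at hz ⊢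
  simp only [pos_add_mul_lt hX, pos_add_mul_le hX]
  exact h.2 _ ((hp.add_mul _ _ _).1 hz)

lemma IsSucc.isPeriodic {n : ℕ} {X : Set ℤ} (hX : ∀ z : ℤ, z + n ∈ X ↔ z ∈ X) {p : Setoid ℤ}
    (hp : IsPeriodicPartition n p) {w : Perm ℤ} (hw : IsSucc X p w) : IsPeriodic n w := fun x => by
  have := (hw x).add_mul hX hp 1
  rw [one_mul] at this
  exact (hw _).unique this

lemma IsSucc.unique {X : Set ℤ} {p : Setoid ℤ} {w w' : Perm ℤ} (h : IsSucc X p w)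
    (h' : IsSucc X p w') : w = w' :=
  Equiv.ext fun x => (h x).unique (h' x)

lemma IsSucc.inv {X : Set ℤ} {p : Setoid ℤ} {w : Perm ℤ} (h : IsSucc X p w) :
    IsSucc Xᶜ p w⁻¹ := fun x => by
  have := h (w⁻¹ x)
  rw [perm_apply_inv] at this
  exact succ_compl.2 this

/-- In a finite part this is the next element, or the first one after the last. In an infinite part,
`x + n` for `x ∈ X` and `x - n` otherwise is a later element on the same side, and only finitely
many candidates precede it; no wrapping occurs. -/
lemma IsNCP.exists_succ {n : ℕ} (hn : 0 < n) {X : Set ℤ}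
    (hX : ∀ z : ℤ, z + n ∈ X ↔ z ∈ X) {p : Setoid ℤ} (hp : IsNCP n X p) (x : ℤ) :
    ∃ y, Succ X p x y := by
  by_cases hx : {y | p x y}.Finite
  · by_cases hne : {y | p x y ∧ pos X x < pos X y}.Nonempty
    · obtain ⟨y, ⟨hy1, hy2⟩, hy⟩ := Set.exists_min_image _ (pos X)
        (hx.subset fun y (hy : p x y ∧ _) => hy.1) hne
      refine ⟨y, hy1, fun z hz => Or.inl ⟨hy2, ?_⟩⟩
      by_contra hc
      push Not at hc
      exact absurd (hy z ⟨hz, hc.1⟩) (not_le.2 hc.2)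
    · obtain ⟨y, hy1, hy⟩ := Set.exists_min_image _ (pos X) hx ⟨x, p.refl x⟩
      refine ⟨y, hy1, fun z hz => Or.inr ⟨hy z hz, ?_⟩⟩
      by_contra hc
      exact hne ⟨z, hz, not_le.1 hc⟩
  · have hn' : (0 : ℤ) < n := by exact_mod_cast hn
    by_cases hxX : x ∈ X
    · have h1 := hp.rel_add_mul_of_infinite hn hX hx 1
      obtain ⟨y, ⟨hy1, hy2, hy3⟩, hy⟩ := Int.exists_least_of_bdd
        (P := fun y => p x y ∧ y ∈ X ∧ x < y) ⟨x, fun z hz => hz.2.2.le⟩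
        ⟨x + 1 * n, h1, (add_mul_mem_iff hX x 1).2 hxX, by linarith⟩
      refine ⟨y, hy1, fun z hz => Or.inl ⟨pos_lt_pos.2 (Or.inl ⟨hxX, hy2, hy3⟩), ?_⟩⟩
      simp only [← not_lt, pos_lt_pos]
      have := hy z
      by_cases hzX : z ∈ X <;> simp only [hxX, hzX, hy2] <;> grind
    · have h1 := hp.rel_add_mul_of_infinite hn hX hx (-1)
      obtain ⟨y, ⟨hy1, hy2, hy3⟩, hy⟩ := Int.exists_greatest_of_bdd
        (P := fun y => p x y ∧ y ∉ X ∧ y < x) ⟨x, fun z hz => hz.2.2.le⟩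
        ⟨x + -1 * n, h1, fun h => hxX ((add_mul_mem_iff hX x (-1)).1 h), by linarith⟩
      refine ⟨y, hy1, fun z hz => Or.inl ⟨pos_lt_pos.2 (Or.inr (Or.inr ⟨hxX, hy2, hy3⟩)), ?_⟩⟩
      simp only [← not_lt, pos_lt_pos]
      have := hy z
      by_cases hzX : z ∈ X <;> simp only [hxX, hzX, hy2] <;> grind

lemma IsNCP.exists_isSucc {n : ℕ} (hn : 0 < n) {X : Set ℤ}
    (hX : ∀ z : ℤ, z + n ∈ X ↔ z ∈ X) {p : Setoid ℤ} (hp : IsNCP n X p) :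
    ∃ w : Perm ℤ, IsSucc X p w := by
  choose f hf using hp.exists_succ hn hX
  choose g hg using hp.compl.exists_succ hn (fun z => not_congr (hX z))
  refine ⟨⟨f, g, fun x => ?_, fun x => ?_⟩, hf⟩
  · exact (hg (f x)).unique (succ_compl.2 (hf x))
  · exact (hf (g x)).unique (succ_compl.1 (hg x))

/-! ### Orbits of the cyclic successor permutation -/

lemma rel_of_sameCycle {p : Setoid ℤ} {w : Perm ℤ} (hw : ∀ x, p x (w x)) {x y : ℤ}
    (h : w.SameCycle x y) : p x y := by
  have key : ∀ k : ℤ, ∀ x, p x ((w ^ k) x) := fun k => by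
    induction k using Int.induction_on with
    | zero => intro x; simp
    | succ i ih =>
      intro x
      rw [zpow_add_one, Perm.mul_apply]
      exact p.trans (hw x) (ih _)
    | pred i ih =>
      intro x
      rw [zpow_sub_one, Perm.mul_apply]
      refine p.trans (p.symm ?_) (ih _)
      simpa using hw (w⁻¹ x)
  obtain ⟨k, rfl⟩ := h
  exact key k x

/-- A finite orbit of a permutation that satisfies the cyclic successor condition relatively to a
set containing the orbit contains all of that set. -/
lemma sameCycle_of_succ {X C : Set ℤ} (hC : C.Finite) {w : Perm ℤ} (hw : ∀ x ∈ C, w x ∈ C)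
    (hs : ∀ x ∈ C, ∀ z ∈ C, (pos X x < pos X (w x) ∧ (pos X z ≤ pos X x ∨ pos X (w x) ≤ pos X z)) ∨
      (pos X (w x) ≤ pos X z ∧ pos X z ≤ pos X x)) {x y : ℤ} (hx : x ∈ C) (hy : y ∈ C) :
    w.SameCycle x y := by
  by_contra hxy
  set O : Set ℤ := {z | z ∈ C ∧ w.SameCycle x z} with hO
  have hOf : O.Finite := hC.subset fun z hz => hz.1
  have hOw : ∀ z ∈ O, w z ∈ O := fun z hz => ⟨hw z hz.1, Perm.sameCycle_apply_right.2 hz.2⟩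
  have hne : ∀ z ∈ O, pos X z ≠ pos X y := fun z hz h => hxy (pos_injective X h ▸ hz.2)
  -- The largest element of the orbit below the missing point `y` would have an image beyond it but
  -- not beyond `y`, which is absurd. So the orbit lies above `y`, and then its last element cannot
  -- wrap around without reaching or passing `y`.
  have hlt : ∀ z ∈ O, pos X y < pos X z := by
    by_contra hc
    push Not at hc
    obtain ⟨z, hz, hzy⟩ := hc
    obtain ⟨u, ⟨hu, huy⟩, hmax⟩ := Set.exists_max_image {z | z ∈ O ∧ pos X z ≤ pos X y} (pos X)
      (hOf.subset fun z hz => hz.1) ⟨z, hz, hzy⟩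
    rcases hs u hu.1 y hy with ⟨h1, h2 | h2⟩ | ⟨h1, h2⟩
    · exact hne u hu (le_antisymm huy h2)
    · exact absurd (hmax _ ⟨hOw u hu, h2⟩) (not_le.2 h1)
    · exact hne u hu (le_antisymm huy h2)
  obtain ⟨u, hu, hmax⟩ := Set.exists_max_image O (pos X) hOf ⟨x, hx, Perm.SameCycle.refl w x⟩
  rcases hs u hu.1 y hy with ⟨h1, -⟩ | ⟨h1, h2⟩
  · exact absurd (hmax _ (hOw u hu)) (not_le.2 h1)
  · exact absurd (hlt _ (hOw u hu)) (not_lt.2 h1)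

/-- An infinite part has no last element, so its successor map never wraps around; its orbits are
therefore infinite. -/
lemma IsNCP.pos_lt_of_infinite {n : ℕ} (hn : 0 < n) {X : Set ℤ}
    (hX : ∀ z : ℤ, z + n ∈ X ↔ z ∈ X) {p : Setoid ℤ} (hp : IsNCP n X p) {w : Perm ℤ}
    (hw : IsSucc X p w) {x : ℤ} (hx : {y | p x y}.Infinite) : pos X x < pos X (w x) := by
  have hn' : (0 : ℤ) < n := by exact_mod_cast hn
  by_contra hc
  have key : ∀ z, p x z → pos X z ≤ pos X x := fun z hz => by
    rcases (hw x).2 z hz with h | h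
    · exact absurd h.1 hc
    · exact h.2
  by_cases hxX : x ∈ X
  · exact absurd (key _ (hp.rel_add_mul_of_infinite hn hX hx 1)) (not_le.2
      (pos_lt_pos.2 (Or.inl ⟨hxX, (add_mul_mem_iff hX x 1).2 hxX, by linarith⟩)))
  · exact absurd (key _ (hp.rel_add_mul_of_infinite hn hX hx (-1))) (not_le.2
      (pos_lt_pos.2 (Or.inr (Or.inr ⟨hxX, fun h => hxX ((add_mul_mem_iff hX x (-1)).1 h),
        by linarith⟩))))

lemma IsNCP.orbitOf_infinite {n : ℕ} (hn : 0 < n) {X : Set ℤ}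
    (hX : ∀ z : ℤ, z + n ∈ X ↔ z ∈ X) {p : Setoid ℤ} (hp : IsNCP n X p) {w : Perm ℤ}
    (hw : IsSucc X p w) {x : ℤ} : (orbitOf w x).Infinite ↔ {y | p x y}.Infinite := by
  constructor
  · exact fun h => h.mono fun y hy => rel_of_sameCycle (fun x => (hw x).1) hy
  · intro hx
    refine Set.infinite_of_injective_forall_mem (f := fun k : ℕ => (w ^ k) x) ?_
      (fun k => ⟨k, by simp⟩)
    have : StrictMono fun k : ℕ => pos X ((w ^ k) x) := strictMono_nat_of_lt_succ fun k => by
      rw [pow_succ', Perm.mul_apply]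
      apply hp.pos_lt_of_infinite hn hX hw
      rwa [← setOf_rel_eq (rel_of_sameCycle (fun x => (hw x).1) ⟨(k : ℤ), by rw [zpow_natCast]⟩)]
    exact fun i j hij => this.injective (congrArg (pos X) hij)

/-- A finite part is a single orbit. The infinite part consists of infinite orbits only, which
`orbitPartition` merges; as there is at most one such part, nothing else is merged. -/
lemma IsNCP.orbitPartition_eq {n : ℕ} (hn : 0 < n) {X : Set ℤ}
    (hX : ∀ z : ℤ, z + n ∈ X ↔ z ∈ X) {p : Setoid ℤ} (hp : IsNCP n X p) {w : Perm ℤ}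
    (hw : IsSucc X p w) : orbitPartition w = p := by
  ext x y
  change (w.SameCycle x y ∨ _) ↔ _
  rw [hp.orbitOf_infinite hn hX hw, hp.orbitOf_infinite hn hX hw]
  constructor
  · rintro (h | ⟨h, h'⟩)
    · exact rel_of_sameCycle (fun x => (hw x).1) h
    · exact hp.rel_of_infinite hn hX h h'
  · intro h
    by_cases hx : {y | p x y}.Infinite
    · exact Or.inr ⟨hx, setOf_rel_eq h ▸ hx⟩
    · refine Or.inl (sameCycle_of_succ (X := X) (Set.not_infinite.1 hx)
        (fun z hz => p.trans hz (hw z).1) (fun z hz u hu => ?_) (p.refl x) h)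
      exact (hw z).2 u (p.trans (p.symm hz) hu)

/-! ### Splitting a non-crossing partition by a reflection -/

/-- `z` lies in the half-open interval `[a, b)` of the boundary order. -/
def InIco (X : Set ℤ) (a b z : ℤ) : Prop := pos X a ≤ pos X z ∧ pos X z < pos X b

lemma inIco_add_mul {n : ℕ} {X : Set ℤ} (hX : ∀ z : ℤ, z + n ∈ X ↔ z ∈ X) (a b z m : ℤ) :
    InIco X (a + m * n) (b + m * n) (z + m * n) ↔ InIco X a b z := by
  simp only [InIco, pos_add_mul_lt hX, pos_add_mul_le hX]

/-- The pair `a, b` does not cross its translates. -/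
structure IsNonCrossingPair (n : ℕ) (X : Set ℤ) (a b : ℤ) : Prop where
  lt : pos X a < pos X b
  iff : ∀ m : ℤ, m ≠ 0 → (InIco X a b (a + m * n) ↔ InIco X a b (b + m * n))

lemma IsNonCrossingPair.iff' {n : ℕ} {X : Set ℤ} (hX : ∀ z : ℤ, z + n ∈ X ↔ z ∈ X) {a b : ℤ}
    (h : IsNonCrossingPair n X a b) {j m : ℤ} (hjm : j ≠ m) :
    InIco X (a + j * n) (b + j * n) (a + m * n) ↔ InIco X (a + j * n) (b + j * n) (b + m * n) := by
  have := h.iff (m - j) (sub_ne_zero.2 hjm.symm)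
  rw [← inIco_add_mul hX _ _ _ j, ← inIco_add_mul hX _ _ (b + _) j] at this
  convert this using 2 <;> ring

lemma IsNonCrossingPair.lt' {n : ℕ} {X : Set ℤ} (hX : ∀ z : ℤ, z + n ∈ X ↔ z ∈ X) {a b : ℤ}
    (h : IsNonCrossingPair n X a b) (m : ℤ) : pos X (a + m * n) < pos X (b + m * n) :=
  (pos_add_mul_lt hX _ _ _).2 h.lt

/-- The partition obtained from `p` by cutting along the translates of the interval `[a, b)`. -/
def split (n : ℕ) (X : Set ℤ) (a b : ℤ) (p : Setoid ℤ) : Setoid ℤ where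
  r x y := p x y ∧ ∀ m : ℤ, InIco X (a + m * n) (b + m * n) x ↔ InIco X (a + m * n) (b + m * n) y
  iseqv :=
    { refl := fun x => ⟨p.refl x, fun _ => Iff.rfl⟩
      symm := fun h => ⟨p.symm h.1, fun m => (h.2 m).symm⟩
      trans := fun h h' => ⟨p.trans h.1 h'.1, fun m => (h.2 m).trans (h'.2 m)⟩ }

lemma split_rel {n : ℕ} {X : Set ℤ} {a b : ℤ} {p : Setoid ℤ} {x y : ℤ} :
    split n X a b p x y ↔ p x y ∧ ∀ m : ℤ, InIco X (a + m * n) (b + m * n) x ↔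
      InIco X (a + m * n) (b + m * n) y := Iff.rfl

lemma split_mono {n : ℕ} {X : Set ℤ} {a b : ℤ} {p q : Setoid ℤ} (h : p ≤ q) :
    split n X a b p ≤ split n X a b q := fun _ _ hxy => ⟨h hxy.1, hxy.2⟩

lemma IsNonCrossingPair.not_split_rel {n : ℕ} {X : Set ℤ} {a b : ℤ}
    (h : IsNonCrossingPair n X a b) {p : Setoid ℤ} : ¬ split n X a b p a b := fun h' => by
  have := (h'.2 0).1 ⟨by simp, by simpa using h.lt⟩
  simpa using this.2

lemma IsNonCrossing.inIco_iff {X : Set ℤ} {p : Setoid ℤ} (hp : IsNonCrossing X p) {a b x y : ℤ}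
    (hab : p a b) (hxy : p x y) (hax : ¬ p a x) : InIco X a b x ↔ InIco X a b y := by
  have key : ∀ x y, p x y → ¬ p a x → InIco X a b x → InIco X a b y := by
    intro x y hxy hax h
    have hne : pos X a ≠ pos X x := fun he => hax (pos_injective X he ▸ p.refl a)
    have := hp a b x y hab hxy hax (lt_of_le_of_ne h.1 hne) h.2
    exact ⟨this.1.le, this.2⟩
  exact ⟨key x y hxy hax, key y x (p.symm hxy) fun h => hax (p.trans h (p.symm hxy))⟩

/-- A successor step jumps over no element of the part, so it can enter or leave `[a, b)` only by
landing on `a` or `b`. Parts not containing `a` and `b` do not cross the arc. -/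
lemma Succ.inIco_iff {X : Set ℤ} {p : Setoid ℤ} (hp : IsNonCrossing X p) {a b x y : ℤ}
    (hab : p a b) (hxy : Succ X p x y) (hya : y ≠ a) (hyb : y ≠ b) :
    InIco X a b x ↔ InIco X a b y := by
  by_cases hax : p a x
  · have h1 := hxy.2 a (p.symm hax)
    have h2 := hxy.2 b (p.trans (p.symm hax) hab)
    have h3 : pos X y ≠ pos X a := fun h => hya (pos_injective X h)
    have h4 : pos X y ≠ pos X b := fun h => hyb (pos_injective X h)
    unfold InIco
    generalize pos X a = a at *
    generalize pos X b = b at *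
    generalize pos X x = x at *
    generalize pos X y = y at *
    grind
  · exact hp.inIco_iff hab hxy.1 hax

lemma Succ.not_inIco {X : Set ℤ} {p : Setoid ℤ} {a b x : ℤ} (hab : p a b)
    (hxa : Succ X p x a) : ¬ InIco X a b x := by
  have h1 := hxa.2 b (p.trans hxa.1 hab)
  rintro ⟨h2, h3⟩
  rcases h1 with h1 | h1
  · exact absurd h1.1 (not_lt.2 h2)
  · exact absurd h1.2 (not_le.2 h3)

lemma Succ.inIco {X : Set ℤ} {p : Setoid ℤ} {a b x : ℤ} (hab : p a b) (h : pos X a < pos X b)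
    (hxb : Succ X p x b) : InIco X a b x := by
  rcases hxb.2 a (p.trans hxb.1 (p.symm hab)) with ⟨h1, h2 | h2⟩ | h1
  · exact ⟨h2, h1⟩
  · exact absurd h (not_lt.2 h2)
  · exact absurd h (not_lt.2 h1.1)

/-- After `w`, the reflection exchanges the two landing points where an arc is entered or left: the
last element of `[a, b)` returns to `a`, and the predecessor of `a`, lying outside the arc, is sent
to `b`. All other steps stay within one piece. -/
lemma IsNCP.split_isSucc {n : ℕ} {X : Set ℤ} (hX : ∀ z : ℤ, z + n ∈ X ↔ z ∈ X) {p : Setoid ℤ}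
    (hp : IsNCP n X p) {w : Perm ℤ} (hw : IsSucc X p w) {a b : ℤ} (hab : p a b)
    (hd : ¬ (n : ℤ) ∣ a - b) (hn : 0 < n)
    (hnc : IsNonCrossingPair n X a b) {t : Perm ℤ} (hta : ∀ m : ℤ, t (a + m * n) = b + m * n)
    (htb : ∀ m : ℤ, t (b + m * n) = a + m * n)
    (ht : ∀ z, (∀ m : ℤ, z ≠ a + m * n) → (∀ m : ℤ, z ≠ b + m * n) → t z = z) :
    IsSucc X (split n X a b p) (t * w) := by
  have hn' : (n : ℤ) ≠ 0 := by exact_mod_cast hn.ne'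
  have hne : ∀ j m : ℤ, a + j * n ≠ b + m * n := fun j m h => hd ⟨m - j, by linear_combination h⟩
  have habm : ∀ m, p (a + m * n) (b + m * n) := fun m => (hp.per.add_mul _ _ _).2 hab
  intro x
  rw [Perm.mul_apply]
  by_cases h1 : ∃ m : ℤ, w x = a + m * n
  · obtain ⟨m, hm⟩ := h1
    have hs := hw x
    rw [hm] at hs ⊢
    rw [hta]
    have hx := hs.not_inIco (habm m)
    refine ⟨⟨p.trans hs.1 (habm m), fun j => ?_⟩, fun z hz => ?_⟩
    · by_cases hj : j = m
      -- On the arc with the same index, both points lie outside; for another index, `x` behaves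
      -- like its `w`-image `a + m * n`, and this like `b + m * n` because the pair does not cross
      -- its translates.
      · subst hj
        exact iff_of_false hx fun h => lt_irrefl _ h.2
      · rw [← hnc.iff' hX hj]
        refine hs.inIco_iff hp.nc (habm j) (fun h => hj ?_) (hne m j)
        have : (m - j) * (n : ℤ) = 0 := by linear_combination h
        rcases mul_eq_zero.1 this with h | h
        · omega
        · exact absurd h hn'
    · have hz1 := hs.2 z hz.1
      have hz2 := mt (hz.2 m).2 hx
      have hlt := hnc.lt' hX m
      unfold InIco at hx hz2
      generalize pos X (a + m * n) = a at *
      generalize pos X (b + m * n) = b at *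
      generalize pos X x = x at *
      generalize pos X z = z at *
      grind
  by_cases h2 : ∃ m : ℤ, w x = b + m * n
  · obtain ⟨m, hm⟩ := h2
    have hs := hw x
    rw [hm] at hs ⊢
    rw [htb]
    have hlt := hnc.lt' hX m
    have hx := hs.inIco (habm m) hlt
    refine ⟨⟨p.trans hs.1 (p.symm (habm m)), fun j => ?_⟩, fun z hz => ?_⟩
    · by_cases hj : j = m
      · subst hj
        exact iff_of_true hx ⟨le_rfl, hlt⟩
      · rw [hnc.iff' hX hj]
        refine hs.inIco_iff hp.nc (habm j) (hne j m).symm (fun h => hj ?_)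
        have : (m - j) * (n : ℤ) = 0 := by linear_combination h
        rcases mul_eq_zero.1 this with h | h
        · omega
        · exact absurd h hn'
    · have hz1 := hs.2 z hz.1
      have hz2 := (hz.2 m).1 hx
      unfold InIco at hx hz2
      generalize pos X (a + m * n) = a at *
      generalize pos X (b + m * n) = b at *
      generalize pos X x = x at *
      generalize pos X z = z at *
      grind
  · push Not at h1 h2
    rw [ht _ h1 h2]
    exact ⟨⟨(hw x).1, fun m => (hw x).inIco_iff hp.nc (habm m) (h1 m) (h2 m)⟩,
      fun z hz => (hw x).2 z hz.1⟩

lemma IsNCP.split_per {n : ℕ} {X : Set ℤ} (hX : ∀ z : ℤ, z + n ∈ X ↔ z ∈ X) {p : Setoid ℤ}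
    (hp : IsNCP n X p) {a b : ℤ} : IsPeriodicPartition n (split n X a b p) := by
  intro x y
  have key : ∀ z m : ℤ, InIco X (a + m * n) (b + m * n) (z + n) ↔
      InIco X (a + (m - 1) * n) (b + (m - 1) * n) z := fun z m => by
    rw [← inIco_add_mul hX _ _ z 1]
    ring_nf
  simp only [split_rel, hp.per x y, key]
  refine and_congr_right fun _ => ⟨fun h m => by simpa using h (m + 1), fun h m => h _⟩

/-- Two pieces of the same part are told apart by some arc of the boundary order; one piece lies
inside it and the other outside, so they cannot be interleaved. -/
lemma IsNonCrossing.split {n : ℕ} {X : Set ℤ} {p : Setoid ℤ} (hp : IsNonCrossing X p) (a b : ℤ) :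
    IsNonCrossing X (split n X a b p) := by
  intro x x' y y' hx hy hxy h1 h2
  by_cases h : p x y
  · have : ∃ m : ℤ, ¬ (InIco X (a + m * n) (b + m * n) x ↔ InIco X (a + m * n) (b + m * n) y) := by
      by_contra hc
      push Not at hc
      exact hxy ⟨h, hc⟩
    obtain ⟨m, hm⟩ := this
    have hxm := hx.2 m
    have hym := hy.2 m
    unfold InIco at *
    generalize pos X (a + m * n) = a at *
    generalize pos X (b + m * n) = b at *
    generalize pos X x = x at *
    generalize pos X x' = x' at *
    generalize pos X y = y at *
    generalize pos X y' = y' at *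
    grind
  · exact hp x x' y y' hx.1 hy.1 h h1 h2

/-! ### Explicit arcs and the infinite parts of a split partition -/

lemma pos_le_pos {X : Set ℤ} {x y : ℤ} : pos X x ≤ pos X y ↔
    (x ∈ X ∧ y ∈ X ∧ x ≤ y) ∨ (x ∈ X ∧ y ∉ X) ∨ (x ∉ X ∧ y ∉ X ∧ y ≤ x) := by
  rw [← not_lt, pos_lt_pos]
  by_cases hx : x ∈ X <;> by_cases hy : y ∈ X <;> simp [hx, hy]

lemma inIco_of_mem_mem {X : Set ℤ} {a b z : ℤ} (ha : a ∈ X) (hb : b ∈ X) :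
    InIco X a b z ↔ z ∈ X ∧ a ≤ z ∧ z < b := by
  rw [InIco, pos_le_pos, pos_lt_pos]; tauto

lemma inIco_of_mem_notMem {X : Set ℤ} {a b z : ℤ} (ha : a ∈ X) (hb : b ∉ X) :
    InIco X a b z ↔ (z ∈ X ∧ a ≤ z) ∨ (z ∉ X ∧ b < z) := by
  rw [InIco, pos_le_pos, pos_lt_pos]; tauto

lemma inIco_of_notMem_notMem {X : Set ℤ} {a b z : ℤ} (ha : a ∉ X) (hb : b ∉ X) :
    InIco X a b z ↔ z ∉ X ∧ b < z ∧ z ≤ a := by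
  rw [InIco, pos_le_pos, pos_lt_pos]; tauto

/-- A non-crossing pair on one side is at distance less than `n`, so translates of the arc cannot
reach `b`. This puts `b` in the piece left outside all arcs. The half-open convention makes the
borderline case `b = a + n` on the side of `X` need the translate by `-n`. -/
lemma IsNonCrossingPair.not_inIco_right {n : ℕ} (hn : 0 < n) {X : Set ℤ}
    (hX : ∀ z : ℤ, z + n ∈ X ↔ z ∈ X) {a b : ℤ} (h : IsNonCrossingPair n X a b)
    (hab : a ∈ X ↔ b ∈ X) (m : ℤ) : ¬ InIco X (a + m * n) (b + m * n) b := by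
  have hn' : (0 : ℤ) < n := by exact_mod_cast hn
  have hlt := h.lt
  have hiff := h.iff 1 one_ne_zero
  intro hm
  rw [pos_lt_pos] at hlt
  by_cases ha : a ∈ X
  · have hb := hab.1 ha
    rw [inIco_of_mem_mem ha hb, inIco_of_mem_mem ha hb, add_mul_mem_iff hX, add_mul_mem_iff hX]
      at hiff
    rw [inIco_of_mem_mem ((add_mul_mem_iff hX a m).2 ha) ((add_mul_mem_iff hX b m).2 hb)] at hm
    have hba : b ≤ a + 1 * n := by
      by_contra hc
      have := hiff.1 ⟨ha, by linarith, by linarith⟩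
      linarith [this.2.2]
    have : 1 ≤ m := by
      by_contra hc
      nlinarith [hm.2.2]
    have : a < b := by tauto
    have : a + m * n ≤ b := hm.2.1
    have : b < a + 1 * n ∨ b = a + 1 * n := lt_or_eq_of_le hba
    have h2 := h.iff (-1) (by norm_num)
    rw [inIco_of_mem_mem ha hb, inIco_of_mem_mem ha hb, add_mul_mem_iff hX, add_mul_mem_iff hX]
      at h2
    rcases this with h3 | h3
    · nlinarith
    · have := h2.2 ⟨hb, by linarith, by linarith⟩
      linarith [this.2.1]
  · have hb : b ∉ X := fun hb => ha (hab.2 hb)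
    rw [inIco_of_notMem_notMem ha hb, inIco_of_notMem_notMem ha hb, add_mul_mem_iff hX,
      add_mul_mem_iff hX] at hiff
    rw [inIco_of_notMem_notMem (mt (add_mul_mem_iff hX a m).1 ha)
      (mt (add_mul_mem_iff hX b m).1 hb)] at hm
    have : m ≤ -1 := by
      by_contra hc
      nlinarith [hm.2.1]
    have hba : ¬ b + 1 * n ≤ a := fun hc => by
      have := hiff.2 ⟨hb, by linarith, hc⟩
      linarith [this.2.2]
    nlinarith [hm.2.2]

lemma finite_inIco {X : Set ℤ} {a b : ℤ} (hab : a ∈ X ↔ b ∈ X) : {z | InIco X a b z}.Finite := by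
  by_cases ha : a ∈ X
  · refine (Set.finite_Icc a b).subset fun z hz => ?_
    have := (inIco_of_mem_mem ha (hab.1 ha)).1 hz
    exact ⟨this.2.1, this.2.2.le⟩
  · refine (Set.finite_Icc b a).subset fun z hz => ?_
    have := (inIco_of_notMem_notMem ha (fun hb => ha (hab.2 hb))).1 hz
    exact ⟨this.2.1.le, this.2.2⟩

/-- Arcs on one side are finite, so an infinite piece lies outside all of them. It contains `b` and
every point of the old part on the opposite side. -/
lemma IsNCP.split_meets_of_same {n : ℕ} (hn : 0 < n) {X : Set ℤ}
    (hX : ∀ z : ℤ, z + n ∈ X ↔ z ∈ X) {p : Setoid ℤ} (hp : IsNCP n X p) {a b x : ℤ}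
    (hnc : IsNonCrossingPair n X a b) (hab : a ∈ X ↔ b ∈ X) (hxb : p x b)
    (hx : {y | AffineDual.split n X a b p x y}.Infinite) :
    (∃ y, AffineDual.split n X a b p x y ∧ y ∈ X) ∧
      ∃ y, AffineDual.split n X a b p x y ∧ y ∉ X := by
  have hxp : {y | p x y}.Infinite := hx.mono fun y hy => hy.1
  have hfin : ∀ m : ℤ, ¬ InIco X (a + m * n) (b + m * n) x := fun m hm =>
    hx ((finite_inIco (by rwa [add_mul_mem_iff hX, add_mul_mem_iff hX])).subset
      fun y hy => (hy.2 m).1 hm)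
  have hrel : ∀ z, p x z → (∀ m : ℤ, ¬ InIco X (a + m * n) (b + m * n) z) →
      AffineDual.split n X a b p x z := fun z hz h => ⟨hz, fun m => iff_of_false (hfin m) (h m)⟩
  have hb := hrel b hxb (hnc.not_inIco_right hn hX hab)
  obtain ⟨⟨c, hc, hcX⟩, ⟨γ, hγ, hγX⟩⟩ := hp.meets x hxp
  by_cases ha : a ∈ X
  · refine ⟨⟨b, hb, hab.1 ha⟩, γ, hrel γ hγ fun m hm => ?_, hγX⟩
    rw [inIco_of_mem_mem ((add_mul_mem_iff hX a m).2 ha)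
      ((add_mul_mem_iff hX b m).2 (hab.1 ha))] at hm
    exact hγX hm.1
  · have hb' : b ∉ X := fun hb => ha (hab.2 hb)
    refine ⟨⟨c, hrel c hc fun m hm => ?_, hcX⟩, b, hb, hb'⟩
    rw [inIco_of_notMem_notMem (mt (add_mul_mem_iff hX a m).1 ha)
      (mt (add_mul_mem_iff hX b m).1 hb')] at hm
    exact hm.1 hcX

/-- For a chord across the strip the arcs `[a + q * n, b + q * n)` decrease with `q`. A piece lies
in the difference of two consecutive ones, a bounded region between two chords. -/
lemma split_finite_of_mem_notMem {n : ℕ} (hn : 0 < n) {X : Set ℤ}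
    (hX : ∀ z : ℤ, z + n ∈ X ↔ z ∈ X) {p : Setoid ℤ} {a b : ℤ} (ha : a ∈ X) (hb : b ∉ X) (x : ℤ) :
    {y | AffineDual.split n X a b p x y}.Finite := by
  have hn' : (0 : ℤ) < n := by exact_mod_cast hn
  have hico : ∀ q z : ℤ, InIco X (a + q * n) (b + q * n) z ↔
      (z ∈ X ∧ a + q * n ≤ z) ∨ (z ∉ X ∧ b + q * n < z) := fun q z =>
    inIco_of_mem_notMem ((add_mul_mem_iff hX a q).2 ha) (mt (add_mul_mem_iff hX b q).1 hb)
  have key : ∃ q : ℤ, InIco X (a + q * n) (b + q * n) x ∧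
      ¬ InIco X (a + (q + 1) * n) (b + (q + 1) * n) x := by
    simp only [hico]
    by_cases hxX : x ∈ X
    · refine ⟨(x - a) / n, ?_⟩
      have h1 := Int.emod_add_mul_ediv (x - a) n
      have h2 := Int.emod_nonneg (x - a) hn'.ne'
      have h3 := Int.emod_lt_of_pos (x - a) hn'
      simp only [hxX, true_and, not_true, false_and, or_false, not_le]
      constructor <;> linarith
    -- The arc excludes its end point `b + q * n`, whence the `- 1`.
    · refine ⟨(x - b - 1) / n, ?_⟩
      have h1 := Int.emod_add_mul_ediv (x - b - 1) n
      have h2 := Int.emod_nonneg (x - b - 1) hn'.ne'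
      have h3 := Int.emod_lt_of_pos (x - b - 1) hn'
      simp only [hxX, not_false_iff, true_and, false_and, false_or, not_lt]
      constructor <;> linarith
  obtain ⟨q, hq1, hq2⟩ := key
  refine ((Set.finite_Icc (a + q * n) (a + (q + 1) * n)).union
    (Set.finite_Icc (b + q * n) (b + (q + 1) * n))).subset fun y hy => ?_
  rw [hy.2 q, hico] at hq1
  rw [hy.2 (q + 1), hico] at hq2
  by_cases hyX : y ∈ X
  · left
    simp only [hyX, true_and, not_true, false_and, or_false, not_le] at hq1 hq2
    exact ⟨hq1, hq2.le⟩
  · right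
    simp only [hyX, not_false_iff, true_and, false_and, false_or, not_lt] at hq1 hq2
    exact ⟨hq1.le, hq2⟩

/-- Only the condition on infinite pieces needs care: a chord across the strip leaves none in the
part of `a`, a pair on one side leaves at most the outer piece, and an infinite part not containing
`a` is not cut at all. -/
lemma IsNCP.split {n : ℕ} (hn : 0 < n) {X : Set ℤ} (hX : ∀ z : ℤ, z + n ∈ X ↔ z ∈ X)
    {p : Setoid ℤ} (hp : IsNCP n X p) {a b : ℤ} (hab : p a b)
    (hnc : IsNonCrossingPair n X a b) : IsNCP n X (split n X a b p) := by
  refine ⟨hp.split_per hX, hp.nc.split a b, fun x hx => ?_⟩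
  have hxp : {y | p x y}.Infinite := hx.mono fun y hy => hy.1
  have habm : ∀ m, p (a + m * n) (b + m * n) := fun m => (hp.per.add_mul _ _ _).2 hab
  by_cases hax : p a x
  · have hxb : p x b := p.trans (p.symm hax) hab
    by_cases hiff : a ∈ X ↔ b ∈ X
    · exact hp.split_meets_of_same hn hX hnc hiff hxb hx
    · have hlt := hnc.lt
      rw [pos_lt_pos] at hlt
      have ha : a ∈ X := by tauto
      have hb : b ∉ X := by tauto
      exact absurd (split_finite_of_mem_notMem hn hX ha hb x) hx
  · have hxa : ∀ m : ℤ, ¬ p (a + m * n) x := fun m h => hax ((hp.per.add_mul _ _ m).1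
      (p.trans h (hp.rel_add_mul_of_infinite hn hX hxp m)))
    have key : ∀ y, p x y → AffineDual.split n X a b p x y := fun y hy =>
      ⟨hy, fun m => hp.nc.inIco_iff (habm m) hy (hxa m)⟩
    obtain ⟨⟨c, hc, hcX⟩, ⟨γ, hγ, hγX⟩⟩ := hp.meets x hxp
    exact ⟨⟨c, key c hc, hcX⟩, γ, key γ hγ, hγX⟩

/-- A non-trivial non-crossing partition contains a non-crossing pair. -/
lemma IsNCP.exists_pair {n : ℕ} (hn : 0 < n) {X : Set ℤ} (hX : ∀ z : ℤ, z + n ∈ X ↔ z ∈ X)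
    {p : Setoid ℤ} (hp : IsNCP n X p) {x y : ℤ} (hxy : p x y) (hne : x ≠ y) :
    ∃ a b, p a b ∧ ¬ (n : ℤ) ∣ a - b ∧ IsNonCrossingPair n X a b := by
  have hn' : (0 : ℤ) < n := by exact_mod_cast hn
  by_cases hx : {y | p x y}.Infinite
  -- Two points of the infinite part on opposite sides will do: the chord joining them is parallel
  -- to its translates. In a finite part any two points will do, since the translates lie in other
  -- parts.
  · obtain ⟨⟨a, ha, haX⟩, ⟨b, hb, hbX⟩⟩ := hp.meets x hx
    refine ⟨a, b, p.trans (p.symm ha) hb, ?_, pos_lt_pos.2 (Or.inr (Or.inl ⟨haX, hbX⟩)),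
      fun m hm => ?_⟩
    · rintro ⟨m, hm⟩
      refine hbX ((add_mul_mem_iff hX b m).1 ?_)
      rwa [show b + m * n = a by linear_combination -hm]
    · rw [inIco_of_mem_notMem haX hbX, inIco_of_mem_notMem haX hbX, add_mul_mem_iff hX,
        add_mul_mem_iff hX]
      have h0 : 0 ≤ m * (n : ℤ) ↔ 0 < m * (n : ℤ) :=
        ⟨fun h => lt_of_le_of_ne h (mul_ne_zero hm hn'.ne').symm, le_of_lt⟩
      simp only [haX, hbX, true_and, not_true, false_and, or_false, false_or, not_false_iff,
        le_add_iff_nonneg_right, lt_add_iff_pos_right, h0]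
  · rw [Set.not_infinite] at hx
    have key : ∀ a b, p x a → p x b → pos X a < pos X b →
      ∃ a b, p a b ∧ ¬ (n : ℤ) ∣ a - b ∧ IsNonCrossingPair n X a b := by
      intro a b ha hb hlt
      have hab := p.trans (p.symm ha) hb
      have hf : {y | p a y}.Finite := by rwa [← setOf_rel_eq ha]
      refine ⟨a, b, hab, ?_, hlt, fun m hm => ?_⟩
      · rintro ⟨m, hm⟩
        have hb' : b = a + (-m) * n := by linear_combination -hm
        rw [hb'] at hab
        have := hp.per.eq_zero_of_rel_add_mul hn hf hab
        rw [hb', this] at hlt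
        simp at hlt
      · refine hp.nc.inIco_iff hab ((hp.per.add_mul _ _ _).2 hab) fun h => hm ?_
        exact hp.per.eq_zero_of_rel_add_mul hn hf h
    rcases lt_or_gt_of_ne (fun h => hne (pos_injective X h)) with h | h
    · exact key x y (p.refl x) hxy h
    · exact key y x hxy (p.refl x) h

/-! ### A linear representation detecting the finite parts -/

/-- The space of functions `f` on `ℤ` with `f (x + n) = 2 f x` that are constant on the parts of
`p`. -/
def fixSpace (n : ℕ) (p : Setoid ℤ) : Submodule ℚ (ℤ → ℚ) where
  carrier := {f | (∀ x, f (x + n) = 2 * f x) ∧ ∀ x y, p x y → f x = f y}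
  add_mem' := fun {f g} hf hg => ⟨fun x => by
    simp only [Pi.add_apply, hf.1, hg.1]; ring, fun x y h => by
    simp only [Pi.add_apply, hf.2 x y h, hg.2 x y h]⟩
  zero_mem' := ⟨fun x => by simp, fun x y _ => rfl⟩
  smul_mem' := fun c f hf => ⟨fun x => by
    simp only [Pi.smul_apply, hf.1, smul_eq_mul]; ring, fun x y h => by
    simp only [Pi.smul_apply, hf.2 x y h]⟩

lemma mem_fixSpace_bot {n : ℕ} {f : ℤ → ℚ} :
    f ∈ fixSpace n ⊥ ↔ ∀ x, f (x + n) = 2 * f x :=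
  ⟨fun h => h.1, fun h => ⟨h, fun x y hxy => by rw [show x = y from hxy]⟩⟩

lemma fixSpace_anti {n : ℕ} {p q : Setoid ℤ} (h : p ≤ q) : fixSpace n q ≤ fixSpace n p :=
  fun _ hf => ⟨hf.1, fun x y hxy => hf.2 x y (h hxy)⟩

lemma apply_add_mul {n : ℕ} {f : ℤ → ℚ} (hf : ∀ x, f (x + n) = 2 * f x) (x m : ℤ) :
    f (x + m * n) = 2 ^ m * f x := by
  induction m using Int.induction_on with
  | zero => simp
  | succ i ih =>
    have := hf (x + i * n)
    rw [show x + ((i : ℤ) + 1) * n = x + i * n + n by ring, this, ih,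
      zpow_add_one₀ two_ne_zero]
    ring
  | pred i ih =>
    have := hf (x + (-i - 1) * n)
    rw [show x + (-(i : ℤ) - 1) * n + n = x + -i * n by ring, ih] at this
    rw [zpow_sub_one₀ two_ne_zero]
    linarith

/-- A function in this space is determined by its values on `0, …, n - 1`. -/
lemma finiteDimensional_fixSpace {n : ℕ} (hn : 0 < n) (p : Setoid ℤ) :
    FiniteDimensional ℚ (fixSpace n p) := by
  let φ : fixSpace n p →ₗ[ℚ] (Fin n → ℚ) :=
    (LinearMap.funLeft ℚ ℚ (fun i : Fin n => (i : ℤ))).comp (fixSpace n p).subtype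
  refine FiniteDimensional.of_injective φ ?_
  rw [← LinearMap.ker_eq_bot, LinearMap.ker_eq_bot']
  intro f hf
  ext x
  have hn' : (0 : ℤ) < n := by exact_mod_cast hn
  have h1 := Int.emod_add_mul_ediv x n
  have h2 := Int.emod_nonneg x hn'.ne'
  have h3 := Int.emod_lt_of_pos x hn'
  have h4 : (f : ℤ → ℚ) ((x % n).toNat : ℤ) = 0 :=
    congrFun hf ⟨(x % n).toNat, by omega⟩
  rw [Int.toNat_of_nonneg h2] at h4
  have h5 := apply_add_mul f.2.1 (x % n) (x / n)
  rw [h4, mul_comm (x / n), h1] at h5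
  simpa using h5

/-- The dimension of the fixed space. -/
noncomputable def fixDim (n : ℕ) (p : Setoid ℤ) : ℕ := Module.finrank ℚ (fixSpace n p)

lemma fixDim_anti {n : ℕ} (hn : 0 < n) {p q : Setoid ℤ} (h : p ≤ q) :
    fixDim n q ≤ fixDim n p := by
  have := finiteDimensional_fixSpace hn p
  exact Submodule.finrank_mono (fixSpace_anti h)

lemma fixDim_le_bot {n : ℕ} (hn : 0 < n) (p : Setoid ℤ) : fixDim n p ≤ fixDim n ⊥ :=
  fixDim_anti hn bot_le

/-- An infinite orbit contains some `z` and `z + k * n` with `k > 0`; an invariant `f` then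
satisfies `f = 2 ^ k * f` there and vanishes. Hence merging the infinite orbits imposes no further
condition. -/
lemma mem_fixSpace_orbitPartition {n : ℕ} (hn : 0 < n) {w : Perm ℤ} {f : ℤ → ℚ} :
    f ∈ fixSpace n (orbitPartition w) ↔ (∀ x, f (x + n) = 2 * f x) ∧ ∀ x, f (w x) = f x := by
  constructor
  · exact fun h => ⟨h.1, fun x => (h.2 _ _ (Or.inl (Perm.sameCycle_apply_right.2
      (Perm.SameCycle.refl w x)))).symm⟩
  · rintro ⟨h1, h2⟩
    have key : ∀ x y, w.SameCycle x y → f x = f y := fun x y h =>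
      rel_of_sameCycle (p := Setoid.ker f) (fun x => (h2 x).symm) h
    have zero : ∀ x, (orbitOf w x).Infinite → f x = 0 := fun x hx => by
      obtain ⟨z, hz, k, hk, hzk⟩ := exists_add_mul_mem_of_infinite hn hx
      have e1 := key x z hz
      have e2 := key x _ hzk
      rw [apply_add_mul h1, ← e1] at e2
      have h3 : (1 : ℚ) < 2 ^ k := one_lt_zpow₀ (by norm_num) hk
      have : (2 ^ k - 1) * f x = 0 := by linarith
      rcases mul_eq_zero.1 this with h | h
      · linarith
      · exact h
    refine ⟨h1, fun x y hxy => ?_⟩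
    rcases hxy with h | ⟨hx, hy⟩
    · exact key x y h
    · rw [zero x hx, zero y hy]

lemma inf_fixSpace_le {n : ℕ} (hn : 0 < n) (u v : Perm ℤ) :
    fixSpace n (orbitPartition u) ⊓ fixSpace n (orbitPartition v) ≤
      fixSpace n (orbitPartition (u * v)) := by
  rintro f ⟨hu, hv⟩
  rw [SetLike.mem_coe, mem_fixSpace_orbitPartition hn] at hu hv
  rw [mem_fixSpace_orbitPartition hn]
  exact ⟨hu.1, fun x => by rw [Perm.mul_apply, hu.2, hv.2]⟩

lemma fixDim_add_le {n : ℕ} (hn : 0 < n) (p q : Setoid ℤ) :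
    fixDim n p + fixDim n q ≤
      fixDim n ⊥ + Module.finrank ℚ ↥(fixSpace n p ⊓ fixSpace n q) := by
  have := finiteDimensional_fixSpace hn p
  have := finiteDimensional_fixSpace hn q
  have := finiteDimensional_fixSpace hn ⊥
  rw [fixDim, fixDim, ← Submodule.finrank_sup_add_finrank_inf_eq]
  exact Nat.add_le_add_right (Submodule.finrank_mono
    (sup_le (fixSpace_anti bot_le) (fixSpace_anti bot_le))) _

/-- Subadditivity of the codimension of the fixed space, from the dimension formula for sums and
intersections. -/
lemma fixDim_mul {n : ℕ} (hn : 0 < n) (u v : Perm ℤ) :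
    fixDim n (orbitPartition u) + fixDim n (orbitPartition v) ≤
      fixDim n ⊥ + fixDim n (orbitPartition (u * v)) := by
  have := finiteDimensional_fixSpace hn (orbitPartition (u * v))
  exact (fixDim_add_le hn _ _).trans
    (Nat.add_le_add_left (Submodule.finrank_mono (inf_fixSpace_le hn u v)) _)

lemma fixDim_one {n : ℕ} (hn : 0 < n) : fixDim n (orbitPartition 1) = fixDim n ⊥ := by
  have : fixSpace n (orbitPartition 1) = fixSpace n ⊥ := by
    ext f
    rw [mem_fixSpace_orbitPartition hn, mem_fixSpace_bot]
    simp
  rw [fixDim, fixDim, this]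

/-! ### Reflections -/

/-- `t` is the reflection exchanging `a` and `b`. -/
structure IsSwap (n : ℕ) (a b : ℤ) (t : Perm ℤ) : Prop where
  left : ∀ m : ℤ, t (a + m * n) = b + m * n
  right : ∀ m : ℤ, t (b + m * n) = a + m * n
  fix : ∀ z, (∀ m : ℤ, z ≠ a + m * n) → (∀ m : ℤ, z ≠ b + m * n) → t z = z

lemma not_dvd_sub_iff {n : ℕ} {a z : ℤ} : ¬ (n : ℤ) ∣ z - a ↔ ∀ m : ℤ, z ≠ a + m * n := by
  constructor
  · rintro h m rfl
    exact h ⟨m, by ring⟩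
  · rintro h ⟨m, hm⟩
    exact h m (by linear_combination hm)

lemma isCycleWord_pair_iff {n : ℕ} {a b : ℤ} (hab : ¬ (n : ℤ) ∣ a - b) {t : Perm ℤ} :
    IsCycleWord n [a, b] 0 t ↔ IsSwap n a b t := by
  constructor
  · rintro ⟨-, -, h3, h4⟩
    refine ⟨h3 a b ⟨[], [a], by simp [closeUp]⟩, h3 b a ⟨[a], [], by simp [closeUp]⟩,
      fun z h1 h2 => h4 z ?_⟩
    simp only [List.mem_cons, List.not_mem_nil, or_false, forall_eq_or_imp, forall_eq]
    exact ⟨not_dvd_sub_iff.2 h1, not_dvd_sub_iff.2 h2⟩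
  · rintro ⟨h1, h2, h3⟩
    refine ⟨by simp, by simpa using hab, fun y z hyz m => ?_, fun z hz => ?_⟩
    · simp only [closeUp, zero_mul, add_zero, List.cons_append, List.nil_append,
        List.infix_cons_iff, List.cons_prefix_cons, List.prefix_nil] at hyz
      simp at hyz
      rcases hyz with ⟨rfl, rfl⟩ | ⟨rfl, rfl⟩
      · exact h1 m
      · exact h2 m
    · simp only [List.mem_cons, List.not_mem_nil, or_false, forall_eq_or_imp, forall_eq] at hz
      exact h3 z (not_dvd_sub_iff.1 hz.1) (not_dvd_sub_iff.1 hz.2)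

lemma exists_isSwap {n : ℕ} {a b : ℤ} (hab : ¬ (n : ℤ) ∣ a - b) : ∃ t, IsSwap n a b t := by
  classical
  set f : ℤ → ℤ := fun x => if (n : ℤ) ∣ x - a then x + (b - a) else
    if (n : ℤ) ∣ x - b then x + (a - b) else x with hf
  have hba : ¬ (n : ℤ) ∣ b - a := fun h => hab (by rw [← neg_sub]; exact h.neg_right)
  have hfa : ∀ m : ℤ, f (a + m * n) = b + m * n := fun m => by
    simp only [hf]
    rw [if_pos ⟨m, by ring⟩]; ring
  have hfb : ∀ m : ℤ, f (b + m * n) = a + m * n := fun m => by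
    simp only [hf]
    rw [if_neg, if_pos ⟨m, by ring⟩]
    · ring
    · rintro ⟨k, hk⟩
      exact hba ⟨k - m, by linear_combination hk⟩
  have hfz : ∀ z, (∀ m : ℤ, z ≠ a + m * n) → (∀ m : ℤ, z ≠ b + m * n) → f z = z := by
    intro z h1 h2
    simp only [hf]
    rw [if_neg (not_dvd_sub_iff.2 h1), if_neg (not_dvd_sub_iff.2 h2)]
  have hinv : Function.Involutive f := fun x => by
    by_cases h1 : ∃ m : ℤ, x = a + m * n
    · obtain ⟨m, rfl⟩ := h1
      rw [hfa, hfb]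
    by_cases h2 : ∃ m : ℤ, x = b + m * n
    · obtain ⟨m, rfl⟩ := h2
      rw [hfb, hfa]
    push Not at h1 h2
    rw [hfz x h1 h2, hfz x h1 h2]
  exact ⟨hinv.toPerm f, hfa, hfb, hfz⟩

lemma IsSwap.mul_self {n : ℕ} {a b : ℤ} {t : Perm ℤ} (ht : IsSwap n a b t) : t * t = 1 := by
  ext x
  rw [Perm.mul_apply, Perm.one_apply]
  by_cases h1 : ∃ m : ℤ, x = a + m * n
  · obtain ⟨m, rfl⟩ := h1
    rw [ht.left, ht.right]
  by_cases h2 : ∃ m : ℤ, x = b + m * n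
  · obtain ⟨m, rfl⟩ := h2
    rw [ht.right, ht.left]
  push Not at h1 h2
  rw [ht.fix x h1 h2, ht.fix x h1 h2]

lemma IsSwap.isPeriodic {n : ℕ} {a b : ℤ} {t : Perm ℤ} (ht : IsSwap n a b t) :
    IsPeriodic n t := fun x => by
  by_cases h1 : ∃ m : ℤ, x = a + m * n
  · obtain ⟨m, rfl⟩ := h1
    rw [ht.left, show a + m * n + n = a + (m + 1) * n by ring, ht.left]; ring
  by_cases h2 : ∃ m : ℤ, x = b + m * n
  · obtain ⟨m, rfl⟩ := h2
    rw [ht.right, show b + m * n + n = b + (m + 1) * n by ring, ht.right]; ring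
  push Not at h1 h2
  rw [ht.fix x h1 h2, ht.fix]
  · exact fun m hm => h1 (m - 1) (by linear_combination hm)
  · exact fun m hm => h2 (m - 1) (by linear_combination hm)

/-- Invariance under the reflection amounts to the single linear equation `f a = f b`. -/
lemma IsSwap.fixDim_le {n : ℕ} (hn : 0 < n) {a b : ℤ} {t : Perm ℤ} (ht : IsSwap n a b t) :
    fixDim n ⊥ ≤ fixDim n (orbitPartition t) + 1 := by
  have := finiteDimensional_fixSpace hn ⊥
  have := finiteDimensional_fixSpace hn (orbitPartition t)
  let φ : fixSpace n ⊥ →ₗ[ℚ] ℚ :=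
    ((LinearMap.proj a : (ℤ → ℚ) →ₗ[ℚ] ℚ) - LinearMap.proj b).comp
      (fixSpace n ⊥).subtype
  have h1 := LinearMap.finrank_range_add_finrank_ker φ
  have h2 : Module.finrank ℚ (LinearMap.range φ) ≤ 1 := by
    simpa using Submodule.finrank_le (LinearMap.range φ)
  have h3 : (LinearMap.ker φ).map (fixSpace n ⊥).subtype ≤ fixSpace n (orbitPartition t) := by
    rintro _ ⟨f, hf, rfl⟩
    have hab : (f : ℤ → ℚ) a = (f : ℤ → ℚ) b := sub_eq_zero.1 hf
    rw [mem_fixSpace_orbitPartition hn]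
    refine ⟨f.2.1, fun x => ?_⟩
    simp only [Submodule.subtype_apply]
    by_cases h1 : ∃ m : ℤ, x = a + m * n
    · obtain ⟨m, rfl⟩ := h1
      rw [ht.left, apply_add_mul f.2.1, apply_add_mul f.2.1, hab]
    by_cases h2 : ∃ m : ℤ, x = b + m * n
    · obtain ⟨m, rfl⟩ := h2
      rw [ht.right, apply_add_mul f.2.1, apply_add_mul f.2.1, hab]
    push Not at h1 h2
    rw [ht.fix x h1 h2]
  have h4 := Submodule.finrank_mono h3
  rw [Submodule.finrank_map_subtype_eq] at h4
  unfold fixDim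
  omega

lemma IsReflection.exists_isSwap {n : ℕ} {t : Perm ℤ} (ht : IsReflection n t) :
    ∃ a b, IsSwap n a b t := by
  obtain ⟨a, b, hab, h⟩ := ht
  exact ⟨a, b, (isCycleWord_pair_iff hab).1 h⟩

/-- This is the lower bound of the reflection length by the codimension of the fixed space. -/
lemma fixDim_prod_reflections {n : ℕ} (hn : 0 < n) (L : List (Perm ℤ))
    (hL : ∀ t ∈ L, IsReflection n t) :
    fixDim n ⊥ ≤ fixDim n (orbitPartition L.prod) + L.length := by
  induction L with
  | nil => simp [fixDim_one hn]
  | cons t L ih =>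
    obtain ⟨a, b, ht⟩ := (hL t (by simp)).exists_isSwap
    have h1 := ht.fixDim_le hn
    have h2 := ih fun u hu => hL u (by simp [hu])
    have h3 := fixDim_mul hn t L.prod
    rw [List.prod_cons, List.length_cons]
    omega

/-! ### Separation of finite parts -/

/-- The translates of a finite part are pairwise different, so the function equal to `2 ^ m` on the
`m`-th translate and `0` elsewhere is well defined; it takes the value `1` only on the part itself.
-/
lemma exists_separating {n : ℕ} (hn : 0 < n) {p : Setoid ℤ} (hp : IsPeriodicPartition n p) {x : ℤ}
    (hx : {y | p x y}.Finite) : ∃ f ∈ fixSpace n p, f x = 1 ∧ ∀ y, f y = 1 → p x y := by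
  classical
  have huniq : ∀ z m m', p (x + m * n) z → p (x + m' * n) z → m = m' := by
    intro z m m' h h'
    have h1 : p (x + m * n) (x + m' * n) := p.trans h (p.symm h')
    rw [show x + m' * n = (x + (m' - m) * n) + m * n by ring, hp.add_mul] at h1
    have := hp.eq_zero_of_rel_add_mul hn hx h1
    omega
  set f : ℤ → ℚ := fun z => if h : ∃ m : ℤ, p (x + m * n) z then 2 ^ h.choose else 0 with hf
  have hf1 : ∀ z m, p (x + m * n) z → f z = 2 ^ m := fun z m h => by
    have hex : ∃ m : ℤ, p (x + m * n) z := ⟨m, h⟩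
    simp only [hf]
    rw [dif_pos hex, huniq z _ _ hex.choose_spec h]
  have hf0 : ∀ z, (¬ ∃ m : ℤ, p (x + m * n) z) → f z = 0 := fun z h => by
    simp only [hf]
    rw [dif_neg h]
  refine ⟨f, ⟨fun z => ?_, fun y z hyz => ?_⟩, ?_, fun y hy => ?_⟩
  · by_cases h : ∃ m : ℤ, p (x + m * n) z
    · obtain ⟨m, hm⟩ := h
      rw [hf1 z m hm, hf1 (z + n) (m + 1), zpow_add_one₀ two_ne_zero]
      · ring
      · rw [← hp] at hm
        convert hm using 1; ring
    · rw [hf0 z h, hf0 (z + n), mul_zero]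
      rintro ⟨m, hm⟩
      refine h ⟨m - 1, ?_⟩
      rw [← hp]
      convert hm using 1; ring
  · by_cases h : ∃ m : ℤ, p (x + m * n) y
    · obtain ⟨m, hm⟩ := h
      rw [hf1 y m hm, hf1 z m (p.trans hm hyz)]
    · rw [hf0 y h, hf0 z]
      rintro ⟨m, hm⟩
      exact h ⟨m, p.trans hm (p.symm hyz)⟩
  · rw [hf1 x 0 (by simp), zpow_zero]
  · by_cases h : ∃ m : ℤ, p (x + m * n) y
    · obtain ⟨m, hm⟩ := h
      rw [hf1 y m hm, zpow_eq_one_iff_right₀ (by norm_num) (by norm_num)] at hy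
      subst hy
      simpa using hm
    · rw [hf0 y h] at hy
      simp at hy

/-- The fixed space remembers the finite parts through separating functions, and there is at most
one infinite part, made of all remaining points. -/
lemma IsNCP.le_of_fixSpace_le {n : ℕ} (hn : 0 < n) {X : Set ℤ}
    (hX : ∀ z : ℤ, z + n ∈ X ↔ z ∈ X) {p q : Setoid ℤ} (hq : IsNCP n X q)
    (h : fixSpace n q ≤ fixSpace n p) : p ≤ q := by
  intro x y hxy
  by_cases hx : {z | q x z}.Infinite
  · by_cases hy : {z | q y z}.Infinite
    · exact hq.rel_of_infinite hn hX hx hy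
    · obtain ⟨f, hf, h1, h2⟩ := exists_separating hn hq.per (Set.not_infinite.1 hy)
      exact q.symm (h2 x ((h hf).2 x y hxy ▸ h1))
  · obtain ⟨f, hf, h1, h2⟩ := exists_separating hn hq.per (Set.not_infinite.1 hx)
    exact h2 y ((h hf).2 x y hxy ▸ h1)

lemma IsNCP.fixDim_lt {n : ℕ} (hn : 0 < n) {X : Set ℤ}
    (hX : ∀ z : ℤ, z + n ∈ X ↔ z ∈ X) {p q : Setoid ℤ} (hp : IsNCP n X p) (hpq : p ≤ q)
    (hne : ¬ q ≤ p) : fixDim n q < fixDim n p := by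
  have := finiteDimensional_fixSpace hn p
  exact Submodule.finrank_lt_finrank_of_lt (lt_of_le_not_ge (fixSpace_anti hpq)
    fun h => hne (hp.le_of_fixSpace_le hn hX h))

/-! ### Reflection length and divisibility -/

/-- The split partition is strictly finer, so the dimension grows; since the two successor
permutations differ by one reflection, it grows by at most one. -/
lemma IsNCP.fixDim_split {n : ℕ} (hn : 0 < n) {X : Set ℤ} (hX : ∀ z : ℤ, z + n ∈ X ↔ z ∈ X)
    {p : Setoid ℤ} (hp : IsNCP n X p) {a b : ℤ} (hab : p a b) (hd : ¬ (n : ℤ) ∣ a - b)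
    (hnc : IsNonCrossingPair n X a b) : fixDim n (AffineDual.split n X a b p) = fixDim n p + 1 := by
  obtain ⟨w, hw⟩ := hp.exists_isSucc hn hX
  obtain ⟨t, ht⟩ := exists_isSwap hd
  have hs := hp.split_isSucc hX hw hab hd hn hnc ht.left ht.right ht.fix
  have hp' := hp.split hn hX hab hnc
  have h1 := hp'.fixDim_lt hn hX (q := p) (fun _ _ h => h.1) fun h => hnc.not_split_rel (h hab)
  have h2 := fixDim_mul hn t (t * w)
  rw [← mul_assoc, ht.mul_self, one_mul, hp.orbitPartition_eq hn hX hw,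
    hp'.orbitPartition_eq hn hX hs] at h2
  have h3 := ht.fixDim_le hn
  omega

lemma IsSucc.eq_one {X : Set ℤ} {p : Setoid ℤ} {w : Perm ℤ} (hw : IsSucc X p w)
    (h : ∀ x y, p x y → x = y) : w = 1 :=
  Equiv.ext fun x => (h _ _ (hw x).1).symm

/-- Splitting repeatedly until the partition is trivial removes one reflection for each unit of
codimension. Together with `fixDim_prod_reflections` this computes the length. -/
lemma IsNCP.exists_reflections {n : ℕ} (hn : 0 < n) {X : Set ℤ}
    (hX : ∀ z : ℤ, z + n ∈ X ↔ z ∈ X) {p : Setoid ℤ} (hp : IsNCP n X p) {w : Perm ℤ}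
    (hw : IsSucc X p w) : ∃ L : List (Perm ℤ), (∀ t ∈ L, IsReflection n t) ∧ L.prod = w ∧
      L.length + fixDim n p = fixDim n ⊥ := by
  induction hk : fixDim n ⊥ - fixDim n p using Nat.strong_induction_on generalizing p w with
  | _ k ih =>
    by_cases htriv : ∀ x y, p x y → x = y
    · have : p = ⊥ := le_antisymm htriv bot_le
      exact ⟨[], by simp, by simp [hw.eq_one htriv], by simp [this]⟩
    push Not at htriv
    obtain ⟨x, y, hxy, hne⟩ := htriv
    obtain ⟨a, b, hab, hd, hnc⟩ := hp.exists_pair hn hX hxy hne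
    obtain ⟨t, ht⟩ := exists_isSwap hd
    have hs := hp.split_isSucc hX hw hab hd hn hnc ht.left ht.right ht.fix
    have hp' := hp.split hn hX hab hnc
    have hdim := hp.fixDim_split hn hX hab hd hnc
    have hle := fixDim_le_bot hn (AffineDual.split n X a b p)
    obtain ⟨L, hL1, hL2, hL3⟩ := ih _ (by omega) hp' hs rfl
    refine ⟨t :: L, ?_, ?_, ?_⟩
    · rintro u hu
      rcases List.mem_cons.1 hu with rfl | hu
      · exact ⟨a, b, hd, (isCycleWord_pair_iff hd).2 ht⟩
      · exact hL1 u hu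
    · rw [List.prod_cons, hL2, ← mul_assoc, ht.mul_self, one_mul]
    · rw [List.length_cons]
      omega

lemma IsNCP.reflLength_add {n : ℕ} (hn : 0 < n) {X : Set ℤ}
    (hX : ∀ z : ℤ, z + n ∈ X ↔ z ∈ X) {p : Setoid ℤ} (hp : IsNCP n X p) {w : Perm ℤ}
    (hw : IsSucc X p w) : reflLength n w + fixDim n p = fixDim n ⊥ := by
  obtain ⟨L, hL1, hL2, hL3⟩ := hp.exists_reflections hn hX hw
  have hmem : L.length ∈ {k : ℕ | ∃ L : List (Perm ℤ), (∀ r ∈ L, IsReflection n r) ∧ L.prod = w ∧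
      L.length = k} := ⟨L, hL1, hL2, rfl⟩
  have h1 := Nat.sInf_le hmem
  obtain ⟨L', hL1', hL2', hL3'⟩ := Nat.sInf_mem ⟨_, hmem⟩
  have h2 := fixDim_prod_reflections hn L' hL1'
  rw [hL2', hL3', hp.orbitPartition_eq hn hX hw] at h2
  change sInf _ + _ = _
  omega

/-- A pair contained in a part of `p` is contained in a part of `q`, so the same reflection `t`
splits both partitions, and `(t * v)⁻¹ * (t * w) = v⁻¹ * w`. When `p` has become trivial, what is
left of `q` is the required `r`. -/
lemma IsNCP.exists_left_quotient {n : ℕ} (hn : 0 < n) {X : Set ℤ}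
    (hX : ∀ z : ℤ, z + n ∈ X ↔ z ∈ X) {p q : Setoid ℤ} (hp : IsNCP n X p) (hq : IsNCP n X q)
    (hpq : p ≤ q) {v w : Perm ℤ} (hv : IsSucc X p v) (hw : IsSucc X q w) :
    ∃ r, IsNCP n X r ∧ IsSucc X r (v⁻¹ * w) ∧ fixDim n p + fixDim n r = fixDim n ⊥ + fixDim n q := by
  induction hk : fixDim n ⊥ - fixDim n p using Nat.strong_induction_on generalizing p q v w with
  | _ k ih =>
    by_cases htriv : ∀ x y, p x y → x = y
    · have : p = ⊥ := le_antisymm htriv bot_le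
      refine ⟨q, hq, ?_, by rw [this]⟩
      rwa [hv.eq_one htriv, inv_one, one_mul]
    push Not at htriv
    obtain ⟨x, y, hxy, hne⟩ := htriv
    obtain ⟨a, b, hab, hd, hnc⟩ := hp.exists_pair hn hX hxy hne
    obtain ⟨t, ht⟩ := exists_isSwap hd
    have hle := fixDim_le_bot hn (AffineDual.split n X a b p)
    have hdp := hp.fixDim_split hn hX hab hd hnc
    have hdq := hq.fixDim_split hn hX (hpq hab) hd hnc
    obtain ⟨r, hr1, hr2, hr3⟩ := ih _ (by omega) (hp.split hn hX hab hnc)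
      (hq.split hn hX (hpq hab) hnc) (split_mono hpq)
      (hp.split_isSucc hX hv hab hd hn hnc ht.left ht.right ht.fix)
      (hq.split_isSucc hX hw (hpq hab) hd hn hnc ht.left ht.right ht.fix) rfl
    refine ⟨r, hr1, ?_, by omega⟩
    rwa [mul_inv_rev, mul_assoc, inv_mul_cancel_left] at hr2

/-- Exchanging the sides of the strip replaces `v` and `w` by their inverses, and the inverse of
`(v⁻¹)⁻¹ * w⁻¹` is `w * v⁻¹`. -/
lemma IsNCP.exists_right_quotient {n : ℕ} (hn : 0 < n) {X : Set ℤ}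
    (hX : ∀ z : ℤ, z + n ∈ X ↔ z ∈ X) {p q : Setoid ℤ} (hp : IsNCP n X p) (hq : IsNCP n X q)
    (hpq : p ≤ q) {v w : Perm ℤ} (hv : IsSucc X p v) (hw : IsSucc X q w) :
    ∃ r, IsNCP n X r ∧ IsSucc X r (w * v⁻¹) ∧ fixDim n p + fixDim n r = fixDim n ⊥ + fixDim n q := by
  obtain ⟨r, hr1, hr2, hr3⟩ := hp.compl.exists_left_quotient hn (fun z => not_congr (hX z))
    hq.compl hpq hv.inv hw.inv
  have h1 := hr1.compl
  have h2 := hr2.inv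
  rw [compl_compl] at h1 h2
  exact ⟨r, h1, by simpa using h2, hr3⟩

/-- The common fixed functions of `u` and `v` are fixed by `w`. Additivity of codimensions makes
this inclusion an equality, so the fixed space of `w` lies in both others. -/
lemma le_of_mul_eq {n : ℕ} (hn : 0 < n) {X : Set ℤ}
    (hX : ∀ z : ℤ, z + n ∈ X ↔ z ∈ X) {p q r : Setoid ℤ} (hp : IsNCP n X p) (hq : IsNCP n X q)
    (hr : IsNCP n X r) {u v w : Perm ℤ} (hu : IsSucc X p u) (hv : IsSucc X r v)
    (hw : IsSucc X q w) (huv : u * v = w)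
    (hdim : fixDim n p + fixDim n r = fixDim n ⊥ + fixDim n q) : p ≤ q ∧ r ≤ q := by
  have := finiteDimensional_fixSpace hn q
  have h1 := inf_fixSpace_le hn u v
  rw [huv, hp.orbitPartition_eq hn hX hu, hr.orbitPartition_eq hn hX hv,
    hq.orbitPartition_eq hn hX hw] at h1
  have h2 := fixDim_add_le hn p r
  have h3 : fixSpace n p ⊓ fixSpace n r = fixSpace n q :=
    Submodule.eq_of_le_of_finrank_le h1 (by change fixDim n q ≤ _; omega)
  exact ⟨hq.le_of_fixSpace_le hn hX (h3 ▸ inf_le_left),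
    hq.le_of_fixSpace_le hn hX (h3 ▸ inf_le_right)⟩

/-! ### Total shift -/

/-- A periodic permutation permutes the residues modulo `n`; `σ` is this permutation on the
representatives `1, …, n`. This makes the total shift additive. -/
lemma sum_Icc_comp {n : ℕ} (hn : 0 < n) {v : Perm ℤ} (hv : IsPeriodic n v) {g : ℤ → ℚ}
    (hg : ∀ x m : ℤ, g (x + m * n) = g x) :
    ∑ x ∈ Finset.Icc (1 : ℤ) n, g (v x) = ∑ x ∈ Finset.Icc (1 : ℤ) n, g x := by
  have hn' : (0 : ℤ) < n := by exact_mod_cast hn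
  set σ : ℤ → ℤ := fun x => (v x - 1) % n + 1 with hσ
  have hσv : ∀ x, v x = σ x + ((v x - 1) / n) * n := fun x => by
    have := Int.emod_add_mul_ediv (v x - 1) n
    simp only [hσ]
    linarith
  have hmaps : Set.MapsTo σ (Finset.Icc (1 : ℤ) n) (Finset.Icc (1 : ℤ) n) := fun x _ => by
    have h2 := Int.emod_nonneg (v x - 1) hn'.ne'
    have h3 := Int.emod_lt_of_pos (v x - 1) hn'
    simp only [hσ, Finset.coe_Icc, Set.mem_Icc]
    omega
  have hinj : Set.InjOn σ (Finset.Icc (1 : ℤ) n) := by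
    intro x hx y hy hxy
    have h1 := hσv x
    rw [hxy] at h1
    have h2 := hσv y
    set k := (v x - 1) / n - (v y - 1) / n with hk
    have h3 : v x = v (y + k * n) := by
      rw [hv.add_mul, hk]
      linear_combination h1 - h2
    have h4 := v.injective h3
    simp only [Finset.coe_Icc, Set.mem_Icc] at hx hy
    have hk0 : k = 0 := by
      rcases lt_trichotomy k 0 with h | h | h
      · nlinarith
      · exact h
      · nlinarith
    simpa [hk0] using h4
  refine Finset.sum_nbij σ hmaps hinj
    (Finset.surjOn_of_injOn_of_card_le σ hmaps hinj le_rfl) fun x _ => ?_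
  rw [hσv x, hg]

lemma totalShift_mul {n : ℕ} (hn : 0 < n) {u v : Perm ℤ} (hu : IsPeriodic n u)
    (hv : IsPeriodic n v) : totalShift n (u * v) = totalShift n u + totalShift n v := by
  have h := sum_Icc_comp hn hv (g := fun x => (u x : ℚ) - x) fun x m => by
    rw [hu.add_mul]; push_cast; ring
  rw [totalShift, totalShift, totalShift, ← mul_add, ← h, ← Finset.sum_add_distrib]
  congr 1
  refine Finset.sum_congr rfl fun x _ => ?_
  rw [Perm.mul_apply]; ring

lemma totalShift_one (n : ℕ) : totalShift n 1 = 0 := by simp [totalShift]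

lemma IsSwap.totalShift {n : ℕ} (hn : 0 < n) {a b : ℤ} {t : Perm ℤ} (ht : IsSwap n a b t) :
    totalShift n t = 0 := by
  have := totalShift_mul hn ht.isPeriodic ht.isPeriodic
  rw [ht.mul_self, totalShift_one] at this
  linarith

lemma totalShift_prod_reflections {n : ℕ} (hn : 0 < n) (L : List (Perm ℤ))
    (hL : ∀ t ∈ L, IsReflection n t) : IsPeriodic n L.prod ∧ totalShift n L.prod = 0 := by
  induction L with
  | nil => exact ⟨IsPeriodic.one, totalShift_one n⟩
  | cons t L ih =>
    obtain ⟨a, b, ht⟩ := (hL t (by simp)).exists_isSwap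
    obtain ⟨h1, h2⟩ := ih fun u hu => hL u (by simp [hu])
    rw [List.prod_cons, totalShift_mul hn ht.isPeriodic h1, ht.totalShift hn, h2, add_zero]
    exact ⟨ht.isPeriodic.mul h1, rfl⟩

lemma IsNCP.totalShift_eq_zero {n : ℕ} (hn : 0 < n) {X : Set ℤ}
    (hX : ∀ z : ℤ, z + n ∈ X ↔ z ∈ X) {p : Setoid ℤ} (hp : IsNCP n X p) {w : Perm ℤ}
    (hw : IsSucc X p w) : totalShift n w = 0 := by
  obtain ⟨L, hL, rfl, -⟩ := hp.exists_reflections hn hX hw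
  exact (totalShift_prod_reflections hn L hL).2

lemma totalShift_pos {n : ℕ} (hn : 0 < n) {u : Perm ℤ} (hu : IsPeriodic n u) (h : ∀ x, x ≤ u x)
    {x : ℤ} (hx : u x ≠ x) : 0 < totalShift n u := by
  have hn' : (0 : ℤ) < n := by exact_mod_cast hn
  rw [totalShift]
  refine mul_pos (by positivity) (Finset.sum_pos' (fun y _ => ?_) ?_)
  · rw [sub_nonneg]; exact_mod_cast h y
  · refine ⟨(x - 1) % n + 1, ?_, ?_⟩
    · have h2 := Int.emod_nonneg (x - 1) hn'.ne'
      have h3 := Int.emod_lt_of_pos (x - 1) hn'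
      rw [Finset.mem_Icc]
      omega
    · rw [sub_pos]
      have h1 := Int.emod_add_mul_ediv (x - 1) n
      have h4 : x = ((x - 1) % n + 1) + ((x - 1) / n) * n := by linarith
      have h5 := hu.add_mul ((x - 1) % n + 1) ((x - 1) / n)
      rw [← h4] at h5
      have h6 := lt_of_le_of_ne (h x) (Ne.symm hx)
      have : (x - 1) % n + 1 < u ((x - 1) % n + 1) := by linarith
      exact_mod_cast this

lemma totalShift_neg {n : ℕ} (hn : 0 < n) {u : Perm ℤ} (hu : IsPeriodic n u) (h : ∀ x, u x ≤ x)
    {x : ℤ} (hx : u x ≠ x) : totalShift n u < 0 := by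
  have h1 := totalShift_mul hn hu hu.inv
  rw [mul_inv_cancel, totalShift_one] at h1
  have h2 := totalShift_pos hn hu.inv (fun y => by
    have := h (u⁻¹ y)
    rwa [perm_apply_inv] at this) (x := x) (fun hc => hx (by
      conv_lhs => rw [← hc]
      exact perm_apply_inv u x))
  linarith

/-! ### Consecutive letters of words -/

lemma mem_of_pair_infix {y z : ℤ} {M : List ℤ} (h : [y, z] <:+: M) : y ∈ M ∧ z ∈ M := by
  obtain ⟨s, t, rfl⟩ := h
  simp

lemma exists_pair_infix {n : ℕ} {h : ℤ} {L : List ℤ} {x : ℤ} (hx : x ∈ L) :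
    ∃ z, [x, z] <:+: closeUp n h L := by
  obtain ⟨s, t, rfl⟩ := List.append_of_mem hx
  cases t with
  | cons z t =>
    refine ⟨z, ?_⟩
    cases s with
    | nil => exact ⟨[], t ++ [x + h * n], by simp [closeUp]⟩
    | cons a s => exact ⟨a :: s, t ++ [a + h * n], by simp [closeUp]⟩
  | nil =>
    cases s with
    | nil => exact ⟨x + h * n, [], [], by simp [closeUp]⟩
    | cons a s => exact ⟨a + h * n, a :: s, [], by simp [closeUp]⟩

lemma pair_infix_append_singleton {y z c : ℤ} {L : List ℤ} (h : [y, z] <:+: L ++ [c]) :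
    [y, z] <:+: L ∨ (z = c ∧ ∃ s, L = s ++ [y]) := by
  obtain ⟨s, t, h⟩ := h
  rcases List.eq_nil_or_concat t with rfl | ⟨t, d, rfl⟩
  · right
    have : (s ++ [y]) ++ [z] = L ++ [c] := by simpa using h
    obtain ⟨h1, h2⟩ := List.append_inj' this rfl
    exact ⟨by simpa using h2, s, h1.symm⟩
  · left
    have : (s ++ [y, z] ++ t) ++ [d] = L ++ [c] := by simpa using h
    exact ⟨s, t, (List.append_inj' this rfl).1⟩

/-- In a word that is sorted with respect to `f`, there is nothing between consecutive letters. -/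
lemma not_between_of_pair_infix {α : Type*} [LinearOrder α] {f : ℤ → α} {M : List ℤ}
    (hM : M.Pairwise fun x y => f x < f y) {y z : ℤ} (h : [y, z] <:+: M) :
    f y < f z ∧ ∀ c ∈ M, f c ≤ f y ∨ f z ≤ f c := by
  obtain ⟨s, t, rfl⟩ := h
  simp only [List.append_assoc, List.pairwise_append, List.cons_append, List.nil_append,
    List.pairwise_cons, List.mem_cons] at hM
  obtain ⟨-, ⟨hy, hz, -⟩, hs⟩ := hM
  refine ⟨hy z (by simp), fun c hc => ?_⟩
  simp only [List.mem_append, List.mem_cons, List.not_mem_nil, or_false] at hc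
  rcases hc with (hc | rfl | rfl) | hc
  · exact Or.inl (hs c hc y (by simp)).le
  · exact Or.inl le_rfl
  · exact Or.inr le_rfl
  · exact Or.inr (hz c hc).le

lemma mem_of_pair_infix_closeUp_left {n : ℕ} {h : ℤ} {L : List ℤ} {y z : ℤ}
    (hyz : [y, z] <:+: closeUp n h L) : y ∈ L := by
  cases L with
  | nil => simp [closeUp] at hyz
  | cons a L =>
    rcases pair_infix_append_singleton hyz with h1 | ⟨-, s, h1⟩
    · exact (mem_of_pair_infix h1).1
    · rw [h1]; simp

lemma mem_of_pair_infix_closeUp_right {n : ℕ} {h : ℤ} {L : List ℤ} {y z : ℤ}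
    (hyz : [y, z] <:+: closeUp n h L) : z ∈ L ∨ ∃ a ∈ L, z = a + h * n := by
  cases L with
  | nil => simp [closeUp] at hyz
  | cons a L =>
    rcases pair_infix_append_singleton hyz with h1 | ⟨h1, -⟩
    · exact Or.inl (mem_of_pair_infix h1).2
    · exact Or.inr ⟨a, by simp, h1⟩

/-- Consecutive letters of a sorted word closed up cyclically are cyclic successors. -/
lemma succ_of_pair_infix {X : Set ℤ} {n : ℕ} {L : List ℤ}
    (hL : L.Pairwise fun x y => pos X x < pos X y) {y z : ℤ} (h : [y, z] <:+: closeUp n 0 L)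
    {c : ℤ} (hc : c ∈ L) : (pos X y < pos X z ∧ (pos X c ≤ pos X y ∨ pos X z ≤ pos X c)) ∨
      (pos X z ≤ pos X c ∧ pos X c ≤ pos X y) := by
  cases L with
  | nil => simp at hc
  | cons a L =>
    rcases pair_infix_append_singleton h with h1 | ⟨h1, s, h2⟩
    · have := not_between_of_pair_infix hL h1
      exact Or.inl ⟨this.1, this.2 c hc⟩
    · right
      rw [zero_mul, add_zero] at h1
      subst h1
      constructor
      · rcases List.mem_cons.1 hc with rfl | hc
        · exact le_rfl
        · exact ((List.pairwise_cons.1 hL).1 c hc).le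
      · rw [h2] at hL hc
        rw [List.pairwise_append] at hL
        rcases List.mem_append.1 hc with hc | hc
        · exact (hL.2.2 c hc y (by simp)).le
        · rw [List.mem_singleton.1 hc]

lemma IsIncreasingWord.bounds {n : ℕ} {X : Set ℤ} {A : List ℤ} (hA : IsIncreasingWord n X A)
    {a b : ℤ} (ha : a ∈ A) (hb : b ∈ A) : a < b + n := by
  obtain ⟨-, hA⟩ := hA
  cases A with
  | nil => simp at ha
  | cons c A =>
    have h1 : ∀ x ∈ c :: A, x < c + 1 * n := fun x hx => by
      exact (List.pairwise_append.1 hA).2.2 x hx _ (by simp)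
    have h2 := (List.pairwise_append.1 hA).1
    have h3 : c ≤ b := by
      rcases List.mem_cons.1 hb with rfl | hb
      · exact le_rfl
      · exact ((List.pairwise_cons.1 h2).1 b hb).le
    linarith [h1 a ha]

lemma IsIncreasingWord.sorted {n : ℕ} {X : Set ℤ} {A : List ℤ} (hA : IsIncreasingWord n X A) :
    A.Pairwise (· < ·) := by
  obtain ⟨-, hA⟩ := hA
  cases A with
  | nil => simp
  | cons c A => exact (List.pairwise_append.1 hA).1

lemma isIncreasingWord_of {n : ℕ} {X : Set ℤ} {A : List ℤ} (h : ∀ a ∈ A, a ∈ X)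
    (hA : A.Pairwise (· < ·)) (hn : ∀ a ∈ A, ∀ b ∈ A, a < b + n) : IsIncreasingWord n X A := by
  refine ⟨h, ?_⟩
  cases A with
  | nil => simp [closeUp]
  | cons c A =>
    refine List.pairwise_append.2 ⟨hA, by simp, fun a ha b hb => ?_⟩
    rw [List.mem_singleton.1 hb]
    linarith [hn a ha c (by simp)]

lemma closeUp_map_neg (n : ℕ) (h : ℤ) (L : List ℤ) :
    closeUp n h (L.map (- ·)) = (closeUp n (-h) L).map (- ·) := by
  cases L with
  | nil => rfl
  | cons a L => simp [closeUp]; ring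

/-- Negation transfers results on increasing words to decreasing ones. -/
lemma isDecreasingWord_iff {n : ℕ} {Ξ : Set ℤ} {B : List ℤ} :
    IsDecreasingWord n Ξ B ↔ IsIncreasingWord n (-Ξ) (B.map (- ·)) := by
  rw [IsDecreasingWord, IsIncreasingWord, closeUp_map_neg, List.pairwise_map]
  simp
  exact fun _ => ⟨fun h a => h _, fun h b hb => by simpa using h (-b) (by simpa)⟩

lemma pair_infix_map_neg {y z : ℤ} {M : List ℤ} (h : [y, z] <:+: M) :
    [-y, -z] <:+: M.map (- ·) := by
  simpa using h.map (- ·)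

lemma pair_infix_of_map_neg {y z : ℤ} {M : List ℤ} (h : [y, z] <:+: M.map (- ·)) :
    [-y, -z] <:+: M := by
  have := h.map (- ·)
  simpa [Function.comp_def] using this

lemma IsDecreasingWord.bounds {n : ℕ} {Ξ : Set ℤ} {B : List ℤ} (hB : IsDecreasingWord n Ξ B)
    {a b : ℤ} (ha : a ∈ B) (hb : b ∈ B) : a < b + n := by
  have := (isDecreasingWord_iff.1 hB).bounds (a := -b) (b := -a) (by simpa) (by simpa)
  linarith

lemma IsDecreasingWord.sorted {n : ℕ} {Ξ : Set ℤ} {B : List ℤ} (hB : IsDecreasingWord n Ξ B) :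
    B.Pairwise (· > ·) := by
  have := (isDecreasingWord_iff.1 hB).sorted
  rw [List.pairwise_map] at this
  exact this.imp fun h => by simpa using h

/-- Nothing of `A + n ℤ` lies between consecutive letters of an increasing word `A`. -/
lemma IsIncreasingWord.not_between {n : ℕ} {X : Set ℤ} {A : List ℤ} (hA : IsIncreasingWord n X A)
    {y z : ℤ} (h : [y, z] <:+: closeUp n 1 A) :
    y < z ∧ ∀ c ∈ A, ∀ m : ℤ, c + m * n ≤ y ∨ z ≤ c + m * n := by
  have hs := not_between_of_pair_infix (f := id) hA.2 h
  refine ⟨hs.1, fun c hc m => ?_⟩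
  by_contra hcon
  push Not at hcon
  have hy := mem_of_pair_infix_closeUp_left h
  have hn0 : (0 : ℤ) ≤ n := by positivity
  have h1 := hA.bounds hc hy
  have h2 : z ≤ c + 1 * n := by
    cases A with
    | nil => simp at hc
    | cons a A =>
      have hA2 := hA.2
      have hac : a ≤ c := by
        rcases List.mem_cons.1 hc with rfl | hc
        · exact le_rfl
        · exact ((List.pairwise_cons.1 hA.sorted).1 c hc).le
      have : z ≤ a + 1 * n := by
        rcases List.mem_append.1 (mem_of_pair_infix h).2 with hz | hz
        · exact ((List.pairwise_append.1 hA2).2.2 z hz _ (by simp)).le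
        · rw [List.mem_singleton.1 hz]
      linarith
  -- All letters lie within one period, so only the translate with `m = 0` could lie strictly
  -- between `y` and `z`, and there sortedness of the closed-up word excludes it.
  have hm1 : m < 1 := by
    by_contra hm
    nlinarith [hcon.2]
  have hm2 : -1 < m := by
    by_contra hm
    nlinarith [hcon.1]
  have hm : m = 0 := by omega
  subst hm
  have hc' : c ∈ closeUp n 1 A := by
    cases A with
    | nil => simp at hc
    | cons a A => exact List.mem_append_left _ hc
  have := hs.2 c hc'
  simp only [id, zero_mul, add_zero] at *
  omega

lemma IsDecreasingWord.not_between {n : ℕ} {Ξ : Set ℤ} {B : List ℤ} (hB : IsDecreasingWord n Ξ B)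
    {y z : ℤ} (h : [y, z] <:+: closeUp n (-1) B) :
    z < y ∧ ∀ c ∈ B, ∀ m : ℤ, c + m * n ≤ z ∨ y ≤ c + m * n := by
  have h1 : [-y, -z] <:+: closeUp n 1 (B.map (- ·)) := by
    rw [closeUp_map_neg]
    exact pair_infix_map_neg h
  obtain ⟨h2, h3⟩ := (isDecreasingWord_iff.1 hB).not_between h1
  refine ⟨by linarith, fun c hc m => ?_⟩
  have := h3 (-c) (by simpa) (-m)
  rcases this with h | h
  · right; linarith
  · left; linarith

/-! ### Cycles given by words -/

lemma IsCycleWord.exists_of_ne {n : ℕ} {L : List ℤ} {h : ℤ} {u : Perm ℤ}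
    (hu : IsCycleWord n L h u) {x : ℤ} (hx : u x ≠ x) : ∃ a ∈ L, ∃ m : ℤ, x = a + m * n := by
  by_contra hc
  push Not at hc
  exact hx (hu.2.2.2 x fun a ha => not_dvd_sub_iff.2 (hc a ha))

lemma IsCycleWord.exists_apply {n : ℕ} {L : List ℤ} {h : ℤ} {u : Perm ℤ}
    (hu : IsCycleWord n L h u) {a : ℤ} (ha : a ∈ L) :
    ∃ z, [a, z] <:+: closeUp n h L ∧ ∀ m : ℤ, u (a + m * n) = z + m * n := by
  obtain ⟨z, hz⟩ := exists_pair_infix (n := n) (h := h) ha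
  exact ⟨z, hz, hu.2.2.1 a z hz⟩

lemma IsCycleWord.isPeriodic {n : ℕ} {L : List ℤ} {h : ℤ} {u : Perm ℤ}
    (hu : IsCycleWord n L h u) : IsPeriodic n u := fun x => by
  by_cases hx : ∃ a ∈ L, ∃ m : ℤ, x = a + m * n
  · obtain ⟨a, ha, m, rfl⟩ := hx
    obtain ⟨z, -, hz⟩ := hu.exists_apply ha
    rw [hz, show a + m * n + n = a + (m + 1) * n by ring, hz]
    ring
  · have h1 : ∀ x, (¬ ∃ a ∈ L, ∃ m : ℤ, x = a + m * n) → u x = x := fun x hx => by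
      by_contra hc
      exact hx (hu.exists_of_ne hc)
    rw [h1 x hx, h1 (x + n)]
    rintro ⟨a, ha, m, hm⟩
    exact hx ⟨a, ha, m - 1, by linear_combination hm⟩

/-- The translate by `m n` of the set of letters of a word. -/
def letters (n : ℕ) (L : List ℤ) (m : ℤ) : Set ℤ := {y | ∃ c ∈ L, y = c + m * n}

lemma finite_letters (n : ℕ) (L : List ℤ) (m : ℤ) : (letters n L m).Finite := by
  refine (L.toFinset.finite_toSet.image (fun c => c + m * n)).subset ?_
  rintro y ⟨c, hc, rfl⟩
  exact ⟨c, by simpa using hc, rfl⟩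

lemma sameCycle_eq_of_fixed {u : Perm ℤ} {x y : ℤ} (hx : u x = x) (h : u.SameCycle x y) : y = x :=
  (h.eq_of_left hx).symm

lemma sameCycle_ne {u : Perm ℤ} {x y : ℤ} (hx : u x ≠ x) (h : u.SameCycle x y) : u y ≠ y :=
  fun hy => hx (by rw [sameCycle_eq_of_fixed hy h.symm, hy])

lemma rel_of_sameCycle_iff {S : Set ℤ} {u : Perm ℤ} (hS : ∀ x, x ∈ S ↔ u x ∈ S) {x y : ℤ}
    (hx : x ∈ S) (h : u.SameCycle x y) : y ∈ S := by
  have := rel_of_sameCycle (p := Setoid.ker (· ∈ S)) (fun x => propext (hS x)) h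
  exact (iff_of_eq this).1 hx

/-- This explains the shape of finite cycles: the word `a₁, …, a_k, α₁, …, α_l` lists its letters in
boundary order, so the cycle is a cyclic successor map. -/
lemma IsIncreasingWord.sorted_append {n : ℕ} {X : Set ℤ} {A B : List ℤ}
    (hA : IsIncreasingWord n X A) (hB : IsDecreasingWord n Xᶜ B) :
    (A ++ B).Pairwise fun x y => pos X x < pos X y := by
  refine List.pairwise_append.2 ⟨?_, ?_, fun a ha b hb => ?_⟩
  · exact hA.sorted.imp_of_mem fun ha hb h => pos_lt_pos.2 (Or.inl ⟨hA.1 _ ha, hA.1 _ hb, h⟩)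
  · exact hB.sorted.imp_of_mem fun ha hb h =>
      pos_lt_pos.2 (Or.inr (Or.inr ⟨hB.1 _ ha, hB.1 _ hb, h⟩))
  · exact pos_lt_pos.2 (Or.inr (Or.inl ⟨hA.1 _ ha, hB.1 _ hb⟩))

lemma IsFinCycle.apply_mem {n : ℕ} {X Ξ : Set ℤ} {A B : List ℤ} {u : Perm ℤ}
    (hu : IsFinCycle n X Ξ A B u) {m x : ℤ} (hx : x ∈ letters n (A ++ B) m) :
    u x ∈ letters n (A ++ B) m := by
  obtain ⟨a, ha, rfl⟩ := hx
  obtain ⟨z, hz, hz'⟩ := hu.2.2.exists_apply ha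
  refine ⟨z, ?_, hz' m⟩
  rcases mem_of_pair_infix_closeUp_right hz with h | ⟨b, hb, rfl⟩
  · exact h
  · simpa using hb

lemma IsFinCycle.succ {n : ℕ} {X : Set ℤ} (hX : ∀ z : ℤ, z + n ∈ X ↔ z ∈ X) {A B : List ℤ}
    {u : Perm ℤ} (hu : IsFinCycle n X Xᶜ A B u) {m x z : ℤ} (hx : x ∈ letters n (A ++ B) m)
    (hz : z ∈ letters n (A ++ B) m) :
    (pos X x < pos X (u x) ∧ (pos X z ≤ pos X x ∨ pos X (u x) ≤ pos X z)) ∨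
      (pos X (u x) ≤ pos X z ∧ pos X z ≤ pos X x) := by
  obtain ⟨a, ha, rfl⟩ := hx
  obtain ⟨c, hc, rfl⟩ := hz
  obtain ⟨z, hz, hz'⟩ := hu.2.2.exists_apply ha
  rw [hz']
  simp only [pos_add_mul_lt hX, pos_add_mul_le hX]
  exact succ_of_pair_infix (hu.1.sorted_append hu.2.1) hz hc

/-- The finite set of letters is mapped injectively, hence bijectively, to itself, so the orbit
stays inside it; the successor property shows that the orbit fills it. -/
lemma IsFinCycle.orbitOf_eq {n : ℕ} {X : Set ℤ} (hX : ∀ z : ℤ, z + n ∈ X ↔ z ∈ X)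
    {A B : List ℤ} {u : Perm ℤ} (hu : IsFinCycle n X Xᶜ A B u) {m x : ℤ}
    (hx : x ∈ letters n (A ++ B) m) : orbitOf u x = letters n (A ++ B) m := by
  have hf := finite_letters n (A ++ B) m
  have hmaps : Set.MapsTo u (letters n (A ++ B) m) (letters n (A ++ B) m) :=
    fun x hx => hu.apply_mem hx
  have hbij := (hf.injOn_iff_bijOn_of_mapsTo hmaps).1 u.injective.injOn
  ext y
  constructor
  · refine rel_of_sameCycle_iff (fun z => ⟨fun hz => hmaps hz, fun hz => ?_⟩) hx
    obtain ⟨z', hz', he⟩ := hbij.surjOn hz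
    rwa [← u.injective he]
  · exact fun hy => sameCycle_of_succ hf hmaps (fun x hx z hz => hu.succ hX hx hz) hx hy

lemma IsFinCycle.exists_orbitOf_eq {n : ℕ} {X : Set ℤ} (hX : ∀ z : ℤ, z + n ∈ X ↔ z ∈ X)
    {A B : List ℤ} {u : Perm ℤ} (hu : IsFinCycle n X Xᶜ A B u) {x : ℤ} (hx : u x ≠ x) :
    ∃ m, orbitOf u x = letters n (A ++ B) m ∧ x ∈ letters n (A ++ B) m := by
  obtain ⟨a, ha, m, rfl⟩ := hu.2.2.exists_of_ne hx
  exact ⟨m, hu.orbitOf_eq hX ⟨a, ha, rfl⟩, a, ha, rfl⟩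

lemma orbitOf_eq_singleton {u : Perm ℤ} {x : ℤ} (hx : u x = x) : orbitOf u x = {x} := by
  ext y
  exact ⟨fun h => sameCycle_eq_of_fixed hx h, fun h => by
    rw [Set.mem_singleton_iff.1 h]; exact Perm.SameCycle.refl u x⟩

lemma IsFinCycle.finite_orbitOf {n : ℕ} {X : Set ℤ} (hX : ∀ z : ℤ, z + n ∈ X ↔ z ∈ X)
    {A B : List ℤ} {u : Perm ℤ} (hu : IsFinCycle n X Xᶜ A B u) (x : ℤ) :
    (orbitOf u x).Finite := by
  by_cases hx : u x = x
  · rw [orbitOf_eq_singleton hx]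
    exact Set.finite_singleton x
  · obtain ⟨m, hm, -⟩ := hu.exists_orbitOf_eq hX hx
    rw [hm]
    exact finite_letters _ _ _

/-- The common features of the infinite cycles `(a₁, …, a_k)_{[1]}` and `(α₁, …, α_l)_{[-1]}`. -/
structure IsInfCycle (X : Set ℤ) (u : Perm ℤ) : Prop where
  lt : ∀ x, u x ≠ x → pos X x < pos X (u x)
  next : ∀ x z, u x ≠ x → u z ≠ z → pos X z ≤ pos X x ∨ pos X (u x) ≤ pos X z
  exists_ne : ∃ x, u x ≠ x

lemma IsInfCycle.infinite_orbitOf {X : Set ℤ} {u : Perm ℤ} (hu : IsInfCycle X u) {x : ℤ}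
    (hx : u x ≠ x) : (orbitOf u x).Infinite := by
  refine Set.infinite_of_injective_forall_mem (f := fun k : ℕ => (u ^ k) x) ?_
    (fun k => ⟨k, by simp⟩)
  have : StrictMono fun k : ℕ => pos X ((u ^ k) x) := strictMono_nat_of_lt_succ fun k => by
    rw [pow_succ', Perm.mul_apply]
    exact hu.lt _ (sameCycle_ne hx ⟨(k : ℤ), by rw [zpow_natCast]⟩)
  exact fun i j hij => this.injective (congrArg (pos X) hij)

lemma IsInfCycleX.exists_apply {n : ℕ} {X : Set ℤ} {A : List ℤ} {u : Perm ℤ}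
    (hu : IsInfCycleX n X A u) {a : ℤ} (ha : a ∈ A) : ∃ z, a < z ∧
      (∀ c ∈ A, ∀ m : ℤ, c + m * n ≤ a ∨ z ≤ c + m * n) ∧ ∀ m : ℤ, u (a + m * n) = z + m * n := by
  obtain ⟨z, hz, hz'⟩ := hu.2.exists_apply ha
  obtain ⟨h1, h2⟩ := hu.1.not_between hz
  exact ⟨z, h1, h2, hz'⟩

lemma IsInfCycleXi.exists_apply {n : ℕ} {Ξ : Set ℤ} {B : List ℤ} {u : Perm ℤ}
    (hu : IsInfCycleXi n Ξ B u) {a : ℤ} (ha : a ∈ B) : ∃ z, z < a ∧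
      (∀ c ∈ B, ∀ m : ℤ, c + m * n ≤ z ∨ a ≤ c + m * n) ∧ ∀ m : ℤ, u (a + m * n) = z + m * n := by
  obtain ⟨z, hz, hz'⟩ := hu.2.exists_apply ha
  obtain ⟨h1, h2⟩ := hu.1.not_between hz
  exact ⟨z, h1, h2, hz'⟩

lemma IsInfCycleX.mem {n : ℕ} {X : Set ℤ} (hX : ∀ z : ℤ, z + n ∈ X ↔ z ∈ X) {A : List ℤ}
    {u : Perm ℤ} (hu : IsInfCycleX n X A u) {x : ℤ} (hx : u x ≠ x) : x ∈ X := by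
  obtain ⟨a, ha, m, rfl⟩ := hu.2.exists_of_ne hx
  exact (add_mul_mem_iff hX _ _).2 (hu.1.1 a ha)

lemma IsInfCycleXi.mem {n : ℕ} {Ξ : Set ℤ} (hΞ : ∀ z : ℤ, z + n ∈ Ξ ↔ z ∈ Ξ) {B : List ℤ}
    {u : Perm ℤ} (hu : IsInfCycleXi n Ξ B u) {x : ℤ} (hx : u x ≠ x) : x ∈ Ξ := by
  obtain ⟨a, ha, m, rfl⟩ := hu.2.exists_of_ne hx
  exact (add_mul_mem_iff hΞ _ _).2 (hu.1.1 a ha)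

lemma IsInfCycleX.lt {n : ℕ} {X : Set ℤ} {A : List ℤ} {u : Perm ℤ} (hu : IsInfCycleX n X A u)
    {x : ℤ} (hx : u x ≠ x) : x < u x := by
  obtain ⟨a, ha, m, rfl⟩ := hu.2.exists_of_ne hx
  obtain ⟨z, h1, -, h3⟩ := hu.exists_apply ha
  rw [h3]; linarith

lemma IsInfCycleXi.lt {n : ℕ} {Ξ : Set ℤ} {B : List ℤ} {u : Perm ℤ} (hu : IsInfCycleXi n Ξ B u)
    {x : ℤ} (hx : u x ≠ x) : u x < x := by
  obtain ⟨a, ha, m, rfl⟩ := hu.2.exists_of_ne hx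
  obtain ⟨z, h1, -, h3⟩ := hu.exists_apply ha
  rw [h3]; linarith

lemma IsInfCycleX.isInfCycle {n : ℕ} {X : Set ℤ} (hX : ∀ z : ℤ, z + n ∈ X ↔ z ∈ X) {A : List ℤ}
    {u : Perm ℤ} (hu : IsInfCycleX n X A u) : IsInfCycle X u where
  lt x hx := pos_lt_pos.2 (Or.inl ⟨hu.mem hX hx, hu.mem hX fun h => hx (u.injective h), hu.lt hx⟩)
  next x z hx hz := by
    have hxX := hu.mem hX hx
    have hzX := hu.mem hX hz
    have huX : u x ∈ X := hu.mem hX fun h => hx (u.injective h)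
    simp only [pos_le_pos, hxX, hzX, huX, true_and, not_true, false_and, or_false, and_false]
    obtain ⟨a, ha, m, rfl⟩ := hu.2.exists_of_ne hx
    obtain ⟨c, hc, j, rfl⟩ := hu.2.exists_of_ne hz
    obtain ⟨y, -, h2, h3⟩ := hu.exists_apply ha
    rw [h3]
    rcases h2 c hc (j - m) with h | h
    · left; linarith
    · right; linarith
  exists_ne := by
    obtain ⟨a, ha⟩ := List.exists_mem_of_ne_nil _ hu.2.1
    obtain ⟨z, h1, -, h3⟩ := hu.exists_apply ha
    refine ⟨a, ?_⟩
    have := h3 0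
    simp only [zero_mul, add_zero] at this
    rw [this]
    exact h1.ne'

lemma IsInfCycleXi.isInfCycle {n : ℕ} {X : Set ℤ} (hX : ∀ z : ℤ, z + n ∈ X ↔ z ∈ X) {B : List ℤ}
    {u : Perm ℤ} (hu : IsInfCycleXi n Xᶜ B u) : IsInfCycle X u where
  lt x hx := pos_lt_pos.2 (Or.inr (Or.inr ⟨hu.mem (fun z => not_congr (hX z)) hx,
    hu.mem (fun z => not_congr (hX z)) fun h => hx (u.injective h), hu.lt hx⟩))
  next x z hx hz := by
    have hxX : x ∉ X := hu.mem (fun z => not_congr (hX z)) hx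
    have hzX : z ∉ X := hu.mem (fun z => not_congr (hX z)) hz
    have huX : u x ∉ X := hu.mem (fun z => not_congr (hX z)) fun h => hx (u.injective h)
    simp only [pos_le_pos, hxX, hzX, huX, not_false_iff, true_and, false_and, false_or]
    obtain ⟨a, ha, m, rfl⟩ := hu.2.exists_of_ne hx
    obtain ⟨c, hc, j, rfl⟩ := hu.2.exists_of_ne hz
    obtain ⟨y, -, h2, h3⟩ := hu.exists_apply ha
    rw [h3]
    rcases h2 c hc (j - m) with h | h
    · right; linarith
    · left; linarith
  exists_ne := by
    obtain ⟨a, ha⟩ := List.exists_mem_of_ne_nil _ hu.2.1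
    obtain ⟨z, h1, -, h3⟩ := hu.exists_apply ha
    refine ⟨a, ?_⟩
    have := h3 0
    simp only [zero_mul, add_zero] at this
    rw [this]
    exact h1.ne

lemma IsInfCycle.not_finite {X : Set ℤ} {u : Perm ℤ} (hu : IsInfCycle X u)
    (h : ∀ x, (orbitOf u x).Finite) : False := by
  obtain ⟨x, hx⟩ := hu.exists_ne
  exact hu.infinite_orbitOf hx (h x)

/-! ### Non-crossing cycles -/

/-- No point of `S` separates points of `T` in the boundary order. -/
def NotSeparating (X S T : Set ℤ) : Prop :=
  ∀ x ∈ S, ∀ y ∈ T, ∀ y' ∈ T, pos X x < pos X y → pos X x < pos X y'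

/-- It is enough that one of the two sets lies in a single gap of the other; which one does not
matter. -/
lemma NotSeparating.nc {X S T : Set ℤ} (h : NotSeparating X S T ∨ NotSeparating X T S)
    (hd : Disjoint S T) {x x' y y' : ℤ} (hx : x ∈ S) (hx' : x' ∈ S) (hy : y ∈ T) (hy' : y' ∈ T)
    (h1 : pos X x < pos X y) (h2 : pos X y < pos X x') :
    pos X x < pos X y' ∧ pos X y' < pos X x' := by
  rcases h with h | h
  · refine ⟨h x hx y hy y' hy' h1, ?_⟩
    by_contra hc
    have hne : pos X x' ≠ pos X y' := fun he =>
      Set.disjoint_left.1 hd hx' (pos_injective X he ▸ hy')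
    exact lt_asymm h2 (h x' hx' y' hy' y hy (lt_of_le_of_ne (not_lt.1 hc) hne))
  · exact absurd (h y hy x' hx' x hx h2) (lt_asymm h1)

/-- The orbits of `u` and `v` do not cross. -/
def OrbitsNonCrossing (X : Set ℤ) (u v : Perm ℤ) : Prop :=
  ∀ x y, u x ≠ x → v y ≠ y → NotSeparating X (orbitOf u x) (orbitOf v y) ∨
    NotSeparating X (orbitOf v y) (orbitOf u x)

lemma OrbitsNonCrossing.symm {X : Set ℤ} {u v : Perm ℤ} (h : OrbitsNonCrossing X u v) :
    OrbitsNonCrossing X v u := fun x y hx hy => (h y x hy hx).symm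

lemma notSeparating_letters {n : ℕ} {X : Set ℤ} (hX : ∀ z : ℤ, z + n ∈ X ↔ z ∈ X)
    {L L' : List ℤ} {i j : ℤ} (h : ∀ c ∈ L, ∀ d ∈ L', ∀ d' ∈ L',
      pos X c < pos X (d + (j - i) * n) → pos X c < pos X (d' + (j - i) * n)) :
    NotSeparating X (letters n L i) (letters n L' j) := by
  rintro _ ⟨c, hc, rfl⟩ _ ⟨d, hd, rfl⟩ _ ⟨d', hd', rfl⟩
  rw [show d + j * n = (d + (j - i) * n) + i * n by ring,
    show d' + j * n = (d' + (j - i) * n) + i * n by ring, pos_add_mul_lt hX, pos_add_mul_lt hX]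
  exact h c hc d hd d' hd'

lemma IsFinCycle.orbitsNonCrossing {n : ℕ} {X : Set ℤ} (hX : ∀ z : ℤ, z + n ∈ X ↔ z ∈ X)
    {A B A' B' : List ℤ} {u v : Perm ℤ} (hu : IsFinCycle n X Xᶜ A B u)
    (hv : IsFinCycle n X Xᶜ A' B' v)
    (h : ∀ i j : ℤ, NotSeparating X (letters n (A ++ B) i) (letters n (A' ++ B') j) ∨
      NotSeparating X (letters n (A' ++ B') j) (letters n (A ++ B) i)) :
    OrbitsNonCrossing X u v := by
  intro x y hx hy
  obtain ⟨i, hi, -⟩ := hu.exists_orbitOf_eq hX hx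
  obtain ⟨j, hj, -⟩ := hv.exists_orbitOf_eq hX hy
  rw [hi, hj]
  exact h i j

/-- Distinct orbits of a finite cycle do not cross. -/
lemma IsFinCycle.orbit_orbit {n : ℕ} (hn : 0 < n) {X : Set ℤ} (hX : ∀ z : ℤ, z + n ∈ X ↔ z ∈ X)
    {A B : List ℤ} {u : Perm ℤ} (hu : IsFinCycle n X Xᶜ A B u) {x y : ℤ} (hx : u x ≠ x)
    (hy : u y ≠ y) (hxy : ¬ u.SameCycle x y) :
    NotSeparating X (orbitOf u x) (orbitOf u y) ∨ NotSeparating X (orbitOf u y) (orbitOf u x) := by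
  have hn' : (0 : ℤ) < n := by exact_mod_cast hn
  obtain ⟨i, hi, hi'⟩ := hu.exists_orbitOf_eq hX hx
  obtain ⟨j, hj, hj'⟩ := hu.exists_orbitOf_eq hX hy
  have hij : i ≠ j := fun h => hxy (by
    have : y ∈ orbitOf u x := by rw [hi, h]; exact hj'
    exact this)
  rw [hi, hj]
  -- Letters span less than a period. So the letters of the `i`-th translate in `X` precede the
  -- whole `j`-th translate, and those in the complement follow it.
  have key : ∀ i j : ℤ, i < j →
      NotSeparating X (letters n (A ++ B) i) (letters n (A ++ B) j) := by
    intro i j hij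
    refine notSeparating_letters hX fun c hc d hd d' hd' h => ?_
    have h1 : (n : ℤ) ≤ (j - i) * n := by nlinarith
    simp only [pos_lt_pos, add_mul_mem_iff hX] at h ⊢
    rcases List.mem_append.1 hc with hc | hc
    · have hcX := hu.1.1 c hc
      rcases List.mem_append.1 hd' with hd' | hd'
      · exact Or.inl ⟨hcX, hu.1.1 _ hd', by linarith [hu.1.bounds hc hd']⟩
      · exact Or.inr (Or.inl ⟨hcX, hu.2.1.1 _ hd'⟩)
    · have hcX : c ∉ X := hu.2.1.1 c hc
      rcases h with h | h | h
      · exact absurd h.1 hcX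
      · exact absurd h.1 hcX
      · rcases List.mem_append.1 hd with hd | hd
        · exact absurd (hu.1.1 d hd) h.2.1
        · linarith [hu.2.1.bounds hc hd, h.2.2]
  rcases lt_or_gt_of_ne hij with h | h
  · exact Or.inl (key _ _ h)
  · exact Or.inr (key _ _ h)

lemma notSeparating_of_mem_notMem {X S T : Set ℤ} (hS : ∀ x ∈ S, x ∈ X) (hT : ∀ x ∈ T, x ∉ X) :
    NotSeparating X S T := fun x hx _ _ y' hy' _ =>
  pos_lt_pos.2 (Or.inr (Or.inl ⟨hS x hx, hT y' hy'⟩))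

lemma letters_subset {n : ℕ} {X : Set ℤ} (hX : ∀ z : ℤ, z + n ∈ X ↔ z ∈ X) {L : List ℤ}
    (hL : ∀ a ∈ L, a ∈ X) (m : ℤ) : ∀ x ∈ letters n L m, x ∈ X := by
  rintro _ ⟨c, hc, rfl⟩
  exact (add_mul_mem_iff hX _ _).2 (hL c hc)

/-- A point of the cycle does not separate a word lying in a gap. -/
lemma InGapX.notSeparating {n : ℕ} {X : Set ℤ} (hX : ∀ z : ℤ, z + n ∈ X ↔ z ∈ X)
    {A A' : List ℤ} (hA : IsIncreasingWord n X A) (hA' : ∀ a ∈ A', a ∈ X) (h : InGapX n A A')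
    {c : ℤ} (hc : c ∈ A) (i j : ℤ) : NotSeparating X {c + i * n} (letters n A' j) := by
  rcases h with rfl | ⟨y, z, hyz, h⟩
  · simp at hc
  have hnb := (hA.not_between hyz).2 c hc (i - j)
  rintro _ rfl _ ⟨d, hd, rfl⟩ _ ⟨d', hd', rfl⟩ hlt
  have hcX := hA.1 c hc
  have hdX := hA' d hd
  have hdX' := hA' d' hd'
  simp only [pos_lt_pos, add_mul_mem_iff hX, hcX, hdX, hdX', true_and, not_true, false_and,
    or_false] at hlt ⊢
  have h1 := h d hd
  have h2 := h d' hd'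
  rcases hnb with h3 | h3 <;> linarith

lemma InGapXi.notSeparating {n : ℕ} {X : Set ℤ} (hX : ∀ z : ℤ, z + n ∈ X ↔ z ∈ X)
    {B B' : List ℤ} (hB : IsDecreasingWord n Xᶜ B) (hB' : ∀ b ∈ B', b ∈ Xᶜ) (h : InGapXi n B B')
    {c : ℤ} (hc : c ∈ B) (i j : ℤ) : NotSeparating X {c + i * n} (letters n B' j) := by
  rcases h with rfl | ⟨y, z, hyz, h⟩
  · simp at hc
  have hnb := (hB.not_between hyz).2 c hc (i - j)
  rintro _ rfl _ ⟨d, hd, rfl⟩ _ ⟨d', hd', rfl⟩ hlt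
  have hcX : c ∉ X := hB.1 c hc
  have hdX : d ∉ X := hB' d hd
  have hdX' : d' ∉ X := hB' d' hd'
  simp only [pos_lt_pos, add_mul_mem_iff hX, hcX, hdX, hdX', true_and, not_false_iff, false_and,
    false_or] at hlt ⊢
  have h1 := h d hd
  have h2 := h d' hd'
  rcases hnb with h3 | h3 <;> linarith

lemma notSeparating_letters_append {n : ℕ} {X T : Set ℤ} {A B : List ℤ} {i : ℤ}
    (hA : ∀ c ∈ A, NotSeparating X {c + i * n} T) (hB : ∀ c ∈ B, NotSeparating X {c + i * n} T) :
    NotSeparating X (letters n (A ++ B) i) T := by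
  rintro _ ⟨c, hc, rfl⟩
  rcases List.mem_append.1 hc with hc | hc
  · exact hA c hc _ rfl
  · exact hB c hc _ rfl

lemma notSeparating_of_notMem_mem {X S T : Set ℤ} (hS : ∀ x ∈ S, x ∉ X) (hT : ∀ x ∈ T, x ∈ X) :
    NotSeparating X S T := fun x hx y hy _ _ h => by
  rcases pos_lt_pos.1 h with h | h | h
  · exact absurd h.1 (hS x hx)
  · exact absurd h.1 (hS x hx)
  · exact absurd (hT y hy) h.2.1

/-- Two finite cycles both meeting `X` and its complement. -/
lemma notSeparating_of_lt {n : ℕ} {X : Set ℤ} (hX : ∀ z : ℤ, z + n ∈ X ↔ z ∈ X)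
    {A B A' B' : List ℤ} (hA : ∀ a ∈ A, a ∈ X) (hB : ∀ b ∈ B, b ∈ Xᶜ) (hA' : ∀ a ∈ A', a ∈ X)
    (hB' : ∀ b ∈ B', b ∈ Xᶜ) (h : ∀ a ∈ A, ∀ b ∈ A', a < b ∧ b < a + n)
    (h' : ∀ α ∈ B, ∀ β ∈ B', α < β ∧ β < α + n) (i j : ℤ) :
    NotSeparating X (letters n (A ++ B) i) (letters n (A' ++ B') j) ∨
      NotSeparating X (letters n (A' ++ B') j) (letters n (A ++ B) i) := by
  have hn : (0 : ℤ) ≤ n := by positivity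
  rcases le_or_gt i j with hij | hij
  · left
    have h1 : 0 ≤ (j - i) * (n : ℤ) := by nlinarith
    refine notSeparating_letters hX fun c hc d hd d' hd' hlt => ?_
    simp only [pos_lt_pos, add_mul_mem_iff hX] at hlt ⊢
    rcases List.mem_append.1 hc with hc | hc
    · rcases List.mem_append.1 hd' with hd' | hd'
      · exact Or.inl ⟨hA c hc, hA' d' hd', by linarith [(h c hc d' hd').1]⟩
      · exact Or.inr (Or.inl ⟨hA c hc, hB' d' hd'⟩)
    · have hcX : c ∉ X := hB c hc
      rcases hlt with h2 | h2 | h2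
      · exact absurd h2.1 hcX
      · exact absurd h2.1 hcX
      · rcases List.mem_append.1 hd with hd | hd
        · exact absurd (hA' d hd) h2.2.1
        · linarith [(h' c hc d hd).1, h2.2.2]
  · right
    have h1 : (n : ℤ) ≤ (i - j) * (n : ℤ) := by nlinarith
    refine notSeparating_letters hX fun c hc d hd d' hd' hlt => ?_
    simp only [pos_lt_pos, add_mul_mem_iff hX] at hlt ⊢
    rcases List.mem_append.1 hc with hc | hc
    · rcases List.mem_append.1 hd' with hd' | hd'
      · exact Or.inl ⟨hA' c hc, hA d' hd', by linarith [(h d' hd' c hc).2]⟩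
      · exact Or.inr (Or.inl ⟨hA' c hc, hB d' hd'⟩)
    · have hcX : c ∉ X := hB' c hc
      rcases hlt with h2 | h2 | h2
      · exact absurd h2.1 hcX
      · exact absurd h2.1 hcX
      · rcases List.mem_append.1 hd with hd | hd
        · exact absurd (hA d hd) h2.2.1
        · linarith [(h' d hd c hc).2, h2.2.2]

/-- Finiteness of the orbits rules out the infinite shapes. In each remaining case one translated
word lies in a gap of the other. -/
lemma NonCrossingOrdered.orbitsNonCrossing {n : ℕ} {X : Set ℤ}
    (hX : ∀ z : ℤ, z + n ∈ X ↔ z ∈ X) {u v : Perm ℤ} (h : NonCrossingOrdered n X Xᶜ u v)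
    (hu : ∀ x, (orbitOf u x).Finite) (hv : ∀ x, (orbitOf v x).Finite) :
    OrbitsNonCrossing X u v := by
  rcases h with ⟨⟨A, h1⟩ | ⟨A, h1⟩, ⟨B, h2⟩ | ⟨B, h2⟩⟩ |
    ⟨A, B, A', B', -, -, -, -, h1, h2, h3, h4⟩ | ⟨A, B, h1, ⟨A', h2, h3⟩ | ⟨B', h2, h3⟩⟩ |
    ⟨A, A', h1, -⟩ | ⟨B, B', h1, -⟩
  · refine h1.orbitsNonCrossing hX h2 fun i j => Or.inl (notSeparating_of_mem_notMem ?_ ?_)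
    · exact letters_subset hX (by simpa using h1.1.1) i
    · exact letters_subset (X := Xᶜ) (fun z => not_congr (hX z)) (by simpa using h2.2.1.1) j
  · exact ((h2.isInfCycle hX).not_finite hv).elim
  · exact ((h1.isInfCycle hX).not_finite hu).elim
  · exact ((h1.isInfCycle hX).not_finite hu).elim
  · exact h1.orbitsNonCrossing hX h2
      (notSeparating_of_lt hX h1.1.1 h1.2.1.1 h2.1.1 h2.2.1.1 h3 h4)
  · refine h1.orbitsNonCrossing hX h2 fun i j => Or.inl (notSeparating_letters_append ?_ ?_)
    · intro c hc
      rw [List.append_nil]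
      exact h3.notSeparating hX h1.1 h2.1.1 hc i j
    · intro c hc
      refine notSeparating_of_notMem_mem ?_ (letters_subset hX (by simpa using h2.1.1) j)
      rintro _ rfl hm
      exact h1.2.1.1 c hc ((add_mul_mem_iff hX _ _).1 hm)
  · refine h1.orbitsNonCrossing hX h2 fun i j => Or.inl (notSeparating_letters_append ?_ ?_)
    · intro c hc
      refine notSeparating_of_mem_notMem ?_
        (letters_subset (X := Xᶜ) (fun z => not_congr (hX z)) (by simpa using h2.2.1.1) j)
      rintro _ rfl
      exact (add_mul_mem_iff hX _ _).2 (h1.1.1 c hc)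
    · intro c hc
      exact h3.notSeparating hX h1.2.1 h2.2.1.1 hc i j
  · exact ((h1.isInfCycle hX).not_finite hu).elim
  · exact ((h1.isInfCycle hX).not_finite hu).elim

lemma NonCrossingCycles.orbitsNonCrossing {n : ℕ} {X : Set ℤ}
    (hX : ∀ z : ℤ, z + n ∈ X ↔ z ∈ X) {u v : Perm ℤ} (h : NonCrossingCycles n X Xᶜ u v)
    (hu : ∀ x, (orbitOf u x).Finite) (hv : ∀ x, (orbitOf v x).Finite) :
    OrbitsNonCrossing X u v := by
  rcases h with h | h
  · exact h.orbitsNonCrossing hX hu hv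
  · exact (h.orbitsNonCrossing hX hv hu).symm

lemma IsInfCycleX.not_isInfCycleXi {n : ℕ} {X : Set ℤ} (hX : ∀ z : ℤ, z + n ∈ X ↔ z ∈ X)
    {A B : List ℤ} {u : Perm ℤ} (h : IsInfCycleX n X A u) (h' : IsInfCycleXi n Xᶜ B u) : False := by
  obtain ⟨x, hx⟩ := (h.isInfCycle hX).exists_ne
  exact h'.mem (fun z => not_congr (hX z)) hx (h.mem hX hx)

lemma IsInfCycle.not_isFinCycle {n : ℕ} {X : Set ℤ} (hX : ∀ z : ℤ, z + n ∈ X ↔ z ∈ X)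
    {A B : List ℤ} {u : Perm ℤ} (h : IsInfCycle X u) (h' : IsFinCycle n X Xᶜ A B u) : False :=
  h.not_finite (h'.finite_orbitOf hX)

/-- The points moved by an infinite cycle do not separate the orbits of a finite one. -/
lemma NonCrossingCycles.notSeparating_of_infX {n : ℕ} {X : Set ℤ}
    (hX : ∀ z : ℤ, z + n ∈ X ↔ z ∈ X) {u v : Perm ℤ} {A₀ : List ℤ} (hu : IsInfCycleX n X A₀ u)
    (hv : ∀ x, (orbitOf v x).Finite) (h : NonCrossingCycles n X Xᶜ u v) {x y : ℤ} (hx : u x ≠ x)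
    (hy : v y ≠ y) : NotSeparating X {x} (orbitOf v y) := by
  have hui := hu.isInfCycle hX
  have hxX := hu.mem hX hx
  rcases h with (⟨-, ⟨B, h2⟩ | ⟨B, h2⟩⟩ | ⟨A, B, A', B', -, -, -, -, h1, -⟩ | ⟨A, B, h1, -⟩ |
    ⟨A, A', h1, h2, h3⟩ | ⟨B, B', h1, -⟩) |
    (⟨-, ⟨B, h2⟩ | ⟨B, h2⟩⟩ | ⟨A, B, A', B', -, -, -, -, -, h1, -⟩ |
      ⟨A, B, -, ⟨A', h2, -⟩ | ⟨B', h2, -⟩⟩ | ⟨A, A', h1, -⟩ | ⟨B, B', h1, -⟩)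
  · obtain ⟨j, hj, -⟩ := h2.exists_orbitOf_eq hX hy
    rw [hj]
    refine notSeparating_of_mem_notMem (by simpa) ?_
    exact letters_subset (X := Xᶜ) (fun z => not_congr (hX z)) (by simpa using h2.2.1.1) j
  · exact ((h2.isInfCycle hX).not_finite hv).elim
  · exact (hui.not_isFinCycle hX h1).elim
  · exact (hui.not_isFinCycle hX h1).elim
  · obtain ⟨j, hj, -⟩ := h2.exists_orbitOf_eq hX hy
    rw [hj, List.append_nil]
    obtain ⟨a, ha, m, rfl⟩ := h1.2.exists_of_ne hx
    exact h3.notSeparating hX h1.1 h2.1.1 ha m j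
  · exact (hu.not_isInfCycleXi hX h1).elim
  · exact (hui.not_isFinCycle hX h2).elim
  · exact (hu.not_isInfCycleXi hX h2).elim
  · exact (hui.not_isFinCycle hX h1).elim
  · exact (hui.not_isFinCycle hX h2).elim
  · exact (hui.not_isFinCycle hX h2).elim
  · exact ((h1.isInfCycle hX).not_finite hv).elim
  · exact ((h1.isInfCycle hX).not_finite hv).elim

lemma NonCrossingCycles.notSeparating_of_infXi {n : ℕ} {X : Set ℤ}
    (hX : ∀ z : ℤ, z + n ∈ X ↔ z ∈ X) {u v : Perm ℤ} {B₀ : List ℤ} (hu : IsInfCycleXi n Xᶜ B₀ u)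
    (hv : ∀ x, (orbitOf v x).Finite) (h : NonCrossingCycles n X Xᶜ u v) {x y : ℤ} (hx : u x ≠ x)
    (hy : v y ≠ y) : NotSeparating X {x} (orbitOf v y) := by
  have hui := hu.isInfCycle hX
  have hxX : x ∉ X := hu.mem (fun z => not_congr (hX z)) hx
  rcases h with (⟨⟨A, h1⟩ | ⟨A, h1⟩, -⟩ | ⟨A, B, A', B', -, -, -, -, h1, -⟩ | ⟨A, B, h1, -⟩ |
    ⟨A, A', h1, -⟩ | ⟨B, B', h1, h2, h3⟩) |
    (⟨⟨A, h1⟩ | ⟨A, h1⟩, -⟩ | ⟨A, B, A', B', -, -, -, -, -, h1, -⟩ |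
      ⟨A, B, -, ⟨A', h2, -⟩ | ⟨B', h2, -⟩⟩ | ⟨A, A', h1, -⟩ | ⟨B, B', h1, -⟩)
  · exact (hui.not_isFinCycle hX h1).elim
  · exact (h1.not_isInfCycleXi hX hu).elim
  · exact (hui.not_isFinCycle hX h1).elim
  · exact (hui.not_isFinCycle hX h1).elim
  · exact (h1.not_isInfCycleXi hX hu).elim
  · obtain ⟨j, hj, -⟩ := h2.exists_orbitOf_eq hX hy
    rw [hj, List.nil_append]
    obtain ⟨a, ha, m, rfl⟩ := h1.2.exists_of_ne hx
    exact h3.notSeparating hX h1.1 h2.2.1.1 ha m j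
  · obtain ⟨j, hj, -⟩ := h1.exists_orbitOf_eq hX hy
    rw [hj]
    exact notSeparating_of_notMem_mem (by simpa) (letters_subset hX (by simpa using h1.1.1) j)
  · exact ((h1.isInfCycle hX).not_finite hv).elim
  · exact (hui.not_isFinCycle hX h1).elim
  · exact (hui.not_isFinCycle hX h2).elim
  · exact (hui.not_isFinCycle hX h2).elim
  · exact ((h1.isInfCycle hX).not_finite hv).elim
  · exact ((h1.isInfCycle hX).not_finite hv).elim

/-- None of the four shapes allows two infinite cycles on the same side, so a non-crossing list has
no two distinct ones there. -/
lemma NonCrossingOrdered.not_infX_infX {n : ℕ} {X : Set ℤ} (hX : ∀ z : ℤ, z + n ∈ X ↔ z ∈ X)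
    {u v : Perm ℤ} {A A' : List ℤ} (hu : IsInfCycleX n X A u) (hv : IsInfCycleX n X A' v)
    (h : NonCrossingOrdered n X Xᶜ u v) : False := by
  have hui := hu.isInfCycle hX
  have hvi := hv.isInfCycle hX
  rcases h with ⟨-, ⟨B, h2⟩ | ⟨B, h2⟩⟩ | ⟨A, B, A', B', -, -, -, -, h1, -⟩ | ⟨A, B, h1, -⟩ |
    ⟨A, A', -, h2, -⟩ | ⟨B, B', h1, -⟩
  · exact hvi.not_isFinCycle hX h2
  · exact hv.not_isInfCycleXi hX h2
  · exact hui.not_isFinCycle hX h1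
  · exact hui.not_isFinCycle hX h1
  · exact hvi.not_isFinCycle hX h2
  · exact hu.not_isInfCycleXi hX h1

lemma NonCrossingOrdered.not_infXi_infXi {n : ℕ} {X : Set ℤ} (hX : ∀ z : ℤ, z + n ∈ X ↔ z ∈ X)
    {u v : Perm ℤ} {B B' : List ℤ} (hu : IsInfCycleXi n Xᶜ B u) (hv : IsInfCycleXi n Xᶜ B' v)
    (h : NonCrossingOrdered n X Xᶜ u v) : False := by
  have hui := hu.isInfCycle hX
  have hvi := hv.isInfCycle hX
  rcases h with ⟨⟨A, h1⟩ | ⟨A, h1⟩, -⟩ | ⟨A, B, A', B', -, -, -, -, h1, -⟩ | ⟨A, B, h1, -⟩ |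
    ⟨A, A', h1, -⟩ | ⟨B, B', -, h2, -⟩
  · exact hui.not_isFinCycle hX h1
  · exact h1.not_isInfCycleXi hX hu
  · exact hui.not_isFinCycle hX h1
  · exact hui.not_isFinCycle hX h1
  · exact h1.not_isInfCycleXi hX hu
  · exact hvi.not_isFinCycle hX h2

/-! ### Products of disjoint permutations -/

lemma prod_apply_of_forall_fixed {L : List (Perm ℤ)} {x : ℤ} (h : ∀ u ∈ L, u x = x) :
    L.prod x = x := by
  induction L with
  | nil => rfl
  | cons v L ih =>
    rw [List.prod_cons, Perm.mul_apply, ih fun u hu => h u (by simp [hu]), h v (by simp)]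

lemma prod_apply_of_mem {L : List (Perm ℤ)} (hL : L.Pairwise Perm.Disjoint) {u : Perm ℤ}
    (hu : u ∈ L) {x : ℤ} (hx : u x ≠ x) : L.prod x = u x := by
  induction L with
  | nil => simp at hu
  | cons v L ih =>
    rw [List.pairwise_cons] at hL
    rw [List.prod_cons, Perm.mul_apply]
    rcases List.mem_cons.1 hu with rfl | hu
    · rw [prod_apply_of_forall_fixed fun w hw => ((hL.1 w hw) x).resolve_left hx]
    · rw [ih hL.2 hu]
      exact ((hL.1 u hu) (u x)).resolve_right fun h => hx (u.injective h)

/-- The orbit of `x` under `u` consists of points moved by `u`, where the product agrees with `u`;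
hence all powers agree at `x`. -/
lemma orbitOf_prod_eq {L : List (Perm ℤ)} (hL : L.Pairwise Perm.Disjoint) {u : Perm ℤ}
    (hu : u ∈ L) {x : ℤ} (hx : u x ≠ x) : orbitOf L.prod x = orbitOf u x := by
  have key : ∀ k : ℤ, (L.prod ^ k) x = (u ^ k) x := by
    intro k
    induction k using Int.induction_on with
    | zero => simp
    | succ i ih =>
      rw [add_comm, zpow_one_add, zpow_one_add, Perm.mul_apply, Perm.mul_apply, ih]
      exact prod_apply_of_mem hL hu (sameCycle_ne hx ⟨_, rfl⟩)
    | pred i ih =>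
      rw [sub_eq_neg_add, zpow_add, zpow_add, Perm.mul_apply, Perm.mul_apply, ih, zpow_neg_one,
        zpow_neg_one, Perm.inv_eq_iff_eq]
      have h1 : u (u⁻¹ ((u ^ (-(i : ℤ))) x)) ≠ u⁻¹ ((u ^ (-(i : ℤ))) x) :=
        sameCycle_ne hx ⟨-1 + -i, by rw [zpow_add, zpow_neg_one, Perm.mul_apply]⟩
      rw [prod_apply_of_mem hL hu h1, perm_apply_inv]
  ext y
  constructor
  · rintro ⟨k, rfl⟩
    exact ⟨k, (key k).symm⟩
  · rintro ⟨k, rfl⟩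
    exact ⟨k, key k⟩

lemma isPeriodic_prod {n : ℕ} {L : List (Perm ℤ)} (h : ∀ u ∈ L, IsPeriodic n u) :
    IsPeriodic n L.prod := by
  induction L with
  | nil => exact IsPeriodic.one
  | cons v L ih =>
    rw [List.prod_cons]
    exact (h v (by simp)).mul (ih fun u hu => h u (by simp [hu]))

lemma totalShift_prod {n : ℕ} (hn : 0 < n) {L : List (Perm ℤ)} (h : ∀ u ∈ L, IsPeriodic n u) :
    totalShift n L.prod = (L.map (totalShift n)).sum := by
  induction L with
  | nil => simp [totalShift_one]
  | cons v L ih =>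
    have h' : ∀ u ∈ L, IsPeriodic n u := fun u hu => h u (by simp [hu])
    rw [List.prod_cons, totalShift_mul hn (h v (by simp)) (isPeriodic_prod h'), ih h',
      List.map_cons, List.sum_cons]

lemma IsPositiveCycle.isPeriodic {n : ℕ} {X Ξ : Set ℤ} {u : Perm ℤ}
    (hu : IsPositiveCycle n X Ξ u) : IsPeriodic n u := by
  rcases hu with ⟨A, B, h⟩ | ⟨A, h⟩ | ⟨B, h⟩
  · exact h.2.2.isPeriodic
  · exact h.2.isPeriodic
  · exact h.2.isPeriodic

lemma IsPeriodic.orbitPartition {n : ℕ} {w : Perm ℤ} (hw : IsPeriodic n w) :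
    IsPeriodicPartition n (orbitPartition w) := by
  have h1 : ∀ x y, w.SameCycle (x + n) (y + n) ↔ w.SameCycle x y := fun x y => by
    simp only [Perm.SameCycle]
    refine exists_congr fun k => ?_
    rw [hw.zpow k x, add_left_inj]
  have h2 : ∀ x, (orbitOf w (x + n)).Infinite ↔ (orbitOf w x).Infinite := fun x => by
    have : orbitOf w (x + n) = (fun y => y + (n : ℤ)) '' orbitOf w x := by
      ext y
      constructor
      · intro hy
        refine ⟨y - n, ?_, by ring⟩
        have hy : w.SameCycle (x + n) y := hy
        change w.SameCycle _ _
        rw [← h1]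
        simpa using hy
      · rintro ⟨y, hy, rfl⟩
        exact (h1 _ _).2 hy
    rw [this, Set.infinite_image_iff (fun a _ b _ h => by simpa using h)]
  intro x y
  change (_ ∨ _) ↔ (_ ∨ _)
  rw [h1, h2, h2]

/-! ### From products of cycles to partitions -/

/-- The disjointness and non-crossing hypotheses on a list of cycles. -/
def IsNonCrossingList (n : ℕ) (X : Set ℤ) (L : List (Perm ℤ)) : Prop :=
  (∀ u ∈ L, IsPositiveCycle n X Xᶜ u) ∧
    L.Pairwise (fun u v => Perm.Disjoint u v ∧ NonCrossingCycles n X Xᶜ u v)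

lemma IsNonCrossingList.nonCrossing {n : ℕ} {X : Set ℤ} {L : List (Perm ℤ)}
    (hL : IsNonCrossingList n X L) {u v : Perm ℤ} (hu : u ∈ L) (hv : v ∈ L) (huv : u ≠ v) :
    Perm.Disjoint u v ∧ NonCrossingCycles n X Xᶜ u v := by
  have : Std.Symm fun u v => Perm.Disjoint u v ∧ NonCrossingCycles n X Xᶜ u v :=
    ⟨fun _ _ h => ⟨h.1.symm, h.2.symm⟩⟩
  exact hL.2.forall hu hv huv

lemma IsNonCrossingList.disjoint {n : ℕ} {X : Set ℤ} {L : List (Perm ℤ)}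
    (hL : IsNonCrossingList n X L) : L.Pairwise Perm.Disjoint := hL.2.imp fun h => h.1

lemma orbitPartition_rel_of_finite {w : Perm ℤ} {x y : ℤ} (hx : (orbitOf w x).Finite)
    (h : orbitPartition w x y) : y ∈ orbitOf w x := by
  rcases h with h | h
  · exact h
  · exact absurd hx h.1

lemma orbitOf_infinite_of_rel {w : Perm ℤ} {x y : ℤ} (hx : (orbitOf w x).Infinite)
    (h : orbitPartition w x y) : (orbitOf w y).Infinite := by
  rcases h with h | h
  · have : orbitOf w y = orbitOf w x := Set.ext fun z => ⟨fun hz => h.trans hz,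
      fun hz => h.symm.trans hz⟩
    rwa [this]
  · exact h.2

lemma IsNonCrossingList.exists_mem {n : ℕ} {X : Set ℤ} {L : List (Perm ℤ)}
    (hL : IsNonCrossingList n X L) {x : ℤ} (hx : L.prod x ≠ x) :
    ∃ u ∈ L, u x ≠ x ∧ L.prod x = u x ∧ orbitOf L.prod x = orbitOf u x := by
  by_contra hc
  push Not at hc
  refine hx (prod_apply_of_forall_fixed fun u hu => ?_)
  by_contra hux
  exact hc u hu hux (prod_apply_of_mem hL.disjoint hu hux) (orbitOf_prod_eq hL.disjoint hu hux)

lemma IsPositiveCycle.isInfCycle {n : ℕ} {X : Set ℤ} (hX : ∀ z : ℤ, z + n ∈ X ↔ z ∈ X)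
    {u : Perm ℤ} (hu : IsPositiveCycle n X Xᶜ u) {x : ℤ} (hx : (orbitOf u x).Infinite) :
    (∃ A, IsInfCycleX n X A u) ∨ ∃ B, IsInfCycleXi n Xᶜ B u := by
  rcases hu with ⟨A, B, h⟩ | h | h
  · exact absurd (h.finite_orbitOf hX x) hx
  · exact Or.inl h
  · exact Or.inr h

lemma IsPositiveCycle.isFinCycle {n : ℕ} {X : Set ℤ} (hX : ∀ z : ℤ, z + n ∈ X ↔ z ∈ X)
    {u : Perm ℤ} (hu : IsPositiveCycle n X Xᶜ u) {x : ℤ} (hx : u x ≠ x)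
    (hf : (orbitOf u x).Finite) : ∃ A B, IsFinCycle n X Xᶜ A B u := by
  rcases hu with h | ⟨A, h⟩ | ⟨B, h⟩
  · exact h
  · exact absurd hf ((h.isInfCycle hX).infinite_orbitOf hx)
  · exact absurd hf ((h.isInfCycle hX).infinite_orbitOf hx)

lemma IsNonCrossingList.notSeparating_of_infinite {n : ℕ} {X : Set ℤ}
    (hX : ∀ z : ℤ, z + n ∈ X ↔ z ∈ X) {L : List (Perm ℤ)} (hL : IsNonCrossingList n X L) {x y : ℤ}
    (hx : (orbitOf L.prod x).Infinite) (hy : (orbitOf L.prod y).Finite) (hy' : L.prod y ≠ y) :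
    NotSeparating X {x} (orbitOf L.prod y) := by
  have hx' : L.prod x ≠ x := fun h => by
    rw [orbitOf_eq_singleton h] at hx
    exact hx (Set.finite_singleton x)
  obtain ⟨u, hu, hux, -, huo⟩ := hL.exists_mem hx'
  obtain ⟨v, hv, hvy, -, hvo⟩ := hL.exists_mem hy'
  rw [huo] at hx
  rw [hvo] at hy ⊢
  obtain ⟨A, B, hfin⟩ := (hL.1 v hv).isFinCycle hX hvy hy
  have hvf := hfin.finite_orbitOf hX
  have huv : u ≠ v := fun h => hx (by rw [h]; exact hvf x)
  have hnc := (hL.nonCrossing hu hv huv).2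
  rcases (hL.1 u hu).isInfCycle hX hx with ⟨A, h⟩ | ⟨B, h⟩
  · exact hnc.notSeparating_of_infX hX h hvf hux hvy
  · exact hnc.notSeparating_of_infXi hX h hvf hux hvy

lemma IsNonCrossingList.notSeparating_of_finite {n : ℕ} (hn : 0 < n) {X : Set ℤ}
    (hX : ∀ z : ℤ, z + n ∈ X ↔ z ∈ X) {L : List (Perm ℤ)} (hL : IsNonCrossingList n X L) {x y : ℤ}
    (hx : (orbitOf L.prod x).Finite) (hx' : L.prod x ≠ x)
    (hy : (orbitOf L.prod y).Finite) (hy' : L.prod y ≠ y) (hxy : y ∉ orbitOf L.prod x) :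
    NotSeparating X (orbitOf L.prod x) (orbitOf L.prod y) ∨
      NotSeparating X (orbitOf L.prod y) (orbitOf L.prod x) := by
  obtain ⟨u, hu, hux, -, huo⟩ := hL.exists_mem hx'
  obtain ⟨v, hv, hvy, -, hvo⟩ := hL.exists_mem hy'
  rw [huo] at hx hxy ⊢
  rw [hvo] at hy ⊢
  obtain ⟨A, B, hfu⟩ := (hL.1 u hu).isFinCycle hX hux hx
  obtain ⟨A', B', hfv⟩ := (hL.1 v hv).isFinCycle hX hvy hy
  by_cases huv : u = v
  · subst huv
    exact hfu.orbit_orbit hn hX hux hvy hxy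
  · exact (hL.nonCrossing hu hv huv).2.orbitsNonCrossing hX (hfu.finite_orbitOf hX)
      (hfv.finite_orbitOf hX) x y hux hvy

lemma orbitPartition_rel_of_fixed {w : Perm ℤ} {x y : ℤ} (hx : w x = x)
    (h : orbitPartition w x y) : y = x := by
  have h1 : (orbitOf w x).Finite := by
    rw [orbitOf_eq_singleton hx]; exact Set.finite_singleton x
  have := orbitPartition_rel_of_finite h1 h
  rwa [orbitOf_eq_singleton hx] at this

/-- Two finite orbits lie in gaps of one another by the cycle conditions. A finite orbit is not
separated by any point of an infinite orbit, which is enough even though the infinite part is a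
union of orbits. Two infinite orbits belong to the same part. -/
lemma IsNonCrossingList.isNonCrossing {n : ℕ} (hn : 0 < n) {X : Set ℤ}
    (hX : ∀ z : ℤ, z + n ∈ X ↔ z ∈ X) {L : List (Perm ℤ)} (hL : IsNonCrossingList n X L) :
    IsNonCrossing X (orbitPartition L.prod) := by
  set w := L.prod with hw
  intro x x' y y' hxx hyy hxy h1 h2
  have hwx : w x ≠ x := fun h => by
    rw [orbitPartition_rel_of_fixed h hxx] at h2
    exact lt_asymm h1 h2
  by_cases hwy : w y = y
  · rw [orbitPartition_rel_of_fixed hwy hyy]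
    exact ⟨h1, h2⟩
  have hne : ∀ a b, a ∈ orbitOf w x → b ∈ orbitOf w y → a ≠ b := by
    rintro a b ha hb rfl
    exact hxy (Or.inl (Perm.SameCycle.trans ha (Perm.SameCycle.symm hb)))
  by_cases hx : (orbitOf w x).Finite <;> by_cases hy : (orbitOf w y).Finite
  · have hx' := orbitPartition_rel_of_finite hx hxx
    have hy' := orbitPartition_rel_of_finite hy hyy
    refine NotSeparating.nc (hL.notSeparating_of_finite hn hX hx hwx hy hwy
      fun h => hxy (Or.inl h)) (Set.disjoint_left.2 fun a ha hb => hne a a ha hb rfl)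
      (Perm.SameCycle.refl w x) hx' (Perm.SameCycle.refl w y) hy' h1 h2
  · have hx' := orbitPartition_rel_of_finite hx hxx
    have := hL.notSeparating_of_infinite hX hy hx hwx y rfl x' hx' x (Perm.SameCycle.refl w x) h2
    exact absurd h1 (lt_asymm this)
  · have hy' := orbitPartition_rel_of_finite hy hyy
    have hx' := orbitOf_infinite_of_rel hx hxx
    refine ⟨hL.notSeparating_of_infinite hX hx hy hwy x rfl y (Perm.SameCycle.refl w y) y' hy' h1,
      ?_⟩
    by_contra hc
    have hne' : pos X x' ≠ pos X y' := fun he => by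
      have := pos_injective X he
      rw [this] at hxx
      exact hxy ((orbitPartition w).trans hxx ((orbitPartition w).symm hyy))
    exact lt_asymm h2 (hL.notSeparating_of_infinite hX hx' hy hwy x' rfl y' hy' y
      (Perm.SameCycle.refl w y) (lt_of_le_of_ne (not_lt.1 hc) hne'))
  · exact absurd (Or.inr ⟨hx, hy⟩) hxy

/-- For the infinite part: there is at most one infinite cycle on each side and all of `X` precedes
the complement, so the next point within the cycle is also the next point within the union. -/
lemma IsNonCrossingList.isSucc {n : ℕ} {X : Set ℤ}
    (hX : ∀ z : ℤ, z + n ∈ X ↔ z ∈ X) {L : List (Perm ℤ)} (hL : IsNonCrossingList n X L) :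
    IsSucc X (orbitPartition L.prod) L.prod := by
  intro x
  refine ⟨Or.inl (Perm.sameCycle_apply_right.2 (Perm.SameCycle.refl _ x)), fun z hz => ?_⟩
  by_cases hwx : L.prod x = x
  · rw [orbitPartition_rel_of_fixed hwx hz, hwx]
    exact Or.inr ⟨le_rfl, le_rfl⟩
  obtain ⟨u, hu, hux, hwu, huo⟩ := hL.exists_mem hwx
  rw [hwu]
  by_cases hx : (orbitOf L.prod x).Finite
  · have hz' := orbitPartition_rel_of_finite hx hz
    rw [huo] at hx hz'
    obtain ⟨A, B, hfu⟩ := (hL.1 u hu).isFinCycle hX hux hx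
    obtain ⟨m, hm, hxm⟩ := hfu.exists_orbitOf_eq hX hux
    rw [hm] at hz'
    exact hfu.succ hX hxm hz'
  · have hzi := orbitOf_infinite_of_rel hx hz
    have hwz : L.prod z ≠ z := fun h => by
      rw [orbitOf_eq_singleton h] at hzi
      exact hzi (Set.finite_singleton z)
    obtain ⟨v, hv, hvz, -, hvo⟩ := hL.exists_mem hwz
    rw [huo] at hx
    rw [hvo] at hzi
    have hXc : ∀ z : ℤ, z + n ∈ Xᶜ ↔ z ∈ Xᶜ := fun z => not_congr (hX z)
    have huu : u (u x) ≠ u x := fun h => hux (u.injective h)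
    left
    rcases (hL.1 u hu).isInfCycle hX hx with ⟨A, h⟩ | ⟨B, h⟩ <;>
      rcases (hL.1 v hv).isInfCycle hX hzi with ⟨A', h'⟩ | ⟨B', h'⟩
    · refine ⟨(h.isInfCycle hX).lt x hux, ?_⟩
      by_cases huv : u = v
      · subst huv
        exact (h.isInfCycle hX).next x z hux hvz
      · rcases (hL.nonCrossing hu hv huv).2 with hc | hc
        · exact (hc.not_infX_infX hX h h').elim
        · exact (hc.not_infX_infX hX h' h).elim
    · exact ⟨(h.isInfCycle hX).lt x hux, Or.inr (pos_lt_pos.2 (Or.inr (Or.inl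
        ⟨h.mem hX huu, h'.mem hXc hvz⟩))).le⟩
    · exact ⟨(h.isInfCycle hX).lt x hux, Or.inl (pos_lt_pos.2 (Or.inr (Or.inl
        ⟨h'.mem hX hvz, h.mem hXc hux⟩))).le⟩
    · refine ⟨(h.isInfCycle hX).lt x hux, ?_⟩
      by_cases huv : u = v
      · subst huv
        exact (h.isInfCycle hX).next x z hux hvz
      · rcases (hL.nonCrossing hu hv huv).2 with hc | hc
        · exact (hc.not_infXi_infXi hX h h').elim
        · exact (hc.not_infXi_infXi hX h' h).elim

lemma IsNonCrossingList.isNCP {n : ℕ} (hn : 0 < n) {X : Set ℤ}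
    (hX : ∀ z : ℤ, z + n ∈ X ↔ z ∈ X) {L : List (Perm ℤ)} (hL : IsNonCrossingList n X L)
    (hinf : (∃ u ∈ L, ∃ A, IsInfCycleX n X A u) ↔ ∃ u ∈ L, ∃ B, IsInfCycleXi n Xᶜ B u) :
    IsNCP n X (orbitPartition L.prod) := by
  refine ⟨(isPeriodic_prod fun u hu => (hL.1 u hu).isPeriodic).orbitPartition,
    hL.isNonCrossing hn hX, fun x hx => ?_⟩
  have hxo : (orbitOf L.prod x).Infinite := fun hf =>
    hx (hf.subset fun y hy => orbitPartition_rel_of_finite hf hy)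
  have hwx : L.prod x ≠ x := fun h => by
    rw [orbitOf_eq_singleton h] at hxo
    exact hxo (Set.finite_singleton x)
  obtain ⟨u, hu, hux, -, huo⟩ := hL.exists_mem hwx
  have hXc : ∀ z : ℤ, z + n ∈ Xᶜ ↔ z ∈ Xᶜ := fun z => not_congr (hX z)
  have key : (∃ u ∈ L, ∃ A, IsInfCycleX n X A u) ∧ ∃ u ∈ L, ∃ B, IsInfCycleXi n Xᶜ B u := by
    have hxu := hxo
    rw [huo] at hxu
    rcases (hL.1 u hu).isInfCycle hX hxu with h | h
    · exact ⟨⟨u, hu, h⟩, hinf.1 ⟨u, hu, h⟩⟩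
    · exact ⟨hinf.2 ⟨u, hu, h⟩, ⟨u, hu, h⟩⟩
  have hrel : ∀ v ∈ L, ∀ z, v z ≠ z → IsInfCycle X v → orbitPartition L.prod x z := by
    intro v hv z hz hvi
    refine Or.inr ⟨hxo, ?_⟩
    rw [orbitOf_prod_eq hL.disjoint hv hz]
    exact hvi.infinite_orbitOf hz
  obtain ⟨⟨v, hv, A, hA⟩, ⟨v', hv', B, hB⟩⟩ := key
  obtain ⟨z, hz⟩ := (hA.isInfCycle hX).exists_ne
  obtain ⟨z', hz'⟩ := (hB.isInfCycle hX).exists_ne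
  exact ⟨⟨z, hrel v hv z hz (hA.isInfCycle hX), hA.mem hX hz⟩,
    ⟨z', hrel v' hv' z' hz' (hB.isInfCycle hX), hB.mem hXc hz'⟩⟩

/-- A single finite cycle is the successor permutation of its own orbit partition, hence a product
of reflections. -/
lemma IsFinCycle.totalShift {n : ℕ} (hn : 0 < n) {X : Set ℤ}
    (hX : ∀ z : ℤ, z + n ∈ X ↔ z ∈ X) {A B : List ℤ} {u : Perm ℤ} (hu : IsFinCycle n X Xᶜ A B u) :
    totalShift n u = 0 := by
  have hL : IsNonCrossingList n X [u] := 
    ⟨fun v hv => by rw [List.mem_singleton.1 hv]; exact Or.inl ⟨A, B, hu⟩, by simp⟩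
  have h1 := hL.isSucc hX
  have h2 := hL.isNCP hn hX (iff_of_false
    (by simpa using fun A h => (IsInfCycleX.isInfCycle hX h).not_isFinCycle hX hu)
    (by simpa using fun A h => (IsInfCycleXi.isInfCycle hX h).not_isFinCycle hX hu))
  simpa using h2.totalShift_eq_zero hn hX h1

lemma IsInfCycleX.totalShift_pos {n : ℕ} (hn : 0 < n) {X : Set ℤ}
    (hX : ∀ z : ℤ, z + n ∈ X ↔ z ∈ X) {A : List ℤ} {u : Perm ℤ} (hu : IsInfCycleX n X A u) :
    0 < totalShift n u := by
  obtain ⟨x, hx⟩ := (hu.isInfCycle hX).exists_ne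
  refine AffineDual.totalShift_pos hn hu.2.isPeriodic (fun y => ?_) hx
  by_cases hy : u y = y
  · exact hy.ge
  · exact (hu.lt hy).le

lemma IsInfCycleXi.totalShift_neg {n : ℕ} (hn : 0 < n) {X : Set ℤ}
    (hX : ∀ z : ℤ, z + n ∈ X ↔ z ∈ X) {B : List ℤ} {u : Perm ℤ} (hu : IsInfCycleXi n Xᶜ B u) :
    totalShift n u < 0 := by
  obtain ⟨x, hx⟩ := (hu.isInfCycle hX).exists_ne
  refine AffineDual.totalShift_neg hn hu.2.isPeriodic (fun y => ?_) hx
  by_cases hy : u y = y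
  · exact hy.le
  · exact (hu.lt hy).le

/-- Finite cycles have shift `0`, infinite ones positive shift on `X` and negative shift on the
other side; a zero sum needs both kinds or neither. -/
lemma IsNonCrossingList.exists_infX_iff {n : ℕ} (hn : 0 < n) {X : Set ℤ}
    (hX : ∀ z : ℤ, z + n ∈ X ↔ z ∈ X) {L : List (Perm ℤ)} (hL : IsNonCrossingList n X L)
    (hshift : totalShift n L.prod = 0) :
    (∃ u ∈ L, ∃ A, IsInfCycleX n X A u) ↔ ∃ u ∈ L, ∃ B, IsInfCycleXi n Xᶜ B u := by
  rw [totalShift_prod hn fun u hu => (hL.1 u hu).isPeriodic] at hshift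
  constructor
  · rintro ⟨u, hu, A, hA⟩
    by_contra hc
    push Not at hc
    have h1 : ∀ s ∈ L.map (totalShift n), 0 ≤ s := by
      intro s hs
      obtain ⟨v, hv, rfl⟩ := List.mem_map.1 hs
      rcases hL.1 v hv with ⟨A, B, h⟩ | ⟨A, h⟩ | ⟨B, h⟩
      · exact (h.totalShift hn hX).ge
      · exact (h.totalShift_pos hn hX).le
      · exact absurd h (hc v hv B)
    have h2 := List.single_le_sum h1 _ (List.mem_map_of_mem hu)
    linarith [hA.totalShift_pos hn hX]
  · rintro ⟨u, hu, B, hB⟩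
    by_contra hc
    push Not at hc
    have h1 : ∀ s ∈ L.map (fun u => -totalShift n u), 0 ≤ s := by
      intro s hs
      obtain ⟨v, hv, rfl⟩ := List.mem_map.1 hs
      rcases hL.1 v hv with ⟨A, B, h⟩ | ⟨A, h⟩ | ⟨B, h⟩
      · simp [h.totalShift hn hX]
      · exact absurd h (hc v hv A)
      · linarith [h.totalShift_neg hn hX]
    have h2 := List.single_le_sum h1 _ (List.mem_map_of_mem hu)
    have h3 : (L.map (fun u => -totalShift n u)).sum = -(L.map (totalShift n)).sum := by
      clear * -
      induction L with
      | nil => simp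
      | cons u L ih => rw [List.map_cons, List.sum_cons, ih, List.map_cons, List.sum_cons]; ring
    linarith [hB.totalShift_neg hn hX]

lemma exists_isNCP_of_isPositiveNonCrossing {n : ℕ} (hn : 0 < n) {X : Set ℤ}
    (hX : ∀ z : ℤ, z + n ∈ X ↔ z ∈ X) {w : Perm ℤ} (hw : IsPositiveNonCrossing n X Xᶜ w)
    (hshift : totalShift n w = 0) : ∃ p, IsNCP n X p ∧ IsSucc X p w := by
  obtain ⟨L, h1, h2, rfl⟩ := hw
  have hL : IsNonCrossingList n X L := ⟨h1, h2⟩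
  exact ⟨_, hL.isNCP hn hX (hL.exists_infX_iff hn hX hshift), hL.isSucc hX⟩

/-! ### Words of a class -/

lemma isDecreasingWord_of {n : ℕ} {Ξ : Set ℤ} {B : List ℤ} (h : ∀ a ∈ B, a ∈ Ξ)
    (hB : B.Pairwise (· > ·)) (hn : ∀ a ∈ B, ∀ b ∈ B, a < b + n) : IsDecreasingWord n Ξ B := by
  refine isDecreasingWord_iff.2 (isIncreasingWord_of (fun a ha => ?_) ?_ ?_)
  · obtain ⟨a, ha', rfl⟩ := List.mem_map.1 ha
    simpa using h a ha'
  · rw [List.pairwise_map]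
    exact hB.imp fun h => by simpa using h
  · intro a ha b hb
    obtain ⟨a, ha', rfl⟩ := List.mem_map.1 ha
    obtain ⟨b, hb', rfl⟩ := List.mem_map.1 hb
    linarith [hn b hb' a ha']

lemma exists_increasing_list {S : Set ℤ} (hS : S.Finite) :
    ∃ A : List ℤ, A.Pairwise (· < ·) ∧ ∀ z, z ∈ A ↔ z ∈ S :=
  ⟨hS.toFinset.sort, hS.toFinset.sortedLT_sort.pairwise, by simp⟩

lemma exists_decreasing_list {S : Set ℤ} (hS : S.Finite) :
    ∃ B : List ℤ, B.Pairwise (· > ·) ∧ ∀ z, z ∈ B ↔ z ∈ S := by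
  obtain ⟨A, h1, h2⟩ := exists_increasing_list hS
  exact ⟨A.reverse, List.pairwise_reverse.2 h1, by simpa using h2⟩

/-- `A` and `B` are the words formed by the elements of the class of `x` in `X`, respectively in
its complement. -/
structure IsWordPair (n : ℕ) (X : Set ℤ) (p : Setoid ℤ) (x : ℤ) (A B : List ℤ) : Prop where
  mem_left : ∀ z, z ∈ A ↔ p x z ∧ z ∈ X
  mem_right : ∀ z, z ∈ B ↔ p x z ∧ z ∉ X
  inc : IsIncreasingWord n X A
  dec : IsDecreasingWord n Xᶜ B

lemma IsWordPair.mem_append {n : ℕ} {X : Set ℤ} {p : Setoid ℤ} {x : ℤ} {A B : List ℤ}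
    (h : IsWordPair n X p x A B) (z : ℤ) : z ∈ A ++ B ↔ p x z := by
  rw [List.mem_append, h.mem_left, h.mem_right]
  tauto

/-- Otherwise `b < b + n < a < a + n` on one side, and the part would cross its translate by `n`. -/
lemma IsNCP.lt_add_of_finite {n : ℕ} (hn : 0 < n) {X : Set ℤ} (hX : ∀ z : ℤ, z + n ∈ X ↔ z ∈ X)
    {p : Setoid ℤ} (hp : IsNCP n X p) {x a b : ℤ} (hx : {y | p x y}.Finite) (ha : p x a)
    (hb : p x b) (hab : a ∈ X ↔ b ∈ X) : a < b + n := by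
  have hn' : (0 : ℤ) < n := by exact_mod_cast hn
  have hper : ∀ y, p x y → ¬ p x (y + n) := fun y hy h => by
    have h1 : p y (y + (1 : ℤ) * n) := by rw [one_mul]; exact p.trans (p.symm hy) h
    exact one_ne_zero (hp.per.eq_zero_of_rel_add_mul hn (by rwa [← setOf_rel_eq hy]) h1)
  by_contra hc
  have hne : a ≠ b + n := fun h => hper b hb (h ▸ ha)
  have hlt : b + n < a := lt_of_le_of_ne (not_lt.1 hc) hne.symm
  have hn1 : ¬ p b (b + n) := fun h => hper b hb (p.trans hb h)
  have hn2 : ¬ p a (b + n) := fun h => hper b hb (p.trans ha h)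
  have hba : p b a := p.trans (p.symm hb) ha
  have hba' : p (b + n) (a + n) := (hp.per _ _).2 hba
  have haX := hX a
  have hbX := hX b
  by_cases h : a ∈ X
  · have := (hp.nc b a (b + n) (a + n) hba hba' hn1 (by rw [pos_lt_pos]; simp_all)
      (by rw [pos_lt_pos]; simp_all)).2
    rw [pos_lt_pos] at this
    simp_all
    omega
  · have := (hp.nc a b (b + n) (a + n) (p.symm hba) hba' hn2 (by rw [pos_lt_pos]; simp_all)
      (by rw [pos_lt_pos]; simp_all)).1
    rw [pos_lt_pos] at this
    simp_all
    omega

lemma IsNCP.exists_isWordPair {n : ℕ} (hn : 0 < n) {X : Set ℤ}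
    (hX : ∀ z : ℤ, z + n ∈ X ↔ z ∈ X) {p : Setoid ℤ} (hp : IsNCP n X p) {x : ℤ}
    (hx : {y | p x y}.Finite) : ∃ A B, IsWordPair n X p x A B := by
  obtain ⟨A, hA, hA'⟩ := exists_increasing_list
    (show {z | p x z ∧ z ∈ X}.Finite from hx.subset fun z h => h.1)
  obtain ⟨B, hB, hB'⟩ := exists_decreasing_list
    (show {z | p x z ∧ z ∉ X}.Finite from hx.subset fun z h => h.1)
  refine ⟨A, B, hA', hB', isIncreasingWord_of (fun a ha => ((hA' a).1 ha).2) hA ?_,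
    isDecreasingWord_of (fun a ha => ((hB' a).1 ha).2) hB ?_⟩
  · intro a ha b hb
    have ha := (hA' a).1 ha
    have hb := (hA' b).1 hb
    exact hp.lt_add_of_finite hn hX hx ha.1 hb.1 (iff_of_true ha.2 hb.2)
  · intro a ha b hb
    have ha := (hB' a).1 ha
    have hb := (hB' b).1 hb
    exact hp.lt_add_of_finite hn hX hx ha.1 hb.1 (iff_of_false ha.2 hb.2)

/-! ### Restrictions of a permutation -/

/-- `u` coincides with `w` on `S` and is the identity elsewhere. -/
def IsRestriction (w : Perm ℤ) (S : Set ℤ) (u : Perm ℤ) : Prop :=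
  (∀ z ∈ S, u z = w z) ∧ ∀ z ∉ S, u z = z

lemma exists_isRestriction {w : Perm ℤ} {S : Set ℤ} (hS : ∀ z, w z ∈ S ↔ z ∈ S) :
    ∃ u, IsRestriction w S u := by
  classical
  exact ⟨Perm.ofSubtype (w.subtypePerm (p := (· ∈ S)) hS),
    fun z hz => Perm.ofSubtype_apply_of_mem _ hz, fun z hz => Perm.ofSubtype_apply_of_not_mem _ hz⟩

lemma IsRestriction.disjoint {w u v : Perm ℤ} {S T : Set ℤ} (hu : IsRestriction w S u)
    (hv : IsRestriction w T v) (h : Disjoint S T) : Perm.Disjoint u v := fun z => by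
  by_cases hz : z ∈ S
  · exact Or.inr (hv.2 z (Set.disjoint_left.1 h hz))
  · exact Or.inl (hu.2 z hz)

/-- The union of the translates of the class of `x`. -/
def translates (n : ℕ) (p : Setoid ℤ) (x : ℤ) : Set ℤ := {z | ∃ m : ℤ, p x (z + m * n)}

lemma mem_translates_of_rel {n : ℕ} {p : Setoid ℤ} {x z : ℤ} (h : p x z) (m : ℤ) :
    z + m * n ∈ translates n p x := ⟨-m, by rwa [show z + m * n + -m * n = z by ring]⟩

lemma translates_add_mul {n : ℕ} {p : Setoid ℤ} (hp : IsPeriodicPartition n p) (x m : ℤ) :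
    translates n p (x + m * n) = translates n p x := by
  ext z
  constructor
  · rintro ⟨k, hk⟩
    refine ⟨k - m, (hp.add_mul _ _ m).1 ?_⟩
    rwa [show z + (k - m) * n + m * n = z + k * n by ring]
  · rintro ⟨k, hk⟩
    refine ⟨k + m, ?_⟩
    rw [show z + (k + m) * n = z + k * n + m * n by ring]
    exact (hp.add_mul _ _ m).2 hk

/-- Consecutive letters of the sorted word are cyclic successors in the part, and by uniqueness `w`
realizes exactly these. -/
lemma IsWordPair.isFinCycle {n : ℕ} (hn : 0 < n) {X : Set ℤ} (hX : ∀ z : ℤ, z + n ∈ X ↔ z ∈ X)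
    {p : Setoid ℤ} (hp : IsNCP n X p) {w : Perm ℤ} (hw : IsSucc X p w) {x : ℤ}
    (hx : {y | p x y}.Finite) {A B : List ℤ} (h : IsWordPair n X p x A B) {u : Perm ℤ}
    (hu : IsRestriction w (translates n p x) u) : IsFinCycle n X Xᶜ A B u := by
  have hsort := h.inc.sorted_append h.dec
  refine ⟨h.inc, h.dec, ?_, ?_, fun y z hyz m => ?_, fun z hz => ?_⟩
  · exact List.ne_nil_of_mem ((h.mem_append x).2 (p.refl x))
  · refine hsort.imp_of_mem fun {a b} ha hb hab => not_dvd_sub_iff.2 fun m hm => ?_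
    rw [h.mem_append] at ha hb
    rw [hm] at ha
    have h1 := hp.per.eq_zero_of_rel_add_mul hn (by rwa [← setOf_rel_eq hb])
      (p.trans (p.symm hb) ha)
    rw [h1] at hm
    rw [hm, zero_mul, add_zero] at hab
    exact lt_irrefl _ hab
  · have hy := (h.mem_append y).1 (mem_of_pair_infix_closeUp_left hyz)
    have hz : p x z := by
      rcases mem_of_pair_infix_closeUp_right hyz with hz | ⟨a, ha, rfl⟩
      · exact (h.mem_append z).1 hz
      · rw [zero_mul, add_zero]
        exact (h.mem_append a).1 ha
    have hs : Succ X p y z := ⟨p.trans (p.symm hy) hz, fun c hc =>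
      succ_of_pair_infix hsort hyz ((h.mem_append c).2 (p.trans hy hc))⟩
    rw [hu.1 _ (mem_translates_of_rel hy m)]
    exact (hw _).unique (hs.add_mul hX hp.per m)
  · refine hu.2 z ?_
    rintro ⟨m, hm⟩
    refine not_dvd_sub_iff.1 (hz _ ((h.mem_append _).2 hm)) (-m) ?_
    ring

/-! ### The cycles of the infinite class -/

/-- The infinite part is stable under translation by `n`, so its elements of `X` in one window `[x₀,
x₀ + n)` form a word whose translates exhaust it. Closing up with shift `1` gives the successors. -/
lemma IsNCP.exists_isInfCycleX {n : ℕ} (hn : 0 < n) {X : Set ℤ}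
    (hX : ∀ z : ℤ, z + n ∈ X ↔ z ∈ X) {p : Setoid ℤ} (hp : IsNCP n X p) {w : Perm ℤ}
    (hw : IsSucc X p w) {x : ℤ} (hx : {y | p x y}.Infinite) {u : Perm ℤ}
    (hu : IsRestriction w {z | p x z ∧ z ∈ X} u) :
    ∃ A, (∀ z ∈ A, p x z) ∧ IsInfCycleX n X A u := by
  have hn' : (0 : ℤ) < n := by exact_mod_cast hn
  obtain ⟨⟨x₀, hx₀, hx₀X⟩, -⟩ := hp.meets x hx
  have hper : ∀ z, p x z → ∀ m : ℤ, p x (z + m * n) := fun z hz m =>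
    p.trans hz (hp.rel_add_mul_of_infinite hn hX (by rwa [← setOf_rel_eq hz]) m)
  obtain ⟨A, hA, hA'⟩ := exists_increasing_list
    (show {z | (p x z ∧ z ∈ X) ∧ z ∈ Set.Ico x₀ (x₀ + n)}.Finite from
      (Set.finite_Ico x₀ (x₀ + n)).subset fun z h => h.2)
  have hA'' : ∀ z, p x z → z ∈ X → ∃ a ∈ A, ∃ m : ℤ, z = a + m * n := fun z hz hzX => by
    refine ⟨z - (z - x₀) / n * n, (hA' _).2 ⟨⟨?_, ?_⟩, ?_, ?_⟩, (z - x₀) / n, by ring⟩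
    · simpa [sub_eq_add_neg, neg_mul] using hper z hz (-((z - x₀) / n))
    · simpa [sub_eq_add_neg, neg_mul] using (add_mul_mem_iff hX z (-((z - x₀) / n))).2 hzX
    · linarith [Int.ediv_mul_le (z - x₀) hn'.ne']
    · have := Int.lt_ediv_add_one_mul_self (z - x₀) hn'
      linarith
  have hinc : IsIncreasingWord n X A := by
    refine isIncreasingWord_of (fun a ha => ((hA' a).1 ha).1.2) hA fun a ha b hb => ?_
    have h1 := ((hA' a).1 ha).2
    have h2 := ((hA' b).1 hb).2
    linarith [h1.2, h2.1]
  refine ⟨A, fun z hz => ((hA' z).1 hz).1.1, hinc, ?_, ?_, fun y z hyz m => ?_, fun z hz => ?_⟩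
  · exact List.ne_nil_of_mem ((hA' x₀).2 ⟨⟨hx₀, hx₀X⟩, le_rfl, by linarith⟩)
  · refine hA.imp_of_mem fun {a b} ha hb hab hdvd => ?_
    have := Int.le_of_dvd (by linarith) (dvd_sub_comm.1 hdvd)
    linarith [hinc.bounds hb ha]
  · have hy := ((hA' y).1 (mem_of_pair_infix_closeUp_left hyz)).1
    have hz : p x z ∧ z ∈ X := by
      rcases mem_of_pair_infix_closeUp_right hyz with hz | ⟨a, ha, rfl⟩
      · exact ((hA' z).1 hz).1
      · have := ((hA' a).1 ha).1
        exact ⟨hper a this.1 1, (add_mul_mem_iff hX a 1).2 this.2⟩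
    obtain ⟨hlt, hnb⟩ := hinc.not_between hyz
    have hs : Succ X p y z := by
      refine ⟨p.trans (p.symm hy.1) hz.1, fun c hc => Or.inl ⟨?_, ?_⟩⟩
      · exact pos_lt_pos.2 (Or.inl ⟨hy.2, hz.2, hlt⟩)
      · by_cases hcX : c ∈ X
        · obtain ⟨a, ha, k, rfl⟩ := hA'' c (p.trans hy.1 hc) hcX
          simpa [pos_le_pos, hcX, hy.2, hz.2] using hnb a ha k
        · right
          simp [pos_le_pos, hcX, hz.2]
    rw [hu.1 _ ⟨hper y hy.1 m, (add_mul_mem_iff hX y m).2 hy.2⟩]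
    exact (hw _).unique (hs.add_mul hX hp.per m)
  · refine hu.2 z ?_
    rintro ⟨h1, h2⟩
    obtain ⟨a, ha, m, rfl⟩ := hA'' z h1 h2
    exact not_dvd_sub_iff.1 (hz a ha) m rfl

lemma IsNCP.exists_isInfCycleXi {n : ℕ} (hn : 0 < n) {X : Set ℤ}
    (hX : ∀ z : ℤ, z + n ∈ X ↔ z ∈ X) {p : Setoid ℤ} (hp : IsNCP n X p) {w : Perm ℤ}
    (hw : IsSucc X p w) {x : ℤ} (hx : {y | p x y}.Infinite) {u : Perm ℤ}
    (hu : IsRestriction w {z | p x z ∧ z ∉ X} u) :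
    ∃ B, (∀ z ∈ B, p x z) ∧ IsInfCycleXi n Xᶜ B u := by
  have hn' : (0 : ℤ) < n := by exact_mod_cast hn
  obtain ⟨-, ⟨x₀, hx₀, hx₀X⟩⟩ := hp.meets x hx
  have hper : ∀ z, p x z → ∀ m : ℤ, p x (z + m * n) := fun z hz m =>
    p.trans hz (hp.rel_add_mul_of_infinite hn hX (by rwa [← setOf_rel_eq hz]) m)
  obtain ⟨B, hB, hB'⟩ := exists_decreasing_list
    (show {z | (p x z ∧ z ∉ X) ∧ z ∈ Set.Ico x₀ (x₀ + n)}.Finite from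
      (Set.finite_Ico x₀ (x₀ + n)).subset fun z h => h.2)
  have hB'' : ∀ z, p x z → z ∉ X → ∃ a ∈ B, ∃ m : ℤ, z = a + m * n := fun z hz hzX => by
    refine ⟨z - (z - x₀) / n * n, (hB' _).2 ⟨⟨?_, ?_⟩, ?_, ?_⟩, (z - x₀) / n, by ring⟩
    · simpa [sub_eq_add_neg, neg_mul] using hper z hz (-((z - x₀) / n))
    · simpa [sub_eq_add_neg, neg_mul] using mt (add_mul_mem_iff hX z (-((z - x₀) / n))).1 hzX
    · linarith [Int.ediv_mul_le (z - x₀) hn'.ne']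
    · have := Int.lt_ediv_add_one_mul_self (z - x₀) hn'
      linarith
  have hdec : IsDecreasingWord n Xᶜ B := by
    refine isDecreasingWord_of (fun a ha => ((hB' a).1 ha).1.2) hB fun a ha b hb => ?_
    have h1 := ((hB' a).1 ha).2
    have h2 := ((hB' b).1 hb).2
    linarith [h1.2, h2.1]
  refine ⟨B, fun z hz => ((hB' z).1 hz).1.1, hdec, ?_, ?_, fun y z hyz m => ?_, fun z hz => ?_⟩
  · exact List.ne_nil_of_mem ((hB' x₀).2 ⟨⟨hx₀, hx₀X⟩, le_rfl, by linarith⟩)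
  · refine hB.imp_of_mem fun {a b} ha hb hab hdvd => ?_
    have := Int.le_of_dvd (by linarith) hdvd
    linarith [hdec.bounds ha hb]
  · have hy := ((hB' y).1 (mem_of_pair_infix_closeUp_left hyz)).1
    have hz : p x z ∧ z ∉ X := by
      rcases mem_of_pair_infix_closeUp_right hyz with hz | ⟨a, ha, rfl⟩
      · exact ((hB' z).1 hz).1
      · have := ((hB' a).1 ha).1
        exact ⟨hper a this.1 (-1), mt (add_mul_mem_iff hX a (-1)).1 this.2⟩
    obtain ⟨hlt, hnb⟩ := hdec.not_between hyz
    have hs : Succ X p y z := by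
      refine ⟨p.trans (p.symm hy.1) hz.1, fun c hc => Or.inl ⟨?_, ?_⟩⟩
      · exact pos_lt_pos.2 (Or.inr (Or.inr ⟨hy.2, hz.2, hlt⟩))
      · by_cases hcX : c ∈ X
        · left
          simp [pos_le_pos, hcX, hy.2]
        · obtain ⟨a, ha, k, rfl⟩ := hB'' c (p.trans hy.1 hc) hcX
          simpa [pos_le_pos, hcX, hy.2, hz.2] using (hnb a ha k).symm
    rw [hu.1 _ ⟨hper y hy.1 m, mt (add_mul_mem_iff hX y m).1 hy.2⟩]
    exact (hw _).unique (hs.add_mul hX hp.per m)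
  · refine hu.2 z ?_
    rintro ⟨h1, h2⟩
    obtain ⟨a, ha, m, rfl⟩ := hB'' z h1 h2
    exact not_dvd_sub_iff.1 (hz a ha) m rfl

/-! ### Gaps -/

lemma exists_pair_infix_between {b : ℤ} (L : List ℤ) {c e : ℤ} (hc : c < b) (he : b < e)
    (hL : ∀ x ∈ L, x ≠ b) : ∃ y z, [y, z] <:+: c :: (L ++ [e]) ∧ y < b ∧ b < z := by
  induction L generalizing c with
  | nil => exact ⟨c, e, List.infix_rfl, hc, he⟩
  | cons d L ih =>
    rcases lt_or_gt_of_ne (hL d (by simp)) with hd | hd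
    · obtain ⟨y, z, h, h'⟩ := ih hd fun x hx => hL x (by simp [hx])
      exact ⟨y, z, List.infix_cons h, h'⟩
    · exact ⟨c, d, ⟨[], L ++ [e], rfl⟩, hc, hd⟩

/-- A set that is not separated by the translates of an increasing word lies in a gap, up to
translation. -/
lemma exists_gap {n : ℕ} (hn : 0 < n) {A : List ℤ} (hA : A ≠ []) {T : Set ℤ} (hT : T.Nonempty)
    (h : ∀ a ∈ A, ∀ m : ℤ, ∀ b ∈ T, ∀ b' ∈ T, a + m * n ≤ b → a + m * n < b') :
    ∃ m : ℤ, ∃ y z, [y, z] <:+: closeUp n 1 A ∧ ∀ b ∈ T, y < b + m * n ∧ b + m * n < z := by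
  have hn' : (0 : ℤ) < n := by exact_mod_cast hn
  obtain ⟨b, hb⟩ := hT
  cases A with
  | nil => exact absurd rfl hA
  | cons a A =>
    have hne : ∀ x ∈ a :: A, ∀ m : ℤ, x + m * n ≠ b := fun x hx m he =>
      lt_irrefl b (by simpa only [he] using h x hx m b hb b hb he.le)
    -- The quotient `k` is the number of periods that brings `b` into the window `[a, a + n)`
    -- covered by the closed-up word.
    have h1 := Int.ediv_mul_le (b - a) hn'.ne'
    have h2 := Int.lt_ediv_add_one_mul_self (b - a) hn'
    set k := (b - a) / (n : ℤ) with hk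
    obtain ⟨y, z, hyz, hy, hz⟩ := exists_pair_infix_between (b := b - k * n) A (c := a)
      (e := a + 1 * n)
      (lt_of_le_of_ne (by linarith) fun he => hne a (by simp) k (by linarith)) (by linarith)
      (fun x hx he => hne x (by simp [hx]) k (by linarith))
    have hyz' : [y, z] <:+: closeUp n 1 (a :: A) := hyz
    refine ⟨-k, y, z, hyz', fun b' hb' => ⟨?_, ?_⟩⟩
    · have := h y (mem_of_pair_infix_closeUp_left hyz') k b hb b' hb' (by linarith)
      linarith
    · by_contra hcon
      rcases mem_of_pair_infix_closeUp_right hyz' with hm | ⟨a', hm, rfl⟩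
      · linarith [h z hm k b' hb' b hb (by linarith)]
      · linarith [h a' hm (k + 1) b' hb' b hb (by linarith)]

lemma exists_gap_decreasing {n : ℕ} (hn : 0 < n) {B : List ℤ} (hB : B ≠ []) {T : Set ℤ}
    (hT : T.Nonempty)
    (h : ∀ a ∈ B, ∀ m : ℤ, ∀ b ∈ T, ∀ b' ∈ T, a + m * n ≤ b → a + m * n < b') :
    ∃ m : ℤ, ∃ y z, [y, z] <:+: closeUp n (-1) B ∧ ∀ b ∈ T, z < b + m * n ∧ b + m * n < y := by
  obtain ⟨m, y, z, hyz, h'⟩ := exists_gap hn (A := B.map (- ·)) (by simpa) (T := -T)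
    (by simpa using hT) (by
      intro a ha m b hb b' hb' hle
      obtain ⟨a, ha', rfl⟩ := List.mem_map.1 ha
      by_contra hc
      have := h a ha' (-m) (-b') hb' (-b) hb (by linarith)
      linarith)
  rw [closeUp_map_neg] at hyz
  refine ⟨-m, -y, -z, pair_infix_of_map_neg hyz, fun b hb => ?_⟩
  have := h' (-b) (by simpa)
  constructor <;> linarith

/-! ### Non-crossing classes yield non-crossing cycles -/

/-- No element of `X` in a translate of the class of `x` separates elements of the class
of `y`. -/
def Unseparated (n : ℕ) (X : Set ℤ) (p : Setoid ℤ) (x y : ℤ) : Prop :=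
  ∀ s ∈ X, s ∈ translates n p x → ∀ b b', p y b → p y b' → s ≤ b → s < b'

lemma not_rel_symm {n : ℕ} {p : Setoid ℤ} (hp : IsPeriodicPartition n p) {x y : ℤ}
    (h : ∀ m : ℤ, ¬ p x (y + m * n)) (m : ℤ) : ¬ p y (x + m * n) := fun h' => by
  refine h (-m) (p.symm ((hp.add_mul _ _ m).1 ?_))
  rwa [show y + -m * n + m * n = y by ring]

/-- If a point of a translate of the part of `x` separates two elements of the part of `y`,
non-crossing traps the whole translate between them, and hence in `X`. -/
lemma IsNCP.unseparated_or {n : ℕ} {X : Set ℤ} (hX : ∀ z : ℤ, z + n ∈ X ↔ z ∈ X)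
    {p : Setoid ℤ} (hp : IsNCP n X p) {x y : ℤ} (hxy : ∀ m : ℤ, ¬ p x (y + m * n))
    (hy : ∀ b, p y b → b ∈ X) : Unseparated n X p x y ∨ ∃ b b', ∃ m : ℤ, p y b ∧ p y b' ∧
      ∀ c, p x c → b < c + m * n ∧ c + m * n < b' ∧ c ∈ X := by
  by_cases h : Unseparated n X p x y
  · exact Or.inl h
  right
  unfold Unseparated at h
  push Not at h
  obtain ⟨s, hs, ⟨k, hk⟩, b, b', hb, hb', h1, h2⟩ := h
  have hne : ∀ b, p y b → ∀ c, p x c → c + -k * n ≠ b := fun b hb c hc he => by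
    refine not_rel_symm hp.per hxy (-k) (p.trans hb ?_)
    rw [← he]
    exact (hp.per.add_mul _ _ _).2 (p.symm hc)
  have hs' : s + k * n + -k * n = s := by ring
  have hn1 := hne b hb _ hk
  have hn2 := hne b' hb' _ hk
  rw [hs'] at hn1 hn2
  refine ⟨b', b, -k, hb', hb, fun c hc => ?_⟩
  have hsc : p s (c + -k * n) := by
    rw [← hs']
    exact (hp.per.add_mul _ _ _).2 (p.trans (p.symm hk) hc)
  have hbs : ¬ p b' s := fun h => by
    refine not_rel_symm hp.per hxy (-k) (p.trans hb' (p.trans h (p.trans hsc ?_)))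
    exact (hp.per.add_mul _ _ _).2 (p.symm hc)
  obtain ⟨h3, h4⟩ := hp.nc b' b s _ (p.trans (p.symm hb') hb) hsc hbs
    (pos_lt_pos.2 (Or.inl ⟨hy b' hb', hs, lt_of_le_of_ne h2 hn2.symm⟩))
    (pos_lt_pos.2 (Or.inl ⟨hs, hy b hb, lt_of_le_of_ne h1 hn1⟩))
  have hbX := hy b hb
  have hbX' := hy b' hb'
  have hcX : c + -k * n ∈ X := by
    by_contra hcX
    rw [pos_lt_pos] at h4
    tauto
  have := add_mul_mem_iff hX c (-k)
  rw [pos_lt_pos] at h3 h4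
  refine ⟨?_, ?_, this.1 hcX⟩ <;> tauto

/-- Two parts cannot each have a translate trapped inside the other: the sum of the two shifts would
have to be both positive and negative. -/
lemma IsNCP.unseparated_or_unseparated {n : ℕ} {X : Set ℤ} (hX : ∀ z : ℤ, z + n ∈ X ↔ z ∈ X)
    {p : Setoid ℤ} (hp : IsNCP n X p) {x y : ℤ} (hxy : ∀ m : ℤ, ¬ p x (y + m * n))
    (hy : ∀ b, p y b → b ∈ X) :
    Unseparated n X p x y ∨ ((∀ a, p x a → a ∈ X) ∧ Unseparated n X p y x) := by
  rcases hp.unseparated_or hX hxy hy with h | ⟨b, b', m, hb, hb', h⟩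
  · exact Or.inl h
  have hx : ∀ a, p x a → a ∈ X := fun a ha => (h a ha).2.2
  refine Or.inr ⟨hx, ?_⟩
  refine (hp.unseparated_or hX (not_rel_symm hp.per hxy) hx).resolve_right ?_
  rintro ⟨a, a', k, ha, ha', h'⟩
  linarith [(h a ha).1, (h a' ha').2.1, (h' b hb).1, (h' b' hb').2.1]

lemma IsRestriction.translate {n : ℕ} {p : Setoid ℤ} (hp : IsPeriodicPartition n p)
    {w u : Perm ℤ} {x : ℤ} (hu : IsRestriction w (translates n p x) u) (m : ℤ) :
    IsRestriction w (translates n p (x + m * n)) u := by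
  rwa [translates_add_mul hp]

lemma IsPeriodicPartition.finite_add_mul {n : ℕ} {p : Setoid ℤ} (hp : IsPeriodicPartition n p)
    {x : ℤ} (hx : {y | p x y}.Finite) (m : ℤ) : {y | p (x + m * n) y}.Finite := by
  rw [← Set.not_infinite, hp.infinite_add_mul]
  exact Set.not_infinite.2 hx

lemma rel_sub_mul_iff {n : ℕ} {p : Setoid ℤ} (hp : IsPeriodicPartition n p) {y b m : ℤ} :
    p y (b - m * n) ↔ p (y + m * n) b := by
  rw [← hp.add_mul _ _ m, sub_add_cancel]

/-- The same periodic cycle can be written with the letters of any translate of the part. The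
freedom in `m` is needed because the gap conditions hold only for a suitable translate. -/
lemma IsNCP.exists_isFinCycle_left {n : ℕ} (hn : 0 < n) {X : Set ℤ}
    (hX : ∀ z : ℤ, z + n ∈ X ↔ z ∈ X) {p : Setoid ℤ} (hp : IsNCP n X p) {w : Perm ℤ}
    (hw : IsSucc X p w) {y : ℤ} (hyf : {z | p y z}.Finite) (hy : ∀ b, p y b → b ∈ X)
    {v : Perm ℤ} (hv : IsRestriction w (translates n p y) v) (m : ℤ) :
    ∃ A', IsFinCycle n X Xᶜ A' [] v ∧ ∀ b ∈ A', p y (b - m * n) := by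
  obtain ⟨A', B', hAB⟩ := hp.exists_isWordPair hn hX (hp.per.finite_add_mul hyf m)
  have hB' : B' = [] := List.eq_nil_iff_forall_not_mem.2 fun b hb => by
    obtain ⟨h1, h2⟩ := (hAB.mem_right b).1 hb
    refine h2 ((add_mul_mem_iff hX b (-m)).1 (hy _ ?_))
    rw [neg_mul, ← sub_eq_add_neg]
    exact (rel_sub_mul_iff hp.per).2 h1
  subst hB'
  exact ⟨A', hAB.isFinCycle hn hX hp hw (hp.per.finite_add_mul hyf m) (hv.translate hp.per m),
    fun b hb => (rel_sub_mul_iff hp.per).2 ((hAB.mem_left b).1 hb).1⟩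

lemma IsNCP.exists_isFinCycle_right {n : ℕ} (hn : 0 < n) {X : Set ℤ}
    (hX : ∀ z : ℤ, z + n ∈ X ↔ z ∈ X) {p : Setoid ℤ} (hp : IsNCP n X p) {w : Perm ℤ}
    (hw : IsSucc X p w) {y : ℤ} (hyf : {z | p y z}.Finite) (hy : ∀ b, p y b → b ∈ Xᶜ)
    {v : Perm ℤ} (hv : IsRestriction w (translates n p y) v) (m : ℤ) :
    ∃ B', IsFinCycle n X Xᶜ [] B' v ∧ ∀ b ∈ B', p y (b - m * n) := by
  obtain ⟨A', B', hAB⟩ := hp.exists_isWordPair hn hX (hp.per.finite_add_mul hyf m)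
  have hA' : A' = [] := List.eq_nil_iff_forall_not_mem.2 fun b hb => by
    obtain ⟨h1, h2⟩ := (hAB.mem_left b).1 hb
    refine hy (b + -m * n) ?_ ((add_mul_mem_iff hX b (-m)).2 h2)
    rw [neg_mul, ← sub_eq_add_neg]
    exact (rel_sub_mul_iff hp.per).2 h1
  subst hA'
  exact ⟨B', hAB.isFinCycle hn hX hp hw (hp.per.finite_add_mul hyf m) (hv.translate hp.per m),
    fun b hb => (rel_sub_mul_iff hp.per).2 ((hAB.mem_right b).1 hb).1⟩

/-- A translate of a class contained in `X` yields a finite cycle lying in a gap. -/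
lemma IsNCP.exists_inGapX {n : ℕ} (hn : 0 < n) {X : Set ℤ} (hX : ∀ z : ℤ, z + n ∈ X ↔ z ∈ X)
    {p : Setoid ℤ} (hp : IsNCP n X p) {w : Perm ℤ} (hw : IsSucc X p w) {x y : ℤ}
    (hyf : {z | p y z}.Finite) (hy : ∀ b, p y b → b ∈ X) (h : Unseparated n X p x y)
    {A : List ℤ} (hA : ∀ a ∈ A, p x a ∧ a ∈ X) {v : Perm ℤ}
    (hv : IsRestriction w (translates n p y) v) :
    ∃ A', IsFinCycle n X Xᶜ A' [] v ∧ InGapX n A A' := by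
  have key := hp.exists_isFinCycle_left hn hX hw hyf hy hv
  by_cases hnil : A = []
  · obtain ⟨A', h1, -⟩ := key 0
    exact ⟨A', h1, Or.inl hnil⟩
  obtain ⟨m, c, d, hcd, hm⟩ := exists_gap hn hnil (T := {z | p y z}) ⟨y, p.refl y⟩
    fun a ha m b hb b' hb' hle => h _ ((add_mul_mem_iff hX a m).2 (hA a ha).2)
      (mem_translates_of_rel (hA a ha).1 m) b b' hb hb' hle
  obtain ⟨A', h1, h2⟩ := key m
  refine ⟨A', h1, Or.inr ⟨c, d, hcd, fun b hb => ?_⟩⟩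
  simpa using hm _ (h2 b hb)

lemma IsNCP.exists_inGapXi {n : ℕ} (hn : 0 < n) {X : Set ℤ} (hX : ∀ z : ℤ, z + n ∈ X ↔ z ∈ X)
    {p : Setoid ℤ} (hp : IsNCP n X p) {w : Perm ℤ} (hw : IsSucc X p w) {x y : ℤ}
    (hyf : {z | p y z}.Finite) (hy : ∀ b, p y b → b ∈ Xᶜ) (h : Unseparated n Xᶜ p x y)
    {B : List ℤ} (hB : ∀ a ∈ B, p x a ∧ a ∉ X) {v : Perm ℤ}
    (hv : IsRestriction w (translates n p y) v) :
    ∃ B', IsFinCycle n X Xᶜ [] B' v ∧ InGapXi n B B' := by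
  have key := hp.exists_isFinCycle_right hn hX hw hyf hy hv
  by_cases hnil : B = []
  · obtain ⟨B', h1, -⟩ := key 0
    exact ⟨B', h1, Or.inl hnil⟩
  obtain ⟨m, c, d, hcd, hm⟩ := exists_gap_decreasing hn hnil (T := {z | p y z}) ⟨y, p.refl y⟩
    fun a ha m b hb b' hb' hle => h _ (mt (add_mul_mem_iff hX a m).1 (hB a ha).2)
      (mem_translates_of_rel (hB a ha).1 m) b b' hb hb' hle
  obtain ⟨B', h1, h2⟩ := key m
  refine ⟨B', h1, Or.inr ⟨c, d, hcd, fun b hb => ?_⟩⟩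
  simpa using hm _ (h2 b hb)

lemma IsNCP.nonCrossingOrdered_of_subset {n : ℕ} (hn : 0 < n) {X : Set ℤ}
    (hX : ∀ z : ℤ, z + n ∈ X ↔ z ∈ X) {p : Setoid ℤ} (hp : IsNCP n X p) {w : Perm ℤ}
    (hw : IsSucc X p w) {x y : ℤ} (hxf : {z | p x z}.Finite) (hyf : {z | p y z}.Finite)
    {u v : Perm ℤ} (hu : IsRestriction w (translates n p x) u)
    (hv : IsRestriction w (translates n p y) v)
    (h : (∀ b, p y b → b ∈ X) ∧ Unseparated n X p x y ∨
      (∀ b, p y b → b ∈ Xᶜ) ∧ Unseparated n Xᶜ p x y) : NonCrossingOrdered n X Xᶜ u v := by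
  obtain ⟨A, B, hAB⟩ := hp.exists_isWordPair hn hX hxf
  have hc := hAB.isFinCycle hn hX hp hw hxf hu
  refine Or.inr (Or.inr (Or.inl ⟨A, B, hc, ?_⟩))
  rcases h with ⟨h1, h2⟩ | ⟨h1, h2⟩
  · exact Or.inl (hp.exists_inGapX hn hX hw hyf h1 h2 (fun a ha => (hAB.mem_left a).1 ha) hv)
  · exact Or.inr (hp.exists_inGapXi hn hX hw hyf h1 h2 (fun a ha => (hAB.mem_right a).1 ha) hv)

lemma IsNCP.nonCrossingCycles_of_subset {n : ℕ} (hn : 0 < n) {X : Set ℤ}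
    (hX : ∀ z : ℤ, z + n ∈ X ↔ z ∈ X) {p : Setoid ℤ} (hp : IsNCP n X p) {w : Perm ℤ}
    (hw : IsSucc X p w) {x y : ℤ} (hxf : {z | p x z}.Finite) (hyf : {z | p y z}.Finite)
    (hxy : ∀ m : ℤ, ¬ p x (y + m * n))
    {u v : Perm ℤ} (hu : IsRestriction w (translates n p x) u)
    (hv : IsRestriction w (translates n p y) v)
    (h : (∀ b, p y b → b ∈ X) ∨ (∀ b, p y b → b ∈ Xᶜ)) : NonCrossingCycles n X Xᶜ u v := by
  rcases h with h | h
  · rcases hp.unseparated_or_unseparated hX hxy h with h' | ⟨h', h''⟩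
    · exact Or.inl (hp.nonCrossingOrdered_of_subset hn hX hw hxf hyf hu hv (Or.inl ⟨h, h'⟩))
    · exact Or.inr (hp.nonCrossingOrdered_of_subset hn hX hw hyf hxf hv hu (Or.inl ⟨h', h''⟩))
  · rcases hp.compl.unseparated_or_unseparated (fun z => not_congr (hX z)) hxy h with h' | ⟨h', h''⟩
    · exact Or.inl (hp.nonCrossingOrdered_of_subset hn hX hw hxf hyf hu hv (Or.inr ⟨h, h'⟩))
    · exact Or.inr (hp.nonCrossingOrdered_of_subset hn hX hw hyf hxf hv hu (Or.inr ⟨h', h''⟩))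

/-- Two chords across the strip that belong to different parts have their end points in the same
order on both sides. -/
lemma IsNCP.lt_of_lt_of_mixed {n : ℕ} {X : Set ℤ} {p : Setoid ℤ} (hp : IsNCP n X p) {x y : ℤ}
    (hxy : ¬ p x y) {a b α β : ℤ} (ha : p x a) (haX : a ∈ X) (hb : p y b) (hbX : b ∈ X)
    (hα : p x α) (hαX : α ∉ X) (hβ : p y β) (hβX : β ∉ X) (hab : a < b) : α < β := by
  have := (hp.nc a α b β (p.trans (p.symm ha) hα) (p.trans (p.symm hb) hβ)
    (fun h => hxy (p.trans ha (p.trans h (p.symm hb)))) (pos_lt_pos.2 (Or.inl ⟨haX, hbX, hab⟩))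
    (pos_lt_pos.2 (Or.inr (Or.inl ⟨hbX, hαX⟩)))).2
  rw [pos_lt_pos] at this
  tauto

/-- Two classes meeting both `X` and its complement are ordered. -/
lemma IsNCP.lt_and_lt_of_lt {n : ℕ} {X : Set ℤ} {p : Setoid ℤ} (hp : IsNCP n X p) {x y : ℤ}
    (hxy : ¬ p x y) {a b α β : ℤ} (ha : p x a) (haX : a ∈ X) (hb : p y b) (hbX : b ∈ X)
    (hα : p x α) (hαX : α ∉ X) (hβ : p y β) (hβX : β ∉ X) (hab : a < b) :
    (∀ a' b', p x a' → a' ∈ X → p y b' → b' ∈ X → a' < b') ∧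
      ∀ α' β', p x α' → α' ∉ X → p y β' → β' ∉ X → α' < β' := by
  refine ⟨fun a' b' ha' haX' hb' hbX' => ?_, fun α' β' hα' hαX' hβ' hβX' =>
    hp.lt_of_lt_of_mixed hxy ha haX hb hbX hα' hαX' hβ' hβX' hab⟩
  have h1 := hp.lt_of_lt_of_mixed hxy ha haX hb hbX hα hαX hβ hβX hab
  by_contra hc
  have hne : b' ≠ a' := fun h => hxy (p.trans ha' (p.symm (h ▸ hb')))
  have := hp.lt_of_lt_of_mixed (fun h => hxy (p.symm h)) hb' hbX' ha' haX' hβ hβX hα hαX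
    (lt_of_le_of_ne (not_lt.1 hc) hne)
  linarith

lemma IsNCP.nonCrossingOrdered_of_mixed {n : ℕ} (hn : 0 < n) {X : Set ℤ}
    (hX : ∀ z : ℤ, z + n ∈ X ↔ z ∈ X) {p : Setoid ℤ} (hp : IsNCP n X p) {w : Perm ℤ}
    (hw : IsSucc X p w) {x y : ℤ} (hxf : {z | p x z}.Finite) (hyf : {z | p y z}.Finite)
    (hxy : ∀ m : ℤ, ¬ p x (y + m * n)) {u v : Perm ℤ} (hu : IsRestriction w (translates n p x) u)
    (hv : IsRestriction w (translates n p y) v) {a b α β : ℤ} (ha : p x a) (haX : a ∈ X)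
    (hb : p y b) (hbX : b ∈ X) (hα : p x α) (hαX : α ∉ X) (hβ : p y β) (hβX : β ∉ X) :
    NonCrossingOrdered n X Xᶜ u v := by
  have hn' : (0 : ℤ) < n := by exact_mod_cast hn
  -- This translate satisfies `a < b + m * n < a + n`. The order of these three points determines
  -- that of the corresponding parts on both sides, which gives all the inequalities of the second
  -- shape.
  set m : ℤ := -((b - a) / n) with hm
  have h1 := Int.ediv_mul_le (b - a) hn'.ne'
  have h2 := Int.lt_ediv_add_one_mul_self (b - a) hn'
  have hb' : p (y + m * n) (b + m * n) := (hp.per.add_mul _ _ _).2 hb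
  have hβ' : p (y + m * n) (β + m * n) := (hp.per.add_mul _ _ _).2 hβ
  have hbX' := (add_mul_mem_iff hX b m).2 hbX
  have hβX' := mt (add_mul_mem_iff hX β m).1 hβX
  have hper : ∀ z z', p z z' → p (z + n) (z' + n) := fun z z' => (hp.per z z').2
  have hlt : a < b + m * n := by
    refine lt_of_le_of_ne (by rw [hm]; linarith) fun he => hxy m (p.trans ha ?_)
    rw [he]
    exact p.symm hb'
  have hlt' : b + m * n < a + n := by rw [hm]; linarith
  have hne : ¬ p (y + m * n) (x + n) := fun h => by
    refine not_rel_symm hp.per hxy (1 - m) ((hp.per.add_mul _ _ m).1 ?_)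
    rwa [show x + (1 - m) * n + m * n = x + n by ring]
  obtain ⟨k1, k2⟩ := hp.lt_and_lt_of_lt (hxy m) ha haX hb' hbX' hα hαX hβ' hβX' hlt
  obtain ⟨k3, k4⟩ := hp.lt_and_lt_of_lt hne hb' hbX' (hper _ _ ha) ((hX a).2 haX) hβ' hβX'
    (hper _ _ hα) (mt (hX α).1 hαX) hlt'
  obtain ⟨A, B, hAB⟩ := hp.exists_isWordPair hn hX hxf
  obtain ⟨A', B', hAB'⟩ := hp.exists_isWordPair hn hX (hp.per.finite_add_mul hyf m)
  refine Or.inr (Or.inl ⟨A, B, A', B', List.ne_nil_of_mem ((hAB.mem_left a).2 ⟨ha, haX⟩),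
    List.ne_nil_of_mem ((hAB.mem_right α).2 ⟨hα, hαX⟩),
    List.ne_nil_of_mem ((hAB'.mem_left _).2 ⟨hb', hbX'⟩),
    List.ne_nil_of_mem ((hAB'.mem_right _).2 ⟨hβ', hβX'⟩),
    hAB.isFinCycle hn hX hp hw hxf hu, hAB'.isFinCycle hn hX hp hw (hp.per.finite_add_mul hyf m)
    (hv.translate hp.per m), fun c hc d hd => ?_, fun c hc d hd => ?_⟩)
  · obtain ⟨hc, hcX⟩ := (hAB.mem_left c).1 hc
    obtain ⟨hd, hdX⟩ := (hAB'.mem_left d).1 hd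
    exact ⟨k1 c d hc hcX hd hdX, k3 d (c + n) hd hdX (hper _ _ hc) ((hX c).2 hcX)⟩
  · obtain ⟨hc, hcX⟩ := (hAB.mem_right c).1 hc
    obtain ⟨hd, hdX⟩ := (hAB'.mem_right d).1 hd
    exact ⟨k2 c d hc hcX hd hdX, k4 d (c + n) hd hdX (hper _ _ hc) (mt (hX c).1 hcX)⟩

lemma IsNCP.nonCrossingCycles_of_finite {n : ℕ} (hn : 0 < n) {X : Set ℤ}
    (hX : ∀ z : ℤ, z + n ∈ X ↔ z ∈ X) {p : Setoid ℤ} (hp : IsNCP n X p) {w : Perm ℤ}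
    (hw : IsSucc X p w) {x y : ℤ} (hxf : {z | p x z}.Finite) (hyf : {z | p y z}.Finite)
    (hxy : ∀ m : ℤ, ¬ p x (y + m * n)) {u v : Perm ℤ} (hu : IsRestriction w (translates n p x) u)
    (hv : IsRestriction w (translates n p y) v) : NonCrossingCycles n X Xᶜ u v := by
  by_cases hy : (∀ b, p y b → b ∈ X) ∨ (∀ b, p y b → b ∈ Xᶜ)
  · exact hp.nonCrossingCycles_of_subset hn hX hw hxf hyf hxy hu hv hy
  by_cases hx : (∀ b, p x b → b ∈ X) ∨ (∀ b, p x b → b ∈ Xᶜ)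
  · exact (hp.nonCrossingCycles_of_subset hn hX hw hyf hxf (not_rel_symm hp.per hxy) hv hu hx).symm
  simp only [Set.mem_compl_iff] at hx hy
  push Not at hx hy
  obtain ⟨⟨α, hα, hαX⟩, a, ha, haX⟩ := hx
  obtain ⟨⟨β, hβ, hβX⟩, b, hb, hbX⟩ := hy
  exact Or.inl (hp.nonCrossingOrdered_of_mixed hn hX hw hxf hyf hxy hu hv ha haX hb hbX hα hαX
    hβ hβX)

/-- A finite class lies on one side of the strip if there is an infinite one. -/
lemma IsNCP.subset_or_subset_compl {n : ℕ} (hn : 0 < n) {X : Set ℤ}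
    (hX : ∀ z : ℤ, z + n ∈ X ↔ z ∈ X) {p : Setoid ℤ} (hp : IsNCP n X p) {x y : ℤ}
    (hx : {z | p x z}.Infinite) (hy : {z | p y z}.Finite) :
    (∀ b, p y b → b ∈ X) ∨ (∀ b, p y b → b ∈ Xᶜ) := by
  have hn' : (0 : ℤ) < n := by exact_mod_cast hn
  by_contra! h
  obtain ⟨⟨β, hβ, hβX⟩, b, hb, hbX⟩ := h
  rw [Set.mem_compl_iff, not_not] at hbX
  obtain ⟨⟨a, ha, haX⟩, α, hα, hαX⟩ := hp.meets x hx
  have hper : ∀ z, p x z → ∀ m : ℤ, p x (z + m * n) := fun z hz m =>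
    p.trans hz (hp.rel_add_mul_of_infinite hn hX (by rwa [← setOf_rel_eq hz]) m)
  have hxy : ¬ p x y := fun h => hx (by rwa [setOf_rel_eq h])
  -- The infinite part contains a chord from far left on `X` to far right on the other side, which
  -- would cross the chord of the finite part.
  have h1 : a + -(|a - b| + 1) * n < b := by nlinarith [le_abs_self (a - b), abs_nonneg (a - b)]
  have h2 : β < α + (|α - β| + 1) * n := by nlinarith [neg_abs_le (α - β), abs_nonneg (α - β)]
  have := hp.lt_of_lt_of_mixed hxy (hper a ha _) ((add_mul_mem_iff hX _ _).2 haX) hb hbX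
    (hper α hα (|α - β| + 1)) (mt (add_mul_mem_iff hX _ _).1 hαX) hβ hβX h1
  exact lt_asymm h2 this

lemma IsNCP.nonCrossingCycles_of_infX {n : ℕ} (hn : 0 < n) {X : Set ℤ}
    (hX : ∀ z : ℤ, z + n ∈ X ↔ z ∈ X) {p : Setoid ℤ} (hp : IsNCP n X p) {w : Perm ℤ}
    (hw : IsSucc X p w) {x y : ℤ} (hx : {z | p x z}.Infinite) (hy : {z | p y z}.Finite)
    {u v : Perm ℤ} (hu : IsRestriction w {z | p x z ∧ z ∈ X} u)
    (hv : IsRestriction w (translates n p y) v) : NonCrossingCycles n X Xᶜ u v := by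
  obtain ⟨A, hA, hc⟩ := hp.exists_isInfCycleX hn hX hw hx hu
  left
  rcases hp.subset_or_subset_compl hn hX hx hy with h | h
  · have hxy : ∀ m : ℤ, ¬ p x (y + m * n) := fun m h =>
      hx (by rw [setOf_rel_eq h]; exact hp.per.finite_add_mul hy m)
    have hsep : Unseparated n X p x y := by
      refine (hp.unseparated_or hX hxy h).resolve_right ?_
      rintro ⟨_, _, m, -, -, h'⟩
      obtain ⟨-, α, hα, hαX⟩ := hp.meets x hx
      exact hαX (h' α hα).2.2
    obtain ⟨A', h1, h2⟩ := hp.exists_inGapX hn hX hw hy h hsep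
      (fun a ha => ⟨hA a ha, hc.1.1 a ha⟩) hv
    exact Or.inr (Or.inr (Or.inr (Or.inl ⟨A, A', hc, h1, h2⟩)))
  · obtain ⟨B, h1, -⟩ := hp.exists_isFinCycle_right hn hX hw hy h hv 0
    exact Or.inl ⟨Or.inr ⟨A, hc⟩, Or.inl ⟨B, h1⟩⟩

lemma IsNCP.nonCrossingCycles_of_infXi {n : ℕ} (hn : 0 < n) {X : Set ℤ}
    (hX : ∀ z : ℤ, z + n ∈ X ↔ z ∈ X) {p : Setoid ℤ} (hp : IsNCP n X p) {w : Perm ℤ}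
    (hw : IsSucc X p w) {x y : ℤ} (hx : {z | p x z}.Infinite) (hy : {z | p y z}.Finite)
    {u v : Perm ℤ} (hu : IsRestriction w {z | p x z ∧ z ∉ X} u)
    (hv : IsRestriction w (translates n p y) v) : NonCrossingCycles n X Xᶜ u v := by
  obtain ⟨B, hB, hc⟩ := hp.exists_isInfCycleXi hn hX hw hx hu
  rcases hp.subset_or_subset_compl hn hX hx hy with h | h
  · obtain ⟨A, h1, -⟩ := hp.exists_isFinCycle_left hn hX hw hy h hv 0
    exact Or.inr (Or.inl ⟨Or.inl ⟨A, h1⟩, Or.inr ⟨B, hc⟩⟩)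
  · have hxy : ∀ m : ℤ, ¬ p x (y + m * n) := fun m h =>
      hx (by rw [setOf_rel_eq h]; exact hp.per.finite_add_mul hy m)
    have hsep : Unseparated n Xᶜ p x y := by
      refine (hp.compl.unseparated_or (fun z => not_congr (hX z)) hxy h).resolve_right ?_
      rintro ⟨_, _, m, -, -, h'⟩
      obtain ⟨⟨a, ha, haX⟩, -⟩ := hp.meets x hx
      exact (h' a ha).2.2 haX
    obtain ⟨B', h1, h2⟩ := hp.exists_inGapXi hn hX hw hy h hsep
      (fun a ha => ⟨hB a ha, hc.1.1 a ha⟩) hv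
    exact Or.inl (Or.inr (Or.inr (Or.inr (Or.inr ⟨B, B', hc, h1, h2⟩))))

/-! ### From partitions to products of cycles -/

/-- The supports of the cycles attached to a partition. -/
def IsCycleSupport (n : ℕ) (X : Set ℤ) (p : Setoid ℤ) (S : Set ℤ) : Prop :=
  ∃ x, ({z | p x z}.Finite ∧ S = translates n p x) ∨
    ({z | p x z}.Infinite ∧ (S = {z | p x z ∧ z ∈ X} ∨ S = {z | p x z ∧ z ∉ X}))

lemma translates_eq_of_mem {n : ℕ} {p : Setoid ℤ} (hp : IsPeriodicPartition n p) {x y z : ℤ}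
    (h : z ∈ translates n p x) (h' : z ∈ translates n p y) :
    translates n p x = translates n p y := by
  have key : ∀ {x z}, z ∈ translates n p x → translates n p x = translates n p z := by
    rintro x z ⟨m, hm⟩
    rw [← translates_add_mul hp z m]
    ext t
    exact exists_congr fun k => ⟨fun h => p.trans (p.symm hm) h, fun h => p.trans hm h⟩
  rw [key h, key h']

/-- Every support arises from a representative in `[0, n)`, because translating `x` by a multiple of
`n` changes neither its `translates` nor, if infinite, its part. -/
lemma IsNCP.finite_isCycleSupport {n : ℕ} (hn : 0 < n) {X : Set ℤ}
    (hX : ∀ z : ℤ, z + n ∈ X ↔ z ∈ X) {p : Setoid ℤ} (hp : IsNCP n X p) :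
    {S | IsCycleSupport n X p S}.Finite := by
  have hn' : (0 : ℤ) < n := by exact_mod_cast hn
  have hmod : ∀ x : ℤ, x % n + (x / n) * n = x := fun x => by
    rw [mul_comm]; exact Int.emod_add_mul_ediv x n
  have hmem : ∀ x : ℤ, x % n ∈ Set.Ico 0 (n : ℤ) := fun x =>
    ⟨Int.emod_nonneg _ hn'.ne', Int.emod_lt_of_pos _ hn'⟩
  have hI := Set.finite_Ico 0 (n : ℤ)
  refine (((hI.image (translates n p)).union (hI.image fun x => {z | p x z ∧ z ∈ X})).union
    (hI.image fun x => {z | p x z ∧ z ∉ X})).subset ?_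
  rintro S ⟨x, ⟨-, rfl⟩ | ⟨hx, h⟩⟩
  · refine Or.inl (Or.inl ⟨x % n, hmem x, ?_⟩)
    rw [← translates_add_mul hp.per (x % n) (x / n), hmod]
  · have hrel : p x (x % n) := by
      refine p.symm ?_
      have := hp.rel_add_mul_of_infinite hn hX (x := x % n)
        (by rwa [← hp.per.infinite_add_mul (x / n), hmod]) (x / n)
      rwa [hmod] at this
    have : ∀ z, p x z ↔ p (x % n) z := fun z =>
      ⟨fun h => p.trans (p.symm hrel) h, fun h => p.trans hrel h⟩
    simp only [this] at h
    rcases h with rfl | rfl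
    · exact Or.inl (Or.inr ⟨x % n, hmem x, rfl⟩)
    · exact Or.inr ⟨x % n, hmem x, rfl⟩

lemma exists_isCycleSupport {n : ℕ} {X : Set ℤ} {p : Setoid ℤ} (x : ℤ) :
    ∃ S, IsCycleSupport n X p S ∧ x ∈ S := by
  by_cases hx : {z | p x z}.Finite
  · exact ⟨_, ⟨x, Or.inl ⟨hx, rfl⟩⟩, 0, by simp⟩
  · by_cases hxX : x ∈ X
    · exact ⟨_, ⟨x, Or.inr ⟨hx, Or.inl rfl⟩⟩, p.refl x, hxX⟩
    · exact ⟨_, ⟨x, Or.inr ⟨hx, Or.inr rfl⟩⟩, p.refl x, hxX⟩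

/-- The translate `x + n` intervenes before the other side is reached. Hence the infinite part gives
one cycle on each side. -/
lemma IsNCP.mem_iff_of_infinite {n : ℕ} (hn : 0 < n) {X : Set ℤ}
    (hX : ∀ z : ℤ, z + n ∈ X ↔ z ∈ X) {p : Setoid ℤ} (hp : IsNCP n X p) {w : Perm ℤ}
    (hw : IsSucc X p w) {x : ℤ} (hx : {z | p x z}.Infinite) : w x ∈ X ↔ x ∈ X := by
  have hn' : (0 : ℤ) < n := by exact_mod_cast hn
  have h1 := hp.pos_lt_of_infinite hn hX hw hx
  constructor
  · intro h
    by_contra hc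
    rw [pos_lt_pos] at h1
    tauto
  · intro h
    by_contra hc
    have h2 := (hw x).2 (x + (1 : ℤ) * n) (hp.rel_add_mul_of_infinite hn hX hx 1)
    have h3 := (add_mul_mem_iff hX x 1).2 h
    simp only [pos_lt_pos, pos_le_pos, h3, h, hc] at h2
    simp at h2
    omega

lemma IsCycleSupport.apply_mem_iff {n : ℕ} (hn : 0 < n) {X : Set ℤ}
    (hX : ∀ z : ℤ, z + n ∈ X ↔ z ∈ X) {p : Setoid ℤ} (hp : IsNCP n X p) {w : Perm ℤ}
    (hw : IsSucc X p w) {S : Set ℤ} (hS : IsCycleSupport n X p S) (z : ℤ) : w z ∈ S ↔ z ∈ S := by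
  have hwz := (hw z).1
  obtain ⟨x, ⟨-, rfl⟩ | ⟨hx, h⟩⟩ := hS
  · refine exists_congr fun m => ?_
    have := (hp.per.add_mul _ _ m).2 hwz
    exact ⟨fun h => p.trans h (p.symm this), fun h => p.trans h this⟩
  · have h1 : p x (w z) ↔ p x z := ⟨fun h => p.trans h (p.symm hwz), fun h => p.trans h hwz⟩
    have h2 : p x z → (w z ∈ X ↔ z ∈ X) := fun h =>
      hp.mem_iff_of_infinite hn hX hw (by rwa [← setOf_rel_eq h])
    rcases h with rfl | rfl
    · change (p x (w z) ∧ w z ∈ X) ↔ (p x z ∧ z ∈ X)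
      rw [h1]
      exact and_congr_right h2
    · change (p x (w z) ∧ w z ∉ X) ↔ (p x z ∧ z ∉ X)
      rw [h1]
      exact and_congr_right fun h => not_congr (h2 h)

lemma IsCycleSupport.isPositiveCycle {n : ℕ} (hn : 0 < n) {X : Set ℤ}
    (hX : ∀ z : ℤ, z + n ∈ X ↔ z ∈ X) {p : Setoid ℤ} (hp : IsNCP n X p) {w : Perm ℤ}
    (hw : IsSucc X p w) {S : Set ℤ} (hS : IsCycleSupport n X p S) {u : Perm ℤ}
    (hu : IsRestriction w S u) : IsPositiveCycle n X Xᶜ u := by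
  obtain ⟨x, ⟨hx, rfl⟩ | ⟨hx, rfl | rfl⟩⟩ := hS
  · obtain ⟨A, B, hAB⟩ := hp.exists_isWordPair hn hX hx
    exact Or.inl ⟨A, B, hAB.isFinCycle hn hX hp hw hx hu⟩
  · obtain ⟨A, -, hA⟩ := hp.exists_isInfCycleX hn hX hw hx hu
    exact Or.inr (Or.inl ⟨A, hA⟩)
  · obtain ⟨B, -, hB⟩ := hp.exists_isInfCycleXi hn hX hw hx hu
    exact Or.inr (Or.inr ⟨B, hB⟩)

lemma setOf_rel_and_eq {p : Setoid ℤ} {x y : ℤ} (h : p x y) (q : ℤ → Prop) :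
    {z | p x z ∧ q z} = {z | p y z ∧ q z} :=
  Set.ext fun _ => and_congr_left fun _ =>
    ⟨fun hz => p.trans (p.symm h) hz, fun hz => p.trans h hz⟩

lemma IsPeriodicPartition.not_rel_of_finite_of_infinite {n : ℕ} {p : Setoid ℤ}
    (hp : IsPeriodicPartition n p) {x y : ℤ} (hx : {z | p x z}.Infinite)
    (hy : {z | p y z}.Finite) {z : ℤ} (hz : z ∈ translates n p y) : ¬ p x z := fun h => by
  obtain ⟨m, hm⟩ := hz
  refine (hp.infinite_add_mul m).2 (?_ : {t | p z t}.Infinite) ?_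
  · rwa [← setOf_rel_eq h]
  · rwa [← setOf_rel_eq hm]

lemma IsCycleSupport.disjoint_and_nonCrossing {n : ℕ} (hn : 0 < n) {X : Set ℤ}
    (hX : ∀ z : ℤ, z + n ∈ X ↔ z ∈ X) {p : Setoid ℤ} (hp : IsNCP n X p) {w : Perm ℤ}
    (hw : IsSucc X p w) {S T : Set ℤ} (hS : IsCycleSupport n X p S) (hT : IsCycleSupport n X p T)
    (hST : S ≠ T) {u v : Perm ℤ} (hu : IsRestriction w S u) (hv : IsRestriction w T v) :
    Disjoint S T ∧ NonCrossingCycles n X Xᶜ u v := by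
  obtain ⟨x, ⟨hx, rfl⟩ | ⟨hx, hS⟩⟩ := hS <;> obtain ⟨y, ⟨hy, rfl⟩ | ⟨hy, hT⟩⟩ := hT
  · refine ⟨Set.disjoint_left.2 fun z h h' => hST (translates_eq_of_mem hp.per h h'), ?_⟩
    refine hp.nonCrossingCycles_of_finite hn hX hw hx hy (fun m hm => hST ?_) hu hv
    exact translates_eq_of_mem hp.per ⟨m, hm⟩ ⟨0, by simp⟩
  · have := fun z => hp.per.not_rel_of_finite_of_infinite hy hx (z := z)
    rcases hT with rfl | rfl
    · exact ⟨Set.disjoint_left.2 fun z h h' => this z h h'.1,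
        (hp.nonCrossingCycles_of_infX hn hX hw hy hx hv hu).symm⟩
    · exact ⟨Set.disjoint_left.2 fun z h h' => this z h h'.1,
        (hp.nonCrossingCycles_of_infXi hn hX hw hy hx hv hu).symm⟩
  · have := fun z => hp.per.not_rel_of_finite_of_infinite hx hy (z := z)
    rcases hS with rfl | rfl
    · exact ⟨Set.disjoint_left.2 fun z h h' => this z h' h.1,
        hp.nonCrossingCycles_of_infX hn hX hw hx hy hu hv⟩
    · exact ⟨Set.disjoint_left.2 fun z h h' => this z h' h.1,
        hp.nonCrossingCycles_of_infXi hn hX hw hx hy hu hv⟩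
  · have hxy := hp.rel_of_infinite hn hX hx hy
    rcases hS with rfl | rfl <;> rcases hT with rfl | rfl
    · exact absurd (setOf_rel_and_eq hxy _) hST
    · obtain ⟨A, -, hA⟩ := hp.exists_isInfCycleX hn hX hw hx hu
      obtain ⟨B, -, hB⟩ := hp.exists_isInfCycleXi hn hX hw hy hv
      exact ⟨Set.disjoint_left.2 fun z h h' => h'.2 h.2,
        Or.inl (Or.inl ⟨Or.inr ⟨A, hA⟩, Or.inr ⟨B, hB⟩⟩)⟩
    · obtain ⟨B, -, hB⟩ := hp.exists_isInfCycleXi hn hX hw hx hu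
      obtain ⟨A, -, hA⟩ := hp.exists_isInfCycleX hn hX hw hy hv
      exact ⟨Set.disjoint_left.2 fun z h h' => h.2 h'.2,
        Or.inr (Or.inl ⟨Or.inr ⟨A, hA⟩, Or.inr ⟨B, hB⟩⟩)⟩
    · exact absurd (setOf_rel_and_eq hxy _) hST

/-- The permutation is the product of its restrictions to the finitely many supports, which are
stable under it and pairwise disjoint. -/
lemma IsNCP.isPositiveNonCrossing {n : ℕ} (hn : 0 < n) {X : Set ℤ}
    (hX : ∀ z : ℤ, z + n ∈ X ↔ z ∈ X) {p : Setoid ℤ} (hp : IsNCP n X p) {w : Perm ℤ}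
    (hw : IsSucc X p w) : IsPositiveNonCrossing n X Xᶜ w := by
  classical
  have hex : ∀ S, ∃ u, IsCycleSupport n X p S → IsRestriction w S u := fun S => by
    by_cases hS : IsCycleSupport n X p S
    · obtain ⟨u, hu⟩ := exists_isRestriction (hS.apply_mem_iff hn hX hp hw)
      exact ⟨u, fun _ => hu⟩
    · exact ⟨1, fun h => absurd h hS⟩
  choose u hu using hex
  set T := (hp.finite_isCycleSupport hn hX).toFinset with hT
  have hmem : ∀ S, S ∈ T.toList ↔ IsCycleSupport n X p S := fun S => by
    rw [Finset.mem_toList, hT, Set.Finite.mem_toFinset]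
    exact Iff.rfl
  have hpair : (T.toList.map u).Pairwise
      fun u v => Perm.Disjoint u v ∧ NonCrossingCycles n X Xᶜ u v := by
    rw [List.pairwise_map]
    refine List.Nodup.pairwise_of_forall_ne T.nodup_toList fun S hS S' hS' hne => ?_
    have h1 := (hmem S).1 hS
    have h2 := (hmem S').1 hS'
    obtain ⟨h3, h4⟩ := h1.disjoint_and_nonCrossing hn hX hp hw h2 hne (hu S h1) (hu S' h2)
    exact ⟨(hu S h1).disjoint (hu S' h2) h3, h4⟩
  refine ⟨T.toList.map u, fun v hv => ?_, hpair, Equiv.ext fun x => ?_⟩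
  · obtain ⟨S, hS, rfl⟩ := List.mem_map.1 hv
    have h1 := (hmem S).1 hS
    exact h1.isPositiveCycle hn hX hp hw (hu S h1)
  · obtain ⟨S, hS, hx⟩ := exists_isCycleSupport (n := n) (X := X) (p := p) x
    by_cases hwx : w x = x
    · rw [hwx]
      refine prod_apply_of_forall_fixed fun v hv => ?_
      obtain ⟨S', hS', rfl⟩ := List.mem_map.1 hv
      have h1 := hu S' ((hmem S').1 hS')
      by_cases h : x ∈ S'
      · rw [h1.1 x h, hwx]
      · exact h1.2 x h
    · have h1 := (hu S hS).1 x hx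
      rw [← h1]
      exact prod_apply_of_mem (hpair.imp fun h => h.1) (List.mem_map_of_mem ((hmem S).2 hS))
        (by rwa [h1])

/-! ### The isomorphism with non-crossing partitions -/

lemma IsNCP.of_partition {n : ℕ} {X : Set ℤ} (p : PeriodicNCPartition n X Xᶜ) :
    IsNCP n X p.1 := by
  obtain ⟨p, h1, h2, h3⟩ := p
  refine ⟨h1, isNonCrossingPartition_iff.1 h2, fun x hx => ?_⟩
  have hc : {y | p x y} = {y | p y x} := Set.ext fun y => ⟨p.symm, p.symm⟩
  rw [hc] at hx
  obtain ⟨⟨a, ha, haX⟩, ⟨b, hb, hbX⟩⟩ := h3 _ (p.mem_classes x) hx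
  exact ⟨⟨a, p.symm ha, haX⟩, ⟨b, p.symm hb, hbX⟩⟩

lemma IsNCP.infinite_classes {n : ℕ} {X : Set ℤ} {p : Setoid ℤ} (hp : IsNCP n X p) :
    ∀ A ∈ p.classes, A.Infinite → (A ∩ X).Nonempty ∧ (A ∩ Xᶜ).Nonempty := by
  rintro _ ⟨x, rfl⟩ hx
  have hc : {y | p y x} = {y | p x y} := Set.ext fun y => ⟨p.symm, p.symm⟩
  rw [hc] at hx ⊢
  obtain ⟨⟨a, ha, haX⟩, ⟨b, hb, hbX⟩⟩ := hp.meets x hx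
  exact ⟨⟨a, ha, haX⟩, ⟨b, hb, hbX⟩⟩

lemma DualGerm.isNCP_and_isSucc {n : ℕ} (hn : 0 < n) {X : Set ℤ}
    (hX : ∀ z : ℤ, z + n ∈ X ↔ z ∈ X) (w : DualGerm n X Xᶜ) :
    IsNCP n X (orbitPartition w.1) ∧ IsSucc X (orbitPartition w.1) w.1 := by
  obtain ⟨p, hp, hw⟩ := exists_isNCP_of_isPositiveNonCrossing hn hX w.2.2.2 w.2.2.1
  rw [hp.orbitPartition_eq hn hX hw]
  exact ⟨hp, hw⟩

/-- The element of the germ attached to a non-crossing partition. -/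
def IsNCP.toDualGerm {n : ℕ} (hn : 0 < n) {X : Set ℤ} (hX : ∀ z : ℤ, z + n ∈ X ↔ z ∈ X)
    {p : Setoid ℤ} (hp : IsNCP n X p) {w : Perm ℤ} (hw : IsSucc X p w) : DualGerm n X Xᶜ :=
  ⟨w, hw.isPeriodic hX hp.per, hp.totalShift_eq_zero hn hX hw, hp.isPositiveNonCrossing hn hX hw⟩

/-- The bijection `w ↦ p_w` between the germ and the non-crossing partitions. -/
noncomputable def germEquiv {n : ℕ} (hn : 0 < n) {X : Set ℤ} (hX : ∀ z : ℤ, z + n ∈ X ↔ z ∈ X) :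
    DualGerm n X Xᶜ ≃ PeriodicNCPartition n X Xᶜ :=
  Equiv.ofBijective
    (fun w => ⟨orbitPartition w.1, (w.isNCP_and_isSucc hn hX).1.per,
      isNonCrossingPartition_iff.2 (w.isNCP_and_isSucc hn hX).1.nc,
      (w.isNCP_and_isSucc hn hX).1.infinite_classes⟩) <| by
    constructor
    · intro v w h
      have h1 : orbitPartition v.1 = orbitPartition w.1 := congrArg Subtype.val h
      refine Subtype.ext ((v.isNCP_and_isSucc hn hX).2.unique ?_)
      rw [h1]
      exact (w.isNCP_and_isSucc hn hX).2
    · intro p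
      have hp := IsNCP.of_partition p
      obtain ⟨w, hw⟩ := hp.exists_isSucc hn hX
      exact ⟨hp.toDualGerm hn hX hw, Subtype.ext (hp.orbitPartition_eq hn hX hw)⟩

/-- Since length is the codimension of the fixed space, additivity of lengths is exactly the
dimension identity used in `le_of_mul_eq` and supplied by `IsNCP.exists_left_quotient`. -/
lemma leftDivides_iff {n : ℕ} (hn : 0 < n) {X : Set ℤ} (hX : ∀ z : ℤ, z + n ∈ X ↔ z ∈ X)
    (v w : DualGerm n X Xᶜ) : LeftDivides v w ↔ orbitPartition v.1 ≤ orbitPartition w.1 := by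
  obtain ⟨hp, hv⟩ := v.isNCP_and_isSucc hn hX
  obtain ⟨hq, hw⟩ := w.isNCP_and_isSucc hn hX
  have hlv := hp.reflLength_add hn hX hv
  have hlw := hq.reflLength_add hn hX hw
  constructor
  · rintro ⟨u, h, hl⟩
    obtain ⟨hr, hu⟩ := u.isNCP_and_isSucc hn hX
    have hlu := hr.reflLength_add hn hX hu
    exact (le_of_mul_eq hn hX hp hq hr hv hu hw h (by omega)).1
  · intro h
    obtain ⟨r, hr, hu, hd⟩ := hp.exists_left_quotient hn hX hq h hv hw
    have hlu := hr.reflLength_add hn hX hu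
    exact ⟨hr.toDualGerm hn hX hu, mul_inv_cancel_left _ _,
      show _ = _ + reflLength n (v.1⁻¹ * w.1) by omega⟩

lemma rightDivides_iff {n : ℕ} (hn : 0 < n) {X : Set ℤ} (hX : ∀ z : ℤ, z + n ∈ X ↔ z ∈ X)
    (v w : DualGerm n X Xᶜ) : RightDivides v w ↔ orbitPartition v.1 ≤ orbitPartition w.1 := by
  obtain ⟨hp, hv⟩ := v.isNCP_and_isSucc hn hX
  obtain ⟨hq, hw⟩ := w.isNCP_and_isSucc hn hX
  have hlv := hp.reflLength_add hn hX hv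
  have hlw := hq.reflLength_add hn hX hw
  constructor
  · rintro ⟨u, h, hl⟩
    obtain ⟨hr, hu⟩ := u.isNCP_and_isSucc hn hX
    have hlu := hr.reflLength_add hn hX hu
    exact (le_of_mul_eq hn hX hr hq hp hu hv hw h (by omega)).2
  · intro h
    obtain ⟨r, hr, hu, hd⟩ := hp.exists_right_quotient hn hX hq h hv hw
    have hlu := hr.reflLength_add hn hX hu
    exact ⟨hr.toDualGerm hn hX hu, inv_mul_cancel_right _ _,
      show _ = reflLength n (w.1 * v.1⁻¹) + _ by omega⟩

end AffineDual

theorem mainTheorem8 (n : ℕ) (hn : 0 < n) (X Ξ : Set ℤ) (hXΞ : IsCompl X Ξ)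
    (hX : X.Nonempty) (hΞ : Ξ.Nonempty)
    (hXn : ∀ z : ℤ, z + n ∈ X ↔ z ∈ X) (hΞn : ∀ z : ℤ, z + n ∈ Ξ ↔ z ∈ Ξ) :
    IsPartialOrder (AffineDual.DualGerm n X Ξ) AffineDual.LeftDivides ∧
    (∀ v w : AffineDual.DualGerm n X Ξ,
      AffineDual.LeftDivides v w ↔ AffineDual.RightDivides v w) ∧
    ∃ e : AffineDual.DualGerm n X Ξ ≃ AffineDual.PeriodicNCPartition n X Ξ,
      (∀ w : AffineDual.DualGerm n X Ξ, (e w).1 = AffineDual.orbitPartition w.1) ∧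
      (∀ v w : AffineDual.DualGerm n X Ξ, AffineDual.LeftDivides v w ↔ e v ≤ e w) := by
  obtain rfl := hXΞ.compl_eq
  have hleft : ∀ v w : AffineDual.DualGerm n X Xᶜ, AffineDual.LeftDivides v w ↔
      AffineDual.germEquiv hn hXn v ≤ AffineDual.germEquiv hn hXn w :=
    AffineDual.leftDivides_iff hn hXn
  refine ⟨{ refl := ?_, trans := ?_, antisymm := ?_ }, fun v w => ?_,
    AffineDual.germEquiv hn hXn, fun w => rfl, hleft⟩
  · exact fun v => (hleft v v).2 le_rfl
  · exact fun u v w h h' => (hleft u w).2 (((hleft u v).1 h).trans ((hleft v w).1 h'))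
  · exact fun v w h h' => (AffineDual.germEquiv hn hXn).injective
      (((hleft v w).1 h).antisymm ((hleft w v).1 h'))
  · rw [AffineDual.leftDivides_iff hn hXn, AffineDual.rightDivides_iff hn hXn]
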